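/- **Setting.** Let $d\ge 1$ and let $\Omega\subset\mathbb R^d$ be a bounded polyhedral domain with Lipschitz boundary. Let $\mathcal T_h$ be a conforming triangulation of $\overline\Omega$ by finitely many closed $d$-simplices $K$. Denote by $h_K$ the diameter of $K$, by $\rho_K$ the supremum of the diameters of the balls contained in $K$, put $h=\max_K h_K$, and let $S_K$ be the union of all simplices of $\mathcal T_h$ that touch $K$. Assume non-degeneracy, $h_K/\rho_K\le\gamma_0$ for all $K$, and quasi-uniformity, $h\le\kappa\,h_K$ for all $K$. Let $r_0\le r_1$, $\ell_0\le\ell$ and $m$ be non-negative integers with $\ell\le r_0+1$, and let $P_h$ be a linear operator from $W^{\ell_0,1}(\Omega)^d$ into the (not necessarily continuous) vector fields that are polynomials of degree at most $r_1$ on each $K\in\mathcal T_h$. Below, $\nabla^j$ of a field involving $P_hv$ is taken elementwise, i.e. as the weak gradient in the interior of each simplex; $|\cdot|$ is the Euclidean norm of tensors and $\|\cdot\|_s$ is the norm of $L^s(\Omega)$. Assume: (a) (local $W^{\ell,1}$-stability) there is a constant $A$ such that for all $K\in\mathcal T_h$ and all $v\in W^{\ell,1}(\Omega)^d$ $$\sum_{j=0}^m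 h_K^j\,\frac1{|K|}\int_K|\nabla^jP_hv|\,dx\le A\sum_{k=0}^\ell h_K^k\,\frac1{|S_K|}\int_{S_K}|\nabla^kv|\,dx;$$ (b) $P_hv=v$ for every vector field $v$ on $\Omega$ whose components are polynomials of degree at most $r_0$. **Proposition.** Let $r,q\in[1,\infty)$ be such that $W^{\ell,q}(\Omega)$ embeds compactly into $W^{m,r}(\Omega)$. Then for all $v\in W^{\ell,q}(\Omega)^d$ $$\sum_{j=0}^m h^j\,\|\nabla^j(v-P_hv)\|_r\le c\sum_{k=0}^\ell h^{\,\ell+d\min\{0,\frac1r-\frac1q\}}\,\|\nabla^kv\|_q ,$$ with a constant $c$ that depends only on $d,\ell,m,q,r,r_0,r_1,\gamma_0$, on the constants $A$ and $\kappa$, and, if $r<q$, on an upper bound for the volume $|\Omega|$. In particular $c$ depends neither on $h$, on the triangulation, on $\ell_0$, nor on $P_h$ and $v$. -/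

import Mathlib

open MeasureTheory Set Filter Topology
open scoped ENNReal ContDiff

/-- The Euclidean space `ℝ^d`. -/
abbrev E (d : ℕ) := EuclideanSpace ℝ (Fin d)

/-- Values of the `j`-th gradient of a vector field `ℝ^d → ℝ^d`: the families
`(∂_{i₁} ⋯ ∂_{i_j} u)` indexed by `i : Fin j → Fin d`, with the Euclidean (Frobenius) norm. -/
abbrev GradVal (d j : ℕ) := PiLp 2 (fun _ : Fin j → Fin d => E d)

/-- Measurable vector fields on `Ω`, up to equality almost everywhere. -/
abbrev VField {d : ℕ} (Ω : Set (E d)) := E d →ₘ[volume.restrict Ω] E d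

/-- The partial derivative `∂_{i₁} ⋯ ∂_{i_j} φ`. -/
noncomputable def partialD {d j : ℕ} (i : Fin j → Fin d) (φ : E d → ℝ) (x : E d) : ℝ :=
  iteratedFDeriv ℝ j φ x (fun t => EuclideanSpace.single (i t) (1 : ℝ))

/-- `U` is the `j`-th weak gradient of `u` on the open set `Ω`. -/
def IsWeakGrad {d : ℕ} (Ω : Set (E d)) (j : ℕ) (u : E d → E d) (U : E d → GradVal d j) : Prop :=
  LocallyIntegrableOn u Ω ∧ LocallyIntegrableOn U Ω ∧
    ∀ φ : E d → ℝ, ContDiff ℝ ∞ φ → HasCompactSupport φ → tsupport φ ⊆ Ω →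
      ∀ i : Fin j → Fin d,
        ∫ x in Ω, partialD i φ x • u x = (-1 : ℝ) ^ j • ∫ x in Ω, φ x • U x i

open Classical in
/-- The `j`-th weak gradient `∇^j u` on `Ω` (unique almost everywhere on `Ω` where it exists; it is
only used for fields that have one). -/
noncomputable def weakGrad {d : ℕ} (Ω : Set (E d)) (j : ℕ) (u : E d → E d) : E d → GradVal d j :=
  if h : ∃ U, IsWeakGrad Ω j u U then h.choose else 0

/-- Membership in `W^{k,p}(Ω)^d`. -/
def MemSob {d : ℕ} (Ω : Set (E d)) (k : ℕ) (p : ℝ≥0∞) (u : E d → E d) : Prop :=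
  ∀ j ≤ k, ∃ U, IsWeakGrad Ω j u U ∧ MemLp U p (volume.restrict Ω)

theorem continuous_partialD {d j : ℕ} (i : Fin j → Fin d) {φ : E d → ℝ} (hφ : ContDiff ℝ ∞ φ) :
    Continuous (partialD i φ) := by
  have h : Continuous (iteratedFDeriv ℝ j φ) :=
    hφ.continuous_iteratedFDeriv (by exact_mod_cast le_top)
  exact (ContinuousMultilinearMap.apply ℝ (fun _ : Fin j => E d) ℝ _).continuous.comp h

theorem support_partialD {d j : ℕ} (i : Fin j → Fin d) (φ : E d → ℝ) :
    Function.support (partialD i φ) ⊆ tsupport φ := by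
  intro x hx
  apply support_iteratedFDeriv_subset (𝕜 := ℝ) j
  intro h
  apply hx
  simp [partialD, h]

theorem integrableOn_smul_of_support {d : ℕ} {F : Type*} [NormedAddCommGroup F] [NormedSpace ℝ F]
    {Ω K : Set (E d)} {ψ : E d → ℝ} {u : E d → F} (hψ : Continuous ψ) (hK : IsCompact K)
    (hs : Function.support ψ ⊆ K) (hKΩ : K ⊆ Ω) (hu : LocallyIntegrableOn u Ω) :
    IntegrableOn (fun x => ψ x • u x) Ω := by
  have h1 : IntegrableOn u K := hu.integrableOn_compact_subset hKΩ hK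
  have h2 : IntegrableOn (fun x => ψ x • u x) K := h1.continuousOn_smul hψ.continuousOn hK
  refine Integrable.integrableOn ?_
  refine (integrableOn_iff_integrable_of_support_subset ?_).1 h2
  intro x hx
  apply hs
  intro h
  apply hx
  simp [h]

theorem locallyIntegrableOn_comp {d j : ℕ} {Ω : Set (E d)} {U : E d → GradVal d j}
    (hU : LocallyIntegrableOn U Ω) (i : Fin j → Fin d) :
    LocallyIntegrableOn (fun x => U x i) Ω := by
  exact (PiLp.proj (𝕜 := ℝ) 2 (fun _ : Fin j → Fin d => E d) i).locallyIntegrableOn_comp hU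

theorem IsWeakGrad.congr {d j : ℕ} {Ω : Set (E d)} {u v : E d → E d} {U : E d → GradVal d j}
    (h : IsWeakGrad Ω j u U) (huv : u =ᵐ[volume.restrict Ω] v) : IsWeakGrad Ω j v U := by
  refine ⟨h.1.congr huv, h.2.1, fun φ h1 h2 h3 i => ?_⟩
  rw [← h.2.2 φ h1 h2 h3 i]
  refine integral_congr_ae ?_
  filter_upwards [huv] with x hx
  rw [hx]

theorem IsWeakGrad.add {d j : ℕ} {Ω : Set (E d)} {u v : E d → E d} {U V : E d → GradVal d j}
    (hu : IsWeakGrad Ω j u U) (hv : IsWeakGrad Ω j v V) : IsWeakGrad Ω j (u + v) (U + V) := by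
  refine ⟨hu.1.add hv.1, hu.2.1.add hv.2.1, fun φ h1 h2 h3 i => ?_⟩
  have a1 := integrableOn_smul_of_support (continuous_partialD i h1) h2 (support_partialD i φ) h3
    hu.1
  have a2 := integrableOn_smul_of_support (continuous_partialD i h1) h2 (support_partialD i φ) h3
    hv.1
  have b1 := integrableOn_smul_of_support h1.continuous h2 (subset_tsupport φ) h3
    (locallyIntegrableOn_comp hu.2.1 i)
  have b2 := integrableOn_smul_of_support h1.continuous h2 (subset_tsupport φ) h3
    (locallyIntegrableOn_comp hv.2.1 i)
  simp only [Pi.add_apply, PiLp.add_apply, smul_add]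
  rw [integral_add a1 a2, integral_add b1 b2, hu.2.2 φ h1 h2 h3 i, hv.2.2 φ h1 h2 h3 i, smul_add]

theorem IsWeakGrad.smul {d j : ℕ} {Ω : Set (E d)} {u : E d → E d} {U : E d → GradVal d j}
    (hu : IsWeakGrad Ω j u U) (c : ℝ) : IsWeakGrad Ω j (c • u) (c • U) := by
  refine ⟨hu.1.smul c, hu.2.1.smul c, fun φ h1 h2 h3 i => ?_⟩
  simp only [Pi.smul_apply, PiLp.smul_apply, smul_comm _ c]
  rw [integral_smul, integral_smul, hu.2.2 φ h1 h2 h3 i, smul_comm]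

/-- The Sobolev space `W^{k,p}(Ω)^d`. -/
def sobolev {d : ℕ} (Ω : Set (E d)) (k : ℕ) (p : ℝ≥0∞) : Submodule ℝ (VField Ω) where
  carrier := {u | MemSob Ω k p u}
  zero_mem' := fun j _ => by
    refine ⟨0, IsWeakGrad.congr (u := 0) ⟨locallyIntegrableOn_zero, locallyIntegrableOn_zero, ?_⟩
      AEEqFun.coeFn_zero.symm, MemLp.zero⟩
    intro φ _ _ _ i
    simp
  add_mem' := fun {u v} hu hv j hj => by
    obtain ⟨U, hU, hU'⟩ := hu j hj
    obtain ⟨V, hV, hV'⟩ := hv j hj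
    exact ⟨U + V, (hU.add hV).congr (AEEqFun.coeFn_add u v).symm, hU'.add hV'⟩
  smul_mem' := fun c u hu j hj => by
    obtain ⟨U, hU, hU'⟩ := hu j hj
    exact ⟨c • U, (hU.smul c).congr (AEEqFun.coeFn_smul c u).symm, hU'.const_smul c⟩

/-- The seminorm `‖∇^j u‖_{L^p(Ω)}`. -/
noncomputable def gradNorm {d : ℕ} (Ω : Set (E d)) (j : ℕ) (p : ℝ≥0∞) (u : VField Ω) : ℝ≥0∞ :=
  eLpNorm (weakGrad Ω j u) p (volume.restrict Ω)

/-- The norm of `W^{k,p}(Ω)^d`. -/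
noncomputable def sobNorm {d : ℕ} (Ω : Set (E d)) (k : ℕ) (p : ℝ≥0∞) (u : VField Ω) : ℝ≥0∞ :=
  ∑ j ∈ Finset.range (k + 1), gradNorm Ω j p u

/-- The compact embedding of `W^{k,p}(Ω)` into `W^{m,r}(Ω)`: inclusion, and every bounded sequence
of the first space has a subsequence that converges in the second. -/
def CompactEmbedding {d : ℕ} (Ω : Set (E d)) (k : ℕ) (p : ℝ≥0∞) (m : ℕ) (r : ℝ≥0∞) : Prop :=
  sobolev Ω k p ≤ sobolev Ω m r ∧
    ∀ u : ℕ → VField Ω, (∀ n, u n ∈ sobolev Ω k p) →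
      (∃ M : ℝ≥0∞, M ≠ ⊤ ∧ ∀ n, sobNorm Ω k p (u n) ≤ M) →
      ∃ σ : ℕ → ℕ, StrictMono σ ∧ ∃ w ∈ sobolev Ω m r,
        Tendsto (fun n => sobNorm Ω m r (u (σ n) - w)) atTop (𝓝 0)

/-- Near every boundary point, `Ω` is the region on one side of the graph of a Lipschitz function,
in a suitable orthonormal system of coordinates (`e` is the direction of the last axis). -/
def HasLipschitzBoundary {d : ℕ} (Ω : Set (E d)) : Prop :=
  ∀ x ∈ frontier Ω, ∃ e : E d, ‖e‖ = 1 ∧ ∃ ε : ℝ, 0 < ε ∧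
    ∃ g : (ℝ ∙ e)ᗮ → ℝ, (∃ L, LipschitzWith L g) ∧
      ∀ y ∈ Metric.ball x ε,
        (y ∈ Ω ↔ g ((ℝ ∙ e)ᗮ.orthogonalProjectionOnto y) < inner ℝ e y)

/-- A (conforming) triangulation of the closure of `Ω` by finitely many `d`-dimensional simplices;
`faces` also contains their lower-dimensional faces. -/
structure Triangulation {d : ℕ} (Ω : Set (E d)) extends Geometry.SimplicialComplex ℝ (E d) where
  finite_faces : faces.Finite
  pure : ∀ s ∈ faces, ∃ t ∈ faces, s ⊆ t ∧ t.card = d + 1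
  space_eq : toSimplicialComplex.space = closure Ω

namespace Triangulation

variable {d : ℕ} {Ω : Set (E d)}

/-- The vertex sets of the `d`-dimensional simplices `K` of the triangulation. -/
def cells (T : Triangulation Ω) : Set (Finset (E d)) := {s ∈ T.faces | s.card = d + 1}

end Triangulation

/-- The closed simplex `K` with the given vertices. -/
def simplex {d : ℕ} (s : Finset (E d)) : Set (E d) := convexHull ℝ (s : Set (E d))

/-- `h_K`, the diameter of `K`. -/
noncomputable def cellDiam {d : ℕ} (s : Finset (E d)) : ℝ := Metric.diam (simplex s)

/-- `ρ_K`, the supremum of the diameters of the balls contained in `K`. -/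
noncomputable def cellRho {d : ℕ} (s : Finset (E d)) : ℝ :=
  sSup {t | ∃ x : E d, ∃ ρ : ℝ, 0 ≤ ρ ∧ Metric.closedBall x ρ ⊆ simplex s ∧ t = 2 * ρ}

namespace Triangulation

variable {d : ℕ} {Ω : Set (E d)}

/-- The mesh size `h = max_K h_K`. -/
noncomputable def meshSize (T : Triangulation Ω) : ℝ := ⨆ s : T.cells, cellDiam (s : Finset (E d))

/-- The patch `S_K`: the union of all simplices of the triangulation that touch `K`. -/
def patch (T : Triangulation Ω) (s : Finset (E d)) : Set (E d) :=
  ⋃ t ∈ {t ∈ T.cells | (simplex t ∩ simplex s).Nonempty}, simplex t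

/-- Non-degeneracy: `h_K / ρ_K ≤ γ₀` for all `K`. -/
def NonDegenerate (T : Triangulation Ω) (γ₀ : ℝ) : Prop :=
  ∀ s ∈ T.cells, cellDiam s / cellRho s ≤ γ₀

/-- `h ≤ κ h_K` for all `K` (while `h_K ≤ h` by definition of `h`). -/
def QuasiUniform (T : Triangulation Ω) (κ : ℝ) : Prop :=
  ∀ s ∈ T.cells, T.meshSize ≤ κ * cellDiam s

/-- The union of the interiors of the simplices, an open subset of `Ω` of full measure. -/
def interiors (T : Triangulation Ω) : Set (E d) := ⋃ s ∈ T.cells, interior (simplex s)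

/-- The elementwise gradient of order `j`: the weak gradient on the interior of every simplex. For
a field with a weak gradient on `Ω` it coincides with the latter almost everywhere, and for a
piecewise polynomial field it is the classical gradient on every simplex. -/
noncomputable def brokenGrad (T : Triangulation Ω) (j : ℕ) (u : VField Ω) : E d → GradVal d j :=
  weakGrad T.interiors j u

end Triangulation

/-- `p` is a vector field with polynomial components of total degree at most `k`. -/
def IsPolyField {d : ℕ} (k : ℕ) (p : E d → E d) : Prop :=
  ∃ Q : Fin d → MvPolynomial (Fin d) ℝ, (∀ i, (Q i).totalDegree ≤ k) ∧
    ∀ x i, p x i = MvPolynomial.eval (fun l => x l) (Q i)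

/-- `u` belongs to `P_k(T)^d`: on every simplex of `T` it is a polynomial of degree at most `k`
(continuity between simplices is not required). -/
def IsPiecewisePoly {d : ℕ} {Ω : Set (E d)} (T : Triangulation Ω) (k : ℕ) (u : VField Ω) : Prop :=
  ∀ s ∈ T.cells, ∃ p, IsPolyField k p ∧ ∀ᵐ x ∂volume.restrict Ω, x ∈ simplex s → u x = p x

/-- Local `W^{ℓ,1}`-stability of `P`, with constant `A`. -/
def LocallyStable {d : ℕ} {Ω : Set (E d)} (T : Triangulation Ω) {ℓ₀ : ℕ}
    (P : sobolev Ω ℓ₀ 1 →ₗ[ℝ] VField Ω) (ℓ m : ℕ) (A : ℝ) : Prop :=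
  ∀ v : sobolev Ω ℓ₀ 1, (v : VField Ω) ∈ sobolev Ω ℓ 1 → ∀ s ∈ T.cells,
    ∑ j ∈ Finset.range (m + 1),
        cellDiam s ^ j * ⨍ x in simplex s, ‖T.brokenGrad j (P v) x‖
      ≤ A * ∑ k ∈ Finset.range (ℓ + 1),
        cellDiam s ^ k * ⨍ x in T.patch s, ‖weakGrad Ω k (v : VField Ω) x‖

/-- `P v = v` for all polynomial fields `v` of degree at most `r₀` on `Ω`. -/
def ReproducesPoly {d : ℕ} {Ω : Set (E d)} {ℓ₀ : ℕ}
    (P : sobolev Ω ℓ₀ 1 →ₗ[ℝ] VField Ω) (r₀ : ℕ) : Prop :=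
  ∀ v : sobolev Ω ℓ₀ 1,
    (∃ p, IsPolyField r₀ p ∧ (v : VField Ω) =ᵐ[volume.restrict Ω] p) → P v = v

/-! The compact embedding enters only through two conditions on the exponents. Oscillating waves
show that it forces m ≤ ℓ (`CompactEmbedding.le_of_isOpen`). Rescaled bumps concentrating at a point
show that for q < r it forces the strict inequality d(1/q − 1/r) < ℓ − m
(`CompactEmbedding.lt_of_lt`). These conditions do not involve Ω, so the constant can be chosen from
them and cannot depend on the domain through its embedding constant.

On a cell K let Q be the polynomial field of degree below ℓ whose derivatives of order below ℓ have
the same mean values on K as those of v (`exists_polyField_integral_eq`). Since ℓ − 1 ≤ r₀, P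
reproduces Q, and v − Pv = (v − Q) − P(v − Q). The first term is handled by an iterated
Poincaré–Sobolev inequality on the convex set K (`IsMeanZeroJet.lpN_le`). Each step integrates along
segments and averages. It raises integrability by less than the critical Sobolev amount, which
suffices because the inequality above is strict. The second term is a polynomial on K: an inverse
estimate reduces its L^r norm to an L¹ norm, and local stability then reduces the matter to the L¹
norms of the derivatives of v − Q on the patch.

The patch need not be convex, so Q is compared with the mean polynomials of the other cells in it
(`Triangulation.exists_enorm_sub_le_of_touch`). Two cells with a common facet contain a full ball of
radius comparable to h about the barycentre of that facet
(`Triangulation.exists_ball_subset_union`). The mean polynomial of this ball is close to those of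
both cells, since on an overlap both approximate v and polynomials are controlled by their values on
a small ball. Two cells that merely touch have a common vertex and are joined by a chain of cells at
this vertex with consecutive common facets (`Triangulation.vertexGraph_preconnected`). The chain
exists because a Lipschitz domain is locally connected at its boundary and the faces of codimension
at least two do not separate. Comparison of volumes bounds its length.

Finally the cell estimates are summed. The patches overlap boundedly. For q ≤ r the inclusion of ℓ^q
in ℓ^r suffices; for r < q Hölder's inequality costs a power of the number of cells, which is at
most a multiple of |Ω| h^{-d}. -/

/-! ### Classical derivatives along lists of coordinate directions -/

section ListDerivatives

variable {d : ℕ} {F : Type*} [NormedAddCommGroup F] [NormedSpace ℝ F]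

/-- The derivative in the direction of the `a`-th coordinate axis. -/
noncomputable def coordD (a : Fin d) (u : E d → F) (x : E d) : F :=
  fderiv ℝ u x (EuclideanSpace.single a (1 : ℝ))

/-- Iterated coordinate derivatives along a list of directions. -/
noncomputable def listD (L : List (Fin d)) (u : E d → F) : E d → F := L.foldr coordD u

@[simp] theorem listD_nil (u : E d → F) : listD [] u = u := rfl

@[simp] theorem listD_cons (a : Fin d) (L : List (Fin d)) (u : E d → F) :
    listD (a :: L) u = coordD a (listD L u) := rfl

theorem listD_append (L L' : List (Fin d)) (u : E d → F) :
    listD (L ++ L') u = listD L (listD L' u) := by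
  simp [listD]

theorem contDiff_coordD (a : Fin d) {u : E d → F} (hu : ContDiff ℝ ∞ u) :
    ContDiff ℝ ∞ (coordD a u) :=
  (hu.fderiv_right (m := ∞) (by simp)).clm_apply contDiff_const

theorem contDiff_listD (L : List (Fin d)) {u : E d → F} (hu : ContDiff ℝ ∞ u) :
    ContDiff ℝ ∞ (listD L u) := by
  induction L with
  | nil => exact hu
  | cons a L ih => exact contDiff_coordD a ih

theorem support_coordD_subset (a : Fin d) (u : E d → F) :
    Function.support (coordD a u) ⊆ tsupport u := by
  intro x hx
  apply support_fderiv_subset (𝕜 := ℝ)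
  intro h
  apply hx
  simp [coordD, h]

theorem tsupport_coordD_subset (a : Fin d) (u : E d → F) :
    tsupport (coordD a u) ⊆ tsupport u :=
  closure_minimal (support_coordD_subset a u) (isClosed_tsupport u)

theorem tsupport_listD_subset (L : List (Fin d)) (u : E d → F) :
    tsupport (listD L u) ⊆ tsupport u := by
  induction L with
  | nil => exact subset_rfl
  | cons a L ih => exact (tsupport_coordD_subset a _).trans ih

theorem hasCompactSupport_coordD (a : Fin d) {u : E d → F} (hu : HasCompactSupport u) :
    HasCompactSupport (coordD a u) :=
  hu.of_isClosed_subset (isClosed_tsupport _) (tsupport_coordD_subset a u)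

theorem coordD_comm (a b : Fin d) {u : E d → F} (hu : ContDiff ℝ ∞ u) :
    coordD a (coordD b u) = coordD b (coordD a u) := by
  funext x
  have hd : Differentiable ℝ (fderiv ℝ u) :=
    (hu.fderiv_right (m := ∞) (by simp)).differentiable (by simp)
  have key : ∀ a b : Fin d, coordD a (coordD b u) x
      = fderiv ℝ (fderiv ℝ u) x (EuclideanSpace.single a 1) (EuclideanSpace.single b 1) := by
    intro a b
    change fderiv ℝ (fun y => fderiv ℝ u y (EuclideanSpace.single b (1 : ℝ))) x _ = _
    rw [fderiv_clm_apply (hd x) (differentiableAt_const _)]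
    simp
  rw [key, key]
  exact second_derivative_symmetric (f := u) (f' := fderiv ℝ u)
    (fun y => (hu.differentiable (by simp) y).hasFDerivAt) (hd x).hasFDerivAt _ _

/-- Symmetry of second derivatives settles adjacent transpositions, which generate all permutations.
The symmetry of the coefficients of the mean polynomials rests on this. -/
theorem listD_perm {L L' : List (Fin d)} (h : L.Perm L') {u : E d → F} (hu : ContDiff ℝ ∞ u) :
    listD L u = listD L' u := by
  induction h with
  | nil => rfl
  | cons a _ ih => simp [ih]
  | swap a b L => exact coordD_comm _ _ (contDiff_listD L hu)
  | trans _ _ ih1 ih2 => exact ih1.trans ih2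

/-- Weak gradients are tested with the multilinear form of the derivative; lists of directions are
easier to permute, split and peel off. -/
theorem iteratedFDeriv_eq_listD {j : ℕ} (i : Fin j → Fin d) {u : E d → F} (hu : ContDiff ℝ ∞ u)
    (x : E d) :
    iteratedFDeriv ℝ j u x (fun t => EuclideanSpace.single (i t) (1 : ℝ))
      = listD (List.ofFn i) u x := by
  induction j generalizing x with
  | zero => simp
  | succ j ih =>
    rw [List.ofFn_succ, listD_cons, iteratedFDeriv_succ_apply_left]
    have h1 : listD (List.ofFn fun t => i t.succ) u = fun y => iteratedFDeriv ℝ j u y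
        (fun t => EuclideanSpace.single (i t.succ) (1 : ℝ)) := by
      funext y
      exact (ih (fun t => i t.succ) y).symm
    rw [coordD, h1]
    have hd : DifferentiableAt ℝ (iteratedFDeriv ℝ j u) x :=
      (hu.differentiable_iteratedFDeriv (by exact_mod_cast ENat.natCast_lt_top j)) x
    have h2 : HasFDerivAt (fun y => iteratedFDeriv ℝ j u y
        (fun t => EuclideanSpace.single (i t.succ) (1 : ℝ)))
        ((ContinuousMultilinearMap.apply ℝ (fun _ : Fin j => E d) F
          (fun t => EuclideanSpace.single (i t.succ) (1 : ℝ))).comp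
          (fderiv ℝ (iteratedFDeriv ℝ j u) x)) x :=
      (ContinuousMultilinearMap.apply ℝ (fun _ : Fin j => E d) F
          (fun t => EuclideanSpace.single (i t.succ) (1 : ℝ))).hasFDerivAt.comp x hd.hasFDerivAt
    rw [h2.fderiv]
    rfl

theorem partialD_eq_listD {j : ℕ} (i : Fin j → Fin d) {φ : E d → ℝ} (hφ : ContDiff ℝ ∞ φ) :
    partialD i φ = listD (List.ofFn i) φ :=
  funext fun x => iteratedFDeriv_eq_listD i hφ x

theorem integral_coordD_smul [CompleteSpace F] (a : Fin d) {φ : E d → ℝ} {u : E d → F}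
    (hφ : ContDiff ℝ ∞ φ) (hc : HasCompactSupport φ) (hu : ContDiff ℝ ∞ u) :
    ∫ x, coordD a φ x • u x = - ∫ x, φ x • coordD a u x := by
  have hi : ∀ {ψ : E d → ℝ} {w : E d → F}, ContDiff ℝ ∞ ψ → HasCompactSupport ψ →
      ContDiff ℝ ∞ w → Integrable (fun x => ψ x • w x) := fun h1 h2 h3 =>
    (h1.continuous.smul h3.continuous).integrable_of_hasCompactSupport h2.smul_right
  rw [eq_neg_iff_add_eq_zero, ← neg_eq_iff_add_eq_zero]
  exact (integral_smul_fderiv_eq_neg_fderiv_smul_of_integrable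
    (hi (contDiff_coordD a hφ) (hasCompactSupport_coordD a hc) hu)
    (hi hφ hc (contDiff_coordD a hu)) (hi hφ hc hu)
    (fun x _ => hφ.differentiable (by simp) x) (fun x _ => hu.differentiable (by simp) x)).symm

theorem integral_listD_smul [CompleteSpace F] (L : List (Fin d)) {φ : E d → ℝ} {u : E d → F}
    (hφ : ContDiff ℝ ∞ φ) (hc : HasCompactSupport φ) (hu : ContDiff ℝ ∞ u) :
    ∫ x, listD L φ x • u x = (-1 : ℝ) ^ L.length • ∫ x, φ x • listD L u x := by
  induction L generalizing φ u with
  | nil => simp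
  | cons a L ih =>
    -- The outermost direction is moved innermost, so that the induction hypothesis applies to
    -- `coordD a φ` as a test function.
    have hp : listD (a :: L) φ = listD L (coordD a φ) := by
      rw [← listD_perm (List.perm_append_singleton a L) hφ, listD_append]
      rfl
    rw [hp, ih (contDiff_coordD a hφ) (hasCompactSupport_coordD a hc) hu,
      integral_coordD_smul a hφ hc (contDiff_listD L hu), List.length_cons, pow_succ]
    simp [smul_neg]

end ListDerivatives

/-! ### Weak gradients: uniqueness, locality and symmetry -/

section WeakGradients

variable {d : ℕ} {Ω D : Set (E d)} {j : ℕ}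

/-- The classical `j`-th gradient. -/
noncomputable def classGrad (j : ℕ) (u : E d → E d) (x : E d) : GradVal d j :=
  WithLp.toLp 2 fun i : Fin j → Fin d => listD (List.ofFn i) u x

theorem continuous_classGrad (j : ℕ) {u : E d → E d} (hu : ContDiff ℝ ∞ u) :
    Continuous (classGrad j u) := by
  refine (PiLp.continuous_toLp 2 _).comp (continuous_pi fun i => ?_)
  exact (contDiff_listD _ hu).continuous

theorem setIntegral_smul_of_tsupport_subset {F : Type*} [NormedAddCommGroup F] [NormedSpace ℝ F]
    {φ : E d → ℝ} (h : Function.support φ ⊆ Ω) (f : E d → F) :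
    ∫ x in Ω, φ x • f x = ∫ x, φ x • f x := by
  apply setIntegral_eq_integral_of_forall_compl_eq_zero
  intro x hx
  have : φ x = 0 := by
    by_contra h0
    exact hx (h h0)
  simp [this]

theorem isWeakGrad_of_contDiff (j : ℕ) {u : E d → E d} (hu : ContDiff ℝ ∞ u) :
    IsWeakGrad Ω j u (classGrad j u) := by
  refine ⟨hu.continuous.locallyIntegrable.locallyIntegrableOn _,
    (continuous_classGrad j hu).locallyIntegrable.locallyIntegrableOn _, ?_⟩
  intro φ h1 h2 h3 i
  rw [setIntegral_smul_of_tsupport_subset ((support_partialD i φ).trans h3),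
    setIntegral_smul_of_tsupport_subset ((subset_tsupport φ).trans h3), partialD_eq_listD i h1,
    integral_listD_smul _ h1 h2 hu]
  simp [classGrad]

theorem IsWeakGrad.mono {u : E d → E d} {U : E d → GradVal d j} (h : IsWeakGrad Ω j u U)
    (hD : D ⊆ Ω) : IsWeakGrad D j u U := by
  refine ⟨h.1.mono_set hD, h.2.1.mono_set hD, fun φ h1 h2 h3 i => ?_⟩
  have := h.2.2 φ h1 h2 (h3.trans hD) i
  rwa [setIntegral_smul_of_tsupport_subset ((support_partialD i φ).trans (h3.trans hD)),
    setIntegral_smul_of_tsupport_subset ((subset_tsupport φ).trans (h3.trans hD)),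
    ← setIntegral_smul_of_tsupport_subset ((support_partialD i φ).trans h3),
    ← setIntegral_smul_of_tsupport_subset ((subset_tsupport φ).trans h3)] at this

theorem ae_eq_of_setIntegral_smul_eq {F : Type*} [NormedAddCommGroup F] [NormedSpace ℝ F]
    [CompleteSpace F] {f g : E d → F}
    (hΩ : IsOpen Ω) (hf : LocallyIntegrableOn f Ω) (hg : LocallyIntegrableOn g Ω)
    (h : ∀ φ : E d → ℝ, ContDiff ℝ ∞ φ → HasCompactSupport φ → tsupport φ ⊆ Ω →
      ∫ x in Ω, φ x • f x = ∫ x in Ω, φ x • g x) : f =ᵐ[volume.restrict Ω] g := by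
  have key := hΩ.ae_eq_zero_of_integral_contDiff_smul_eq_zero (hf.sub hg) (fun φ h1 h2 h3 => by
    have e := h φ h1 h2 h3
    rw [← setIntegral_smul_of_tsupport_subset ((subset_tsupport φ).trans h3)]
    simp only [Pi.sub_apply, smul_sub]
    rw [integral_sub, e, sub_self]
    · exact integrableOn_smul_of_support h1.continuous h2 (subset_tsupport φ) h3 hf
    · exact integrableOn_smul_of_support h1.continuous h2 (subset_tsupport φ) h3 hg)
  rw [Filter.EventuallyEq, ae_restrict_iff' hΩ.measurableSet]
  filter_upwards [key] with x hx hxΩ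
  exact sub_eq_zero.1 (hx hxΩ)

/-- The derivative of a test function is insensitive to the order of the directions, so both
components satisfy the same identities. The orders j and k are independent variables so that lengths
of two permuted lists can be inserted without a cast. -/
theorem IsWeakGrad.apply_ae_eq {u : E d → E d} {j k : ℕ} {U : E d → GradVal d j}
    {V : E d → GradVal d k} (hΩ : IsOpen Ω) (hU : IsWeakGrad Ω j u U) (hV : IsWeakGrad Ω k u V)
    {i : Fin j → Fin d} {i' : Fin k → Fin d} (hi : (List.ofFn i).Perm (List.ofFn i')) :
    (fun x => U x i) =ᵐ[volume.restrict Ω] fun x => V x i' := by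
  refine ae_eq_of_setIntegral_smul_eq hΩ (locallyIntegrableOn_comp hU.2.1 i)
    (locallyIntegrableOn_comp hV.2.1 i') fun φ h1 h2 h3 => ?_
  have e1 := hU.2.2 φ h1 h2 h3 i
  have e2 := hV.2.2 φ h1 h2 h3 i'
  have hjk : j = k := by simpa using hi.length_eq
  rw [partialD_eq_listD i h1, listD_perm hi h1, ← partialD_eq_listD i' h1, e2] at e1
  obtain rfl := hjk
  have hne : ((-1 : ℝ) ^ j) ≠ 0 := by simp
  exact (smul_right_injective _ hne e1).symm

theorem IsWeakGrad.ae_eq {u : E d → E d} {U V : E d → GradVal d j} (hΩ : IsOpen Ω)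
    (hU : IsWeakGrad Ω j u U) (hV : IsWeakGrad Ω j u V) : U =ᵐ[volume.restrict Ω] V := by
  have : ∀ i, (fun x => U x i) =ᵐ[volume.restrict Ω] fun x => V x i := fun i =>
    hU.apply_ae_eq hΩ hV (List.Perm.refl _)
  filter_upwards [ae_all_iff.2 this] with x hx
  ext1 i
  exact hx i

theorem isWeakGrad_weakGrad {u : E d → E d} {U : E d → GradVal d j} (h : IsWeakGrad Ω j u U) :
    IsWeakGrad Ω j u (weakGrad Ω j u) := by
  have hex : ∃ U, IsWeakGrad Ω j u U := ⟨U, h⟩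
  rw [weakGrad, dif_pos hex]
  exact hex.choose_spec

theorem weakGrad_ae_eq {u : E d → E d} {U : E d → GradVal d j} (hΩ : IsOpen Ω)
    (h : IsWeakGrad Ω j u U) : weakGrad Ω j u =ᵐ[volume.restrict Ω] U :=
  (isWeakGrad_weakGrad h).ae_eq hΩ h

theorem IsWeakGrad.neg {u : E d → E d} {U : E d → GradVal d j} (h : IsWeakGrad Ω j u U) :
    IsWeakGrad Ω j (-u) (-U) := by
  simpa using h.smul (-1)

theorem IsWeakGrad.sub {u v : E d → E d} {U V : E d → GradVal d j}
    (hu : IsWeakGrad Ω j u U) (hv : IsWeakGrad Ω j v V) : IsWeakGrad Ω j (u - v) (U - V) := by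
  simpa [sub_eq_add_neg] using hu.add hv.neg

/-- The `(j+1)`-st weak gradient contains the first weak derivatives of the `j`-th one. -/
theorem IsWeakGrad.integral_coordD_smul {u : E d → E d} {U : E d → GradVal d j}
    {V : E d → GradVal d (j + 1)} (hU : IsWeakGrad Ω j u U) (hV : IsWeakGrad Ω (j + 1) u V)
    {φ : E d → ℝ} (h1 : ContDiff ℝ ∞ φ) (h2 : HasCompactSupport φ) (h3 : tsupport φ ⊆ Ω)
    (a : Fin d) (i : Fin j → Fin d) :
    ∫ x in Ω, coordD a φ x • U x i
      = - ∫ x in Ω, φ x • V x (Fin.snoc (α := fun _ => Fin d) i a) := by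
  have e1 := hU.2.2 (coordD a φ) (contDiff_coordD a h1) (hasCompactSupport_coordD a h2)
    ((tsupport_coordD_subset a φ).trans h3) i
  have e2 := hV.2.2 φ h1 h2 h3 (Fin.snoc (α := fun _ => Fin d) i a)
  -- The last index is the direction that acts first, so a further derivative of the test function
  -- is appended at the end.
  have e3 : partialD i (coordD a φ) = partialD (Fin.snoc (α := fun _ => Fin d) i a) φ := by
    have hL : List.ofFn (Fin.snoc (α := fun _ => Fin d) i a) = List.ofFn i ++ [a] := by
      rw [List.ofFn_succ']
      simp
    rw [partialD_eq_listD _ h1, partialD_eq_listD _ (contDiff_coordD a h1), hL, listD_append]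
    rfl
  rw [e3, e2, pow_succ, mul_smul, neg_one_smul] at e1
  have hne : ((-1 : ℝ) ^ j) ≠ 0 := by simp
  exact (smul_right_injective _ hne e1).symm

end WeakGradients

/-! ### Weak gradients on disjoint unions of open sets -/

section Gluing

variable {d : ℕ}

/-- Near a point of the support of φ, which lies in exactly one of the disjoint open sets, the
truncated function is either φ or zero; elsewhere φ vanishes locally. A test function on the union
therefore splits into test functions on the pieces. -/
theorem contDiff_indicator_of_tsupport_subset_iUnion {ι : Type*} {O : ι → Set (E d)}
    (hO : ∀ s, IsOpen (O s)) (hdisj : Pairwise fun s t => Disjoint (O s) (O t)) {φ : E d → ℝ}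
    (h1 : ContDiff ℝ ∞ φ) (h2 : HasCompactSupport φ) (h3 : tsupport φ ⊆ ⋃ s, O s) (s : ι) :
    ContDiff ℝ ∞ ((O s).indicator φ) ∧ HasCompactSupport ((O s).indicator φ) ∧
      tsupport ((O s).indicator φ) ⊆ O s := by
  have hsub : tsupport ((O s).indicator φ) ⊆ tsupport φ :=
    closure_mono (by simp [Set.support_indicator])
  refine ⟨?_, h2.of_isClosed_subset (isClosed_tsupport _) hsub, ?_⟩
  · rw [contDiff_iff_contDiffAt]
    intro x
    by_cases hx : x ∈ tsupport φ
    · obtain ⟨t, ht⟩ := mem_iUnion.1 (h3 hx)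
      by_cases hst : s = t
      · subst hst
        refine h1.contDiffAt.congr_of_eventuallyEq ?_
        filter_upwards [(hO s).mem_nhds ht] with y hy
        exact indicator_of_mem hy _
      · refine contDiffAt_const (c := (0 : ℝ)) |>.congr_of_eventuallyEq ?_
        filter_upwards [(hO t).mem_nhds ht] with y hy
        exact indicator_of_notMem (fun h => disjoint_left.1 (hdisj hst) h hy) _
    · refine contDiffAt_const (c := (0 : ℝ)) |>.congr_of_eventuallyEq ?_
      filter_upwards [(isClosed_tsupport φ).isOpen_compl.mem_nhds hx] with y hy
      have : φ y = 0 := image_eq_zero_of_notMem_tsupport hy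
      simp [indicator, this]
  · intro x hx
    obtain ⟨t, ht⟩ := mem_iUnion.1 (h3 (hsub hx))
    by_cases hst : s = t
    · exact hst ▸ ht
    · exfalso
      obtain ⟨y, hy1, hy2⟩ := mem_closure_iff.1 hx _ (hO t) ht
      have hy3 : y ∈ O s := by
        by_contra hn
        exact hy2 (indicator_of_notMem hn _)
      exact disjoint_left.1 (hdisj hst) hy3 hy1

-- For a piecewise polynomial field this supplies a weak gradient on the union of the open cells, so
-- that the elementwise gradient is not the default value of `weakGrad`.
open Classical in
theorem exists_isWeakGrad_iUnion {ι : Type*} [Finite ι] {O : ι → Set (E d)}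
    (hO : ∀ s, IsOpen (O s)) (hdisj : Pairwise fun s t => Disjoint (O s) (O t)) {j : ℕ}
    {u : E d → E d} {V : ι → E d → GradVal d j} (hV : ∀ s, IsWeakGrad (O s) j u (V s)) :
    ∃ W, IsWeakGrad (⋃ s, O s) j u W ∧ ∀ s, ∀ x ∈ O s, W x = V s x := by
  have : Fintype ι := Fintype.ofFinite ι
  let W : E d → GradVal d j := fun x => if h : ∃ s, x ∈ O s then V h.choose x else 0
  have hW : ∀ s, ∀ x ∈ O s, W x = V s x := by
    intro s x hx
    have h : ∃ s, x ∈ O s := ⟨s, hx⟩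
    have hs : h.choose = s := by
      by_contra hne
      exact disjoint_left.1 (hdisj hne) h.choose_spec hx
    simp only [W, dif_pos h, hs]
  have hmem : ∀ s, ∀ x ∈ O s, O s ∈ 𝓝 x := fun s x hx => (hO s).mem_nhds hx
  have hloc : ∀ {G : Type} [NormedAddCommGroup G] (f : E d → G) (g : ι → E d → G),
      (∀ s, LocallyIntegrableOn (g s) (O s)) → (∀ s, ∀ x ∈ O s, f x = g s x) →
      LocallyIntegrableOn f (⋃ s, O s) := by
    intro G _ f g hg hfg x hx
    obtain ⟨s, hs⟩ := mem_iUnion.1 hx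
    obtain ⟨t, ht, hint⟩ := hg s x hs
    rw [(hO s).nhdsWithin_eq hs] at ht
    refine ⟨t ∩ O s, mem_nhdsWithin_of_mem_nhds (inter_mem ht (hmem s x hs)), ?_⟩
    refine (hint.mono_set inter_subset_left).congr ?_
    have h1 : ∀ᵐ y ∂volume.restrict (O s), g s y = f y :=
      ae_restrict_of_forall_mem (hO s).measurableSet fun y hy => (hfg s y hy).symm
    exact ae_mono (Measure.restrict_mono inter_subset_right le_rfl) h1
  refine ⟨W, ⟨hloc u (fun _ => u) (fun s => (hV s).1) fun _ _ _ => rfl,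
    hloc W V (fun s => (hV s).2.1) hW, ?_⟩, hW⟩
  intro φ h1 h2 h3 i
  have hWi := hloc W V (fun s => (hV s).2.1) hW
  have hui := hloc u (fun _ => u) (fun s => (hV s).1) fun _ _ _ => rfl
  have a1 := integrableOn_smul_of_support (continuous_partialD i h1) h2 (support_partialD i φ) h3
    hui
  have a2 := integrableOn_smul_of_support h1.continuous h2 (subset_tsupport φ) h3
    (locallyIntegrableOn_comp hWi i)
  rw [integral_iUnion_fintype (fun s => (hO s).measurableSet) hdisj
      (fun s => a1.mono_set (subset_iUnion O s)),
    integral_iUnion_fintype (fun s => (hO s).measurableSet) hdisj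
      (fun s => a2.mono_set (subset_iUnion O s)), Finset.smul_sum]
  refine Finset.sum_congr rfl fun s _ => ?_
  obtain ⟨b1, b2, b3⟩ := contDiff_indicator_of_tsupport_subset_iUnion hO hdisj h1 h2 h3 s
  have e := (hV s).2.2 _ b1 b2 b3 i
  have e1 : ∫ x in O s, partialD i ((O s).indicator φ) x • u x
      = ∫ x in O s, partialD i φ x • u x := by
    refine setIntegral_congr_fun (hO s).measurableSet fun x hx => ?_
    have hev : (O s).indicator φ =ᶠ[𝓝 x] φ := by
      filter_upwards [hmem s x hx] with y hy
      exact indicator_of_mem hy _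
    simp only [partialD, hev.iteratedFDeriv ℝ j |>.eq_of_nhds]
  have e2 : ∫ x in O s, (O s).indicator φ x • V s x i = ∫ x in O s, φ x • W x i := by
    refine setIntegral_congr_fun (hO s).measurableSet fun x hx => ?_
    simp only [indicator_of_mem hx, hW s x hx]
  rw [← e1, e, e2]

end Gluing

/-! ### Polynomial fields with prescribed mean derivatives -/

section PolynomialFields

variable {d : ℕ}

/-- The vector field with the given polynomial components. -/
noncomputable def polyField (Q : Fin d → MvPolynomial (Fin d) ℝ) (x : E d) : E d :=
  WithLp.toLp 2 fun c => MvPolynomial.eval (fun l => x l) (Q c)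

@[simp] theorem polyField_apply (Q : Fin d → MvPolynomial (Fin d) ℝ) (x : E d) (c : Fin d) :
    polyField Q x c = MvPolynomial.eval (fun l => x l) (Q c) := rfl

theorem isPolyField_iff {k : ℕ} {p : E d → E d} :
    IsPolyField k p ↔ ∃ Q : Fin d → MvPolynomial (Fin d) ℝ,
      (∀ i, (Q i).totalDegree ≤ k) ∧ p = polyField Q := by
  constructor
  · rintro ⟨Q, h1, h2⟩
    exact ⟨Q, h1, by funext x; ext i; exact h2 x i⟩
  · rintro ⟨Q, h1, rfl⟩
    exact ⟨Q, h1, fun x i => rfl⟩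

theorem hasFDerivAt_mvPolynomial_eval (p : MvPolynomial (Fin d) ℝ) (x : E d) :
    HasFDerivAt (fun y : E d => MvPolynomial.eval (fun l => y l) p)
      (∑ a, MvPolynomial.eval (fun l => x l) (MvPolynomial.pderiv a p) •
        (EuclideanSpace.proj a : E d →L[ℝ] ℝ)) x := by
  induction p using MvPolynomial.induction_on with
  | C c => simpa using hasFDerivAt_const c x
  | add p q hp hq =>
    simp only [map_add, add_smul, Finset.sum_add_distrib]
    exact hp.add hq
  | mul_X p b hp =>
    have hX : HasFDerivAt (fun y : E d => y b) (EuclideanSpace.proj b : E d →L[ℝ] ℝ) x :=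
      (EuclideanSpace.proj b : E d →L[ℝ] ℝ).hasFDerivAt
    have := hp.mul hX
    simp only [map_mul, MvPolynomial.eval_X]
    refine this.congr_fderiv ?_
    simp only [Derivation.leibniz, smul_eq_mul, map_add, map_mul, MvPolynomial.eval_X,
      MvPolynomial.pderiv_X, add_smul, Finset.sum_add_distrib, Finset.smul_sum, smul_smul]
    congr 1
    rw [Finset.sum_eq_single b]
    · simp
    · intro c _ hc
      simp [hc]
    · simp

theorem coordD_mvPolynomial_eval (a : Fin d) (p : MvPolynomial (Fin d) ℝ) :
    coordD a (fun y : E d => MvPolynomial.eval (fun l => y l) p)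
      = fun y => MvPolynomial.eval (fun l => y l) (MvPolynomial.pderiv a p) := by
  funext x
  rw [coordD, (hasFDerivAt_mvPolynomial_eval p x).fderiv]
  simp [PiLp.single_apply]

theorem contDiff_mvPolynomial_eval (p : MvPolynomial (Fin d) ℝ) :
    ContDiff ℝ ∞ (fun y : E d => MvPolynomial.eval (fun l => y l) p) := by
  induction p using MvPolynomial.induction_on with
  | C c => simpa using contDiff_const
  | add p q hp hq => simpa using hp.add hq
  | mul_X p b hp =>
    have hX : ContDiff ℝ ∞ (fun y : E d => y b) :=
      (EuclideanSpace.proj b : E d →L[ℝ] ℝ).contDiff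
    simpa using hp.mul hX

theorem contDiff_polyField (Q : Fin d → MvPolynomial (Fin d) ℝ) : ContDiff ℝ ∞ (polyField Q) :=
  contDiff_euclidean.2 fun c => contDiff_mvPolynomial_eval (Q c)

/-- Iterated partial derivatives of a polynomial along a list of directions. -/
noncomputable def polyD (L : List (Fin d)) (p : MvPolynomial (Fin d) ℝ) :
    MvPolynomial (Fin d) ℝ := L.foldr (fun a p => MvPolynomial.pderiv a p) p

@[simp] theorem polyD_cons (a : Fin d) (L : List (Fin d)) (p : MvPolynomial (Fin d) ℝ) :
    polyD (a :: L) p = MvPolynomial.pderiv a (polyD L p) := rfl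

theorem polyD_append (L L' : List (Fin d)) (p : MvPolynomial (Fin d) ℝ) :
    polyD (L ++ L') p = polyD L (polyD L' p) := by simp [polyD]

theorem polyD_add (L : List (Fin d)) (p q : MvPolynomial (Fin d) ℝ) :
    polyD L (p + q) = polyD L p + polyD L q := by
  induction L with
  | nil => rfl
  | cons a L ih => simp [ih]

theorem polyD_zero (L : List (Fin d)) : polyD L (0 : MvPolynomial (Fin d) ℝ) = 0 := by
  induction L with
  | nil => rfl
  | cons a L ih => simp [ih]

theorem coordD_polyField (a : Fin d) (Q : Fin d → MvPolynomial (Fin d) ℝ) :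
    coordD a (polyField Q) = polyField fun c => MvPolynomial.pderiv a (Q c) := by
  funext x
  have h : HasFDerivAt (polyField Q) (fderiv ℝ (polyField Q) x) x :=
    ((contDiff_polyField Q).differentiable (by simp) x).hasFDerivAt
  ext c
  have h2 := ((EuclideanSpace.proj c : E d →L[ℝ] ℝ).hasFDerivAt.comp x h).fderiv
  have h3 := congrFun (coordD_mvPolynomial_eval a (Q c)) x
  rw [coordD] at h3
  change fderiv ℝ (polyField Q) x (EuclideanSpace.single a 1) c = _
  rw [polyField_apply, ← h3]
  change _ = fderiv ℝ ((EuclideanSpace.proj c : E d →L[ℝ] ℝ) ∘ polyField Q) x _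
  rw [h2]
  rfl

theorem listD_polyField (L : List (Fin d)) (Q : Fin d → MvPolynomial (Fin d) ℝ) :
    listD L (polyField Q) = polyField fun c => polyD L (Q c) := by
  induction L with
  | nil => rfl
  | cons a L ih => rw [listD_cons, ih, coordD_polyField]; rfl

theorem classGrad_polyField_apply {j : ℕ} (Q : Fin d → MvPolynomial (Fin d) ℝ) (x : E d)
    (i : Fin j → Fin d) (c : Fin d) :
    classGrad j (polyField Q) x i c
      = MvPolynomial.eval (fun l => x l) (polyD (List.ofFn i) (Q c)) := by
  simp [classGrad, listD_polyField]

theorem classGrad_polyField_add (j : ℕ) (Q R : Fin d → MvPolynomial (Fin d) ℝ) (x : E d) :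
    classGrad j (polyField (Q + R)) x = classGrad j (polyField Q) x
      + classGrad j (polyField R) x := by
  ext i c
  simp [classGrad_polyField_apply, polyD_add]

theorem classGrad_polyField_sub (j : ℕ) (Q R : Fin d → MvPolynomial (Fin d) ℝ) (x : E d) :
    classGrad j (polyField (Q - R)) x = classGrad j (polyField Q) x
      - classGrad j (polyField R) x := by
  have h := classGrad_polyField_add j (Q - R) R x
  rw [sub_add_cancel] at h
  rw [h, add_sub_cancel_right]

theorem totalDegree_pderiv_le (a : Fin d) (p : MvPolynomial (Fin d) ℝ) :
    (MvPolynomial.pderiv a p).totalDegree ≤ p.totalDegree := by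
  conv_lhs => rw [p.as_sum, map_sum]
  refine MvPolynomial.totalDegree_finsetSum_le fun s hs => ?_
  rw [MvPolynomial.pderiv_monomial]
  refine (MvPolynomial.totalDegree_monomial_le _ _).trans ?_
  refine le_trans ?_ (MvPolynomial.le_totalDegree hs)
  exact Finsupp.degree_mono tsub_le_self

theorem totalDegree_polyD_le (L : List (Fin d)) (p : MvPolynomial (Fin d) ℝ) :
    (polyD L p).totalDegree ≤ p.totalDegree := by
  induction L with
  | nil => exact le_rfl
  | cons a L ih => exact (totalDegree_pderiv_le a _).trans ih

/-- The homogeneous polynomial of degree `k` with prescribed `k`-th partial derivatives `c`. -/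
noncomputable def homPoly : ℕ → (List (Fin d) → ℝ) → MvPolynomial (Fin d) ℝ
  | 0, c => MvPolynomial.C (c [])
  | k + 1, c => MvPolynomial.C ((k + 1 : ℝ)⁻¹) *
      ∑ a, MvPolynomial.X a * homPoly k (fun L => c (a :: L))

theorem totalDegree_homPoly_le (k : ℕ) (c : List (Fin d) → ℝ) : (homPoly k c).totalDegree ≤ k := by
  induction k generalizing c with
  | zero => simp [homPoly]
  | succ k ih =>
    rw [homPoly]
    refine (MvPolynomial.totalDegree_mul _ _).trans ?_
    rw [MvPolynomial.totalDegree_C, zero_add]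
    refine MvPolynomial.totalDegree_finsetSum_le fun a _ => ?_
    refine (MvPolynomial.totalDegree_mul _ _).trans ?_
    rw [MvPolynomial.totalDegree_X, add_comm]
    exact Nat.add_le_add_right (ih _) 1

theorem homPoly_congr {k : ℕ} {c c' : List (Fin d) → ℝ} (h : ∀ L, L.length = k → c L = c' L) :
    homPoly k c = homPoly k c' := by
  induction k generalizing c c' with
  | zero => simp [homPoly, h]
  | succ k ih =>
    rw [homPoly, homPoly]
    congr 1
    refine Finset.sum_congr rfl fun a _ => ?_
    rw [ih]
    intro L hL
    exact h _ (by simp [hL])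

/-- The recursion defining `homPoly` is Euler's identity k p = ∑ xₐ ∂ₐp. By the product rule, the
derivative of the sum is one copy of the desired polynomial from differentiating the variable, plus
further copies from the induction hypothesis, as many as its degree; the inverse factor cancels
their number. Symmetry of the coefficients is needed to exchange the first two directions. -/
theorem pderiv_homPoly {k : ℕ} {c : List (Fin d) → ℝ}
    (hc : ∀ L L' : List (Fin d), L.Perm L' → c L = c L') (b : Fin d) :
    MvPolynomial.pderiv b (homPoly (k + 1) c) = homPoly k (fun L => c (b :: L)) := by
  induction k generalizing c with
  | zero =>
    simp only [homPoly, Nat.cast_zero, zero_add, inv_one, map_one, one_mul, map_sum,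
      Derivation.leibniz, MvPolynomial.pderiv_C, smul_eq_mul, mul_zero, MvPolynomial.pderiv_X]
    rw [Finset.sum_eq_single b]
    · simp
    · intro a _ ha
      simp [ha]
    · simp
  | succ k ih =>
    have h1 : ∀ a, MvPolynomial.pderiv b (homPoly (k + 1) (fun L => c (a :: L)))
        = homPoly k (fun L => c (b :: a :: L)) := by
      intro a
      rw [ih (fun L L' h => hc _ _ (h.cons a))]
      exact homPoly_congr fun L _ => hc _ _ (List.Perm.swap _ _ _)
    rw [homPoly, MvPolynomial.pderiv_C_mul]
    simp only [map_sum, Derivation.leibniz, smul_eq_mul, MvPolynomial.pderiv_X, h1,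
      Finset.sum_add_distrib]
    have h2 : ∑ a, homPoly (k + 1) (fun L => c (a :: L)) *
        (Pi.single (M := fun _ => MvPolynomial (Fin d) ℝ) b 1 a)
        = homPoly (k + 1) (fun L => c (b :: L)) := by
      rw [Finset.sum_eq_single b]
      · simp
      · intro a _ ha
        simp [ha]
      · simp
    have h3 : ∑ a, MvPolynomial.X a * homPoly k (fun L => c (b :: a :: L))
        = MvPolynomial.C (k + 1 : ℝ) * homPoly (k + 1) (fun L => c (b :: L)) := by
      rw [homPoly, ← mul_assoc, ← MvPolynomial.C_mul, mul_inv_cancel₀ (by positivity)]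
      simp
    rw [h2, h3, ← add_one_mul, ← mul_assoc]
    have h4 : (MvPolynomial.C (k + 1 : ℝ) : MvPolynomial (Fin d) ℝ) + 1
        = MvPolynomial.C ((k + 1 : ℕ) + 1 : ℝ) := by
      push_cast; simp
    rw [h4, ← MvPolynomial.C_mul, inv_mul_cancel₀ (by positivity), MvPolynomial.C_1, one_mul]

theorem polyD_homPoly {k : ℕ} {c : List (Fin d) → ℝ}
    (hc : ∀ L L' : List (Fin d), L.Perm L' → c L = c L') {L : List (Fin d)} (hL : L.length = k) :
    polyD L (homPoly k c) = MvPolynomial.C (c L) := by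
  induction k generalizing c L with
  | zero =>
    obtain rfl := List.length_eq_zero_iff.1 hL
    rfl
  | succ k ih =>
    obtain ⟨L', b, rfl⟩ := List.eq_nil_or_concat' L |>.resolve_left (by rintro rfl; simp at hL)
    rw [polyD_append]
    change polyD L' (MvPolynomial.pderiv b (homPoly (k + 1) c)) = _
    rw [pderiv_homPoly hc, ih (fun L L' h => hc _ _ (h.cons b)) (by simpa using hL)]
    rw [hc _ _ (List.perm_append_singleton b L')]

theorem polyD_homPoly_of_lt {k : ℕ} {c : List (Fin d) → ℝ}
    (hc : ∀ L L' : List (Fin d), L.Perm L' → c L = c L') {L : List (Fin d)} (hL : k < L.length) :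
    polyD L (homPoly k c) = 0 := by
  induction k generalizing c L with
  | zero =>
    obtain ⟨L', b, rfl⟩ := List.eq_nil_or_concat' L |>.resolve_left (by rintro rfl; simp at hL)
    rw [polyD_append]
    change polyD L' (MvPolynomial.pderiv b (MvPolynomial.C _)) = _
    rw [MvPolynomial.pderiv_C, polyD_zero]
  | succ k ih =>
    obtain ⟨L', b, rfl⟩ := List.eq_nil_or_concat' L |>.resolve_left (by rintro rfl; simp at hL)
    rw [polyD_append]
    change polyD L' (MvPolynomial.pderiv b (homPoly (k + 1) c)) = _
    rw [pderiv_homPoly hc, ih (fun L L' h => hc _ _ (h.cons b)) (by simpa using hL)]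

theorem gradVal_integral_apply {j : ℕ} {D : Set (E d)} {G : E d → GradVal d j}
    (hG : IntegrableOn G D) (i : Fin j → Fin d) : (∫ x in D, G x) i = ∫ x in D, G x i :=
  ((PiLp.proj (𝕜 := ℝ) 2 (fun _ : Fin j → Fin d => E d) i).integral_comp_comm hG).symm

/-- The coefficients below are indexed by lists, the components of a gradient by functions on `Fin
k`; this removes the cast along the length of `List.ofFn i`. -/
theorem sigma_list_get_ofFn {α β : Type*} {k : ℕ} (i : Fin k → α) (f : ∀ n, (Fin n → α) → β) :
    f (List.ofFn i).length (List.ofFn i).get = f k i := by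
  have h := List.equivSigmaTuple.apply_symm_apply (⟨k, i⟩ : Σ n, Fin n → α)
  have := congrArg (fun s : Σ n, Fin n → α => f s.1 s.2) h
  simpa [List.equivSigmaTuple] using this

theorem integrableOn_of_continuous {F : Type*} [NormedAddCommGroup F] {D : Set (E d)}
    {f : E d → F} (hf : Continuous f) (hD : Bornology.IsBounded D) : IntegrableOn f D :=
  (hf.continuousOn.integrableOn_compact hD.isCompact_closure).mono_set subset_closure

/-- A polynomial field whose gradients of order `< ℓ` have the same mean values as those of `u`. -/
theorem exists_polyField_integral_eq {D : Set (E d)} (hD : IsOpen D) (hb : Bornology.IsBounded D)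
    (hne : D.Nonempty) {ℓ : ℕ} {u : E d → E d} {U : ∀ k, E d → GradVal d k}
    (hU : ∀ k < ℓ, IsWeakGrad D k u (U k)) (hi : ∀ k < ℓ, IntegrableOn (U k) D) :
    ∃ Q : Fin d → MvPolynomial (Fin d) ℝ, (∀ c, (Q c).totalDegree ≤ ℓ - 1) ∧
      (∀ k ≥ ℓ, ∀ x, classGrad k (polyField Q) x = 0) ∧
      ∀ k < ℓ, ∫ x in D, (U k x - classGrad k (polyField Q) x) = 0 := by
  have hvol : volume.real D ≠ 0 := by
    rw [measureReal_def, ENNReal.toReal_ne_zero]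
    exact ⟨(hD.measure_pos volume hne).ne', hb.measure_lt_top.ne⟩
  -- Descending induction on the order: after n steps the mean values of orders ℓ − n, …, ℓ − 1
  -- agree. A homogeneous correction of degree k₀ has a constant gradient of order k₀ and no
  -- gradient of higher order, so what has been achieved is not destroyed.
  suffices H : ∀ n ≤ ℓ, ∃ Q : Fin d → MvPolynomial (Fin d) ℝ,
      (∀ c, (Q c).totalDegree ≤ ℓ - 1) ∧ (∀ k ≥ ℓ, ∀ x, classGrad k (polyField Q) x = 0) ∧
      ∀ k < ℓ, ℓ - n ≤ k → ∫ x in D, (U k x - classGrad k (polyField Q) x) = 0 by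
    obtain ⟨Q, h1, h1', h2⟩ := H ℓ le_rfl
    exact ⟨Q, h1, h1', fun k hk => h2 k hk (by simp)⟩
  intro n
  induction n with
  | zero =>
    intro _
    refine ⟨0, by simp, fun k _ x => ?_, fun k hk hk' => absurd hk (by omega)⟩
    ext i c
    simp [classGrad_polyField_apply, polyD_zero]
  | succ n ih =>
    intro hn
    obtain ⟨Q, hQ1, hQ3, hQ2⟩ := ih (by omega)
    set k₀ := ℓ - (n + 1) with hk₀
    have hk₀ℓ : k₀ < ℓ := by omega
    have hcQ : ∀ (R : Fin d → MvPolynomial (Fin d) ℝ) k,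
        IntegrableOn (classGrad k (polyField R)) D :=
      fun R k => integrableOn_of_continuous (continuous_classGrad k (contDiff_polyField R)) hb
    have hWi : ∀ k < ℓ, IntegrableOn (fun x => U k x - classGrad k (polyField Q) x) D :=
      fun k hk => (hi k hk).sub (hcQ Q k)
    have hW : ∀ k < ℓ, IsWeakGrad D k (u - polyField Q)
        (fun x => U k x - classGrad k (polyField Q) x) :=
      fun k hk => (hU k hk).sub (isWeakGrad_of_contDiff k (contDiff_polyField Q))
    -- The coefficients are the mean values of the remaining derivatives of order k₀. Lists of other
    -- lengths do not influence `homPoly k₀`; the value zero there keeps c symmetric.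
    let c : Fin d → List (Fin d) → ℝ := fun b L => if L.length = k₀ then
      (volume.real D)⁻¹ * (∫ x in D, (U L.length x - classGrad L.length (polyField Q) x) L.get) b
      else 0
    have hc : ∀ b, ∀ L L' : List (Fin d), L.Perm L' → c b L = c b L' := by
      intro b L L' h
      simp only [c]
      by_cases hL : L.length = k₀
      · rw [if_pos hL, if_pos (h.length_eq ▸ hL)]
        have := (hW L.length (hL ▸ hk₀ℓ)).apply_ae_eq hD (hW L'.length (h.length_eq ▸ hL ▸ hk₀ℓ))
          (i := L.get) (i' := L'.get) (by simpa using h)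
        rw [integral_congr_ae this]
      · rw [if_neg hL, if_neg (h.length_eq ▸ hL)]
    have hcof : ∀ b (i : Fin k₀ → Fin d), c b (List.ofFn i)
        = (volume.real D)⁻¹ * (∫ x in D, (U k₀ x - classGrad k₀ (polyField Q) x)) i b := by
      intro b i
      have := sigma_list_get_ofFn i (fun n i' => (volume.real D)⁻¹ *
        (∫ x in D, (U n x - classGrad n (polyField Q) x) i') b)
      simp only [c, if_pos (List.length_ofFn)]
      rw [this, gradVal_integral_apply (hWi k₀ hk₀ℓ)]
    have hzero : ∀ k > k₀, ∀ x, classGrad k (polyField fun b => homPoly k₀ (c b)) x = 0 := by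
      intro k hk x
      ext i b
      rw [classGrad_polyField_apply, polyD_homPoly_of_lt (hc b) (by simpa using hk)]
      simp
    refine ⟨Q + fun b => homPoly k₀ (c b), fun b => ?_, fun k hk x => ?_, ?_⟩
    · refine (MvPolynomial.totalDegree_add _ _).trans (max_le (hQ1 b) ?_)
      exact (totalDegree_homPoly_le _ _).trans (by omega)
    · rw [classGrad_polyField_add, hQ3 k hk, hzero k (by omega), add_zero]
    · intro k hk hk'
      have e : ∀ x, U k x - classGrad k (polyField (Q + fun b => homPoly k₀ (c b))) x
          = (U k x - classGrad k (polyField Q) x)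
            - classGrad k (polyField fun b => homPoly k₀ (c b)) x := by
        intro x
        rw [classGrad_polyField_add, sub_add_eq_sub_sub]
      simp only [e]
      rw [integral_sub (hWi k hk) (hcQ _ k)]
      rcases (show k₀ = k ∨ k₀ < k by omega) with rfl | hlt
      · have hconst : ∀ x, classGrad k₀ (polyField fun b => homPoly k₀ (c b)) x
            = (volume.real D)⁻¹ • ∫ x in D, (U k₀ x - classGrad k₀ (polyField Q) x) := by
          intro x
          ext i b
          rw [classGrad_polyField_apply, polyD_homPoly (hc b) (by simp), MvPolynomial.eval_C, hcof]
          rfl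
        simp only [hconst]
        rw [setIntegral_const, smul_smul, mul_inv_cancel₀ hvol, one_smul, sub_self]
      · simp only [hzero k hlt]
        rw [hQ2 k hk (by omega)]
        simp

end PolynomialFields

/-! ### Averages over segments in a convex set -/

section Averaging

/-- Jensen's inequality without normalisation of the measure, since it is also applied to measures
with a density. -/
theorem lintegral_rpow_le_measure_univ_mul {α : Type*} [MeasurableSpace α] {ν : Measure α}
    {a : α → ℝ≥0∞} (ha : AEMeasurable a ν) {r : ℝ} (hr : 1 ≤ r) :
    (∫⁻ x, a x ∂ν) ^ r ≤ ν univ ^ (r - 1) * ∫⁻ x, a x ^ r ∂ν := by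
  have hr0 : 0 < r := by linarith
  have h := eLpNorm'_le_eLpNorm'_mul_rpow_measure_univ zero_lt_one hr (f := a) (μ := ν)
    ha.aestronglyMeasurable
  simp only [eLpNorm', enorm_eq_self, ENNReal.rpow_one, div_one] at h
  calc (∫⁻ x, a x ∂ν) ^ r ≤ ((∫⁻ x, a x ^ r ∂ν) ^ (1 / r) * ν univ ^ (1 - 1 / r)) ^ r := by
        gcongr
    _ = _ := by
      rw [ENNReal.mul_rpow_of_nonneg _ _ hr0.le, ← ENNReal.rpow_mul, ← ENNReal.rpow_mul,
        one_div_mul_cancel hr0.ne', ENNReal.rpow_one, mul_comm]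
      congr 2
      field_simp

variable {d : ℕ}

theorem lintegral_comp_add_smul (c : E d) {t : ℝ} (ht : 0 < t) {G : E d → ℝ≥0∞}
    (hG : Measurable G) :
    ∫⁻ y, G (c + t • y) = ENNReal.ofReal t ^ (-(d : ℝ)) * ∫⁻ y, G y := by
  have h1 : ∫⁻ y, G (c + t • y)
      = ∫⁻ z, G (c + z) ∂(Measure.map (t • ·) (volume : Measure (E d))) := by
    rw [lintegral_map (by fun_prop) (by fun_prop)]
  rw [h1, Measure.map_addHaar_smul _ ht.ne', lintegral_smul_measure, lintegral_add_left_eq_self]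
  simp only [finrank_euclideanSpace, Fintype.card_fin, smul_eq_mul]
  congr 1
  rw [abs_of_pos (by positivity), ENNReal.ofReal_inv_of_pos (by positivity),
    ENNReal.ofReal_pow ht.le, ENNReal.rpow_neg, ENNReal.rpow_natCast]

variable {D : Set (E d)}

/-- For fixed x the substitution z = s x + t y has Jacobian t^d, and convexity keeps z in D. -/
theorem setLIntegral_segment_le (hD : Convex ℝ D) (hm : MeasurableSet D) {G : E d → ℝ≥0∞}
    (hG : Measurable G) {s t : ℝ} (hs : 0 ≤ s) (ht : 0 < t) (hst : s + t = 1) {x : E d}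
    (hx : x ∈ D) :
    ∫⁻ y in D, G (s • x + t • y) ≤ ENNReal.ofReal t ^ (-(d : ℝ)) * ∫⁻ y in D, G y := by
  rw [← lintegral_indicator hm, ← lintegral_indicator hm,
    ← lintegral_comp_add_smul (s • x) ht (hG.indicator hm)]
  refine lintegral_mono fun y => ?_
  by_cases hy : y ∈ D
  · rw [indicator_of_mem hy, indicator_of_mem (hD hx hy hs ht.le hst)]
  · rw [indicator_of_notMem hy]
    exact zero_le

theorem ofReal_rpow_neg_le {t : ℝ} (ht : 1 / 2 ≤ t) :
    ENNReal.ofReal t ^ (-(d : ℝ)) ≤ 2 ^ d := by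
  rw [ENNReal.rpow_neg, ENNReal.rpow_natCast, ENNReal.inv_pow]
  gcongr
  rw [ENNReal.inv_le_iff_inv_le]
  rw [← ENNReal.ofReal_ofNat, ← ENNReal.ofReal_inv_of_pos (by norm_num)]
  exact ENNReal.ofReal_le_ofReal (by linarith)

/-- One of t and 1 − t is at least 1/2. Substituting in the corresponding variable costs at most
2^d, so the double integral has no singularity in t. -/
theorem setLIntegral_setLIntegral_segment_le (hD : Convex ℝ D) (hm : MeasurableSet D)
    {G : E d → ℝ≥0∞} (hG : Measurable G) {t : ℝ} (ht : t ∈ Ioo (0 : ℝ) 1) :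
    ∫⁻ x in D, ∫⁻ y in D, G ((1 - t) • x + t • y) ≤ 2 ^ d * volume D * ∫⁻ y in D, G y := by
  have key : ∀ {s t : ℝ}, 0 ≤ s → 1 / 2 ≤ t → s + t = 1 →
      ∫⁻ x in D, ∫⁻ y in D, G (s • x + t • y) ≤ 2 ^ d * volume D * ∫⁻ y in D, G y := by
    intro s t hs ht hst
    calc ∫⁻ x in D, ∫⁻ y in D, G (s • x + t • y)
        ≤ ∫⁻ x in D, 2 ^ d * ∫⁻ y in D, G y := by
          refine setLIntegral_mono' hm fun x hx => ?_
          refine (setLIntegral_segment_le hD hm hG hs (by linarith) hst hx).trans ?_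
          gcongr
          exact ofReal_rpow_neg_le ht
      _ = _ := by rw [setLIntegral_const]; ring
  rcases le_total (1 / 2) t with h | h
  · exact key (by linarith [ht.2]) h (by ring)
  · rw [lintegral_lintegral_swap]
    · simp only [add_comm ((1 - t) • _)]
      exact key ht.1.le (by linarith) (by ring)
    · exact (hG.comp (by fun_prop)).aemeasurable

/-- An interpolation between the two preceding bounds. After Jensen's inequality with exponent q the
integrand is H^(r/q). Of this, the power r/q − 1 is bounded uniformly in x, at the cost of a
negative power of t, and the remaining factor H is integrated over x at no such cost. -/
theorem lintegral_segment_rpow_le (hD : Convex ℝ D) (hm : MeasurableSet D)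
    {G : E d → ℝ≥0∞} (hG : Measurable G) {q r : ℝ} (hq : 1 ≤ q) (hqr : q ≤ r) {t : ℝ}
    (ht : t ∈ Ioo (0 : ℝ) 1) :
    ∫⁻ x in D, (∫⁻ y in D, G ((1 - t) • x + t • y)) ^ r ≤
      2 ^ d * volume D * volume D ^ (r - r / q) * (∫⁻ y in D, G y ^ q) ^ (r / q) *
        ENNReal.ofReal t ^ (-(d * (r / q - 1))) := by
  have hq0 : 0 < q := by linarith
  have hrq : 1 ≤ r / q := (one_le_div hq0).2 hqr
  set Q := ∫⁻ y in D, G y ^ q with hQ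
  set T := ENNReal.ofReal t
  have hGq : Measurable fun y => G y ^ q := hG.pow_const q
  set H : E d → ℝ≥0∞ := fun x => ∫⁻ y in D, G ((1 - t) • x + t • y) ^ q with hH
  have hHm : Measurable H := by
    have : Measurable fun p : E d × E d => G ((1 - t) • p.1 + t • p.2) ^ q :=
      hGq.comp (f := fun p : E d × E d => (1 - t) • p.1 + t • p.2) (by fun_prop)
    exact this.lintegral_prod_right'
  have h1 : ∀ x ∈ D, (∫⁻ y in D, G ((1 - t) • x + t • y)) ^ r ≤
      volume D ^ (r - r / q) * (T ^ (-(d : ℝ)) * Q) ^ (r / q - 1) * H x := by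
    intro x hx
    have hJ := lintegral_rpow_le_measure_univ_mul (ν := volume.restrict D)
      (a := fun y => G ((1 - t) • x + t • y)) (hG.comp (by fun_prop)).aemeasurable hq
    rw [Measure.restrict_apply_univ] at hJ
    have hr1 : r = q * (r / q) := by field_simp
    calc (∫⁻ y in D, G ((1 - t) • x + t • y)) ^ r
        = ((∫⁻ y in D, G ((1 - t) • x + t • y)) ^ q) ^ (r / q) := by
          rw [← ENNReal.rpow_mul, ← hr1]
      _ ≤ (volume D ^ (q - 1) * H x) ^ (r / q) := by gcongr
      _ = volume D ^ (r - r / q) * (H x ^ (r / q - 1) * H x) := by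
          rw [ENNReal.mul_rpow_of_nonneg _ _ (by linarith), ← ENNReal.rpow_mul]
          congr 2
          · rw [sub_mul, ← hr1, one_mul]
          · nth_rw 3 [← ENNReal.rpow_one (H x)]
            rw [← ENNReal.rpow_add_of_nonneg _ _ (by linarith) zero_le_one]
            congr 1; ring
      _ ≤ volume D ^ (r - r / q) * ((T ^ (-(d : ℝ)) * Q) ^ (r / q - 1) * H x) := by
          have := setLIntegral_segment_le hD hm hGq (s := 1 - t) (by linarith [ht.2]) ht.1
            (by ring) hx
          gcongr
      _ = _ := by ring
  calc ∫⁻ x in D, (∫⁻ y in D, G ((1 - t) • x + t • y)) ^ r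
      ≤ ∫⁻ x in D, volume D ^ (r - r / q) * (T ^ (-(d : ℝ)) * Q) ^ (r / q - 1) * H x :=
        setLIntegral_mono' hm h1
    _ = volume D ^ (r - r / q) * (T ^ (-(d : ℝ)) * Q) ^ (r / q - 1) * ∫⁻ x in D, H x :=
        lintegral_const_mul _ hHm
    _ ≤ volume D ^ (r - r / q) * (T ^ (-(d : ℝ)) * Q) ^ (r / q - 1) *
          (2 ^ d * volume D * Q) := by
        gcongr
        exact setLIntegral_setLIntegral_segment_le hD hm hGq ht
    _ = _ := by
        rw [ENNReal.mul_rpow_of_nonneg _ _ (by linarith), ← ENNReal.rpow_mul]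
        have hQQ : Q ^ (r / q - 1) * Q = Q ^ (r / q) := by
          nth_rw 2 [← ENNReal.rpow_one Q]
          rw [← ENNReal.rpow_add_of_nonneg _ _ (by linarith) zero_le_one]
          congr 1; ring
        rw [← hQQ, neg_mul]
        ring

/-- The integral of `t ↦ t^{-θ}` over `(0,1)`. -/
noncomputable def weightInt (θ : ℝ) : ℝ≥0∞ := ∫⁻ t in Ioo (0 : ℝ) 1, ENNReal.ofReal t ^ (-θ)

theorem weightInt_lt_top {θ : ℝ} (hθ : θ < 1) : weightInt θ < ⊤ := by
  have h := (intervalIntegral.intervalIntegrable_rpow' (a := 0) (b := 1) (r := -θ)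
    (by linarith)).1
  have h2 := (h.mono_set Ioo_subset_Ioc_self).2
  rw [hasFiniteIntegral_iff_enorm] at h2
  refine lt_of_le_of_lt (le_of_eq ?_) h2
  refine setLIntegral_congr_fun measurableSet_Ioo fun t ht => ?_
  rw [ENNReal.ofReal_rpow_of_pos ht.1, Real.enorm_of_nonneg (Real.rpow_nonneg ht.1.le _)]

/-- Jensen's inequality for the measure t^(−θ) dt. The weight spreads a singularity in t over the
r-th power, so that integrability of t^(−θ), and not of t^(−θr), is what matters. -/
theorem lintegral_rpow_le_weightInt_mul {a : ℝ → ℝ≥0∞} (ha : Measurable a) {r : ℝ} (hr : 1 ≤ r)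
    (θ : ℝ) : (∫⁻ t in Ioo (0 : ℝ) 1, a t) ^ r ≤
      weightInt θ ^ (r - 1) * ∫⁻ t in Ioo (0 : ℝ) 1, ENNReal.ofReal t ^ (θ * r - θ) * a t ^ r := by
  let w : ℝ → ℝ≥0∞ := fun t => ENNReal.ofReal t ^ (-θ)
  have hw : Measurable w := ENNReal.measurable_ofReal.pow_const _
  let f : ℝ → ℝ≥0∞ := fun t => ENNReal.ofReal t ^ θ * a t
  have hf : Measurable f := (ENNReal.measurable_ofReal.pow_const _).mul ha
  let g : ℝ → ℝ≥0∞ := fun t => f t ^ r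
  have hg : Measurable g := hf.pow_const _
  have hT : ∀ t ∈ Ioo (0 : ℝ) 1, ENNReal.ofReal t ≠ 0 ∧ ENNReal.ofReal t ≠ ⊤ := fun t ht =>
    ⟨by simpa using ht.1, ENNReal.ofReal_ne_top⟩
  have hJ := lintegral_rpow_le_measure_univ_mul
    (ν := (volume.restrict (Ioo (0 : ℝ) 1)).withDensity w) (a := f) hf.aemeasurable hr
  rw [lintegral_withDensity_eq_lintegral_mul _ hw hf,
    show (fun t => f t ^ r) = g from rfl,
    lintegral_withDensity_eq_lintegral_mul _ hw hg,
    withDensity_apply _ MeasurableSet.univ, Measure.restrict_univ] at hJ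
  refine le_trans (le_of_eq ?_) (hJ.trans (le_of_eq ?_))
  · congr 1
    refine setLIntegral_congr_fun measurableSet_Ioo fun t ht => ?_
    simp only [Pi.mul_apply, w, f]
    rw [← mul_assoc, ← ENNReal.rpow_add _ _ (hT t ht).1 (hT t ht).2]
    simp
  · congr 1
    refine setLIntegral_congr_fun measurableSet_Ioo fun t ht => ?_
    simp only [Pi.mul_apply, w, f, g]
    rw [ENNReal.mul_rpow_of_nonneg _ _ (by linarith), ← mul_assoc, ← ENNReal.rpow_mul,
      ← ENNReal.rpow_add _ _ (hT t ht).1 (hT t ht).2]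
    congr 2
    ring

/-- For θ = d(1/q − 1/r) the loss t^(−θr) and the factor t^(θr − θ) from the weighted Jensen
inequality combine to t^(−θ), which is integrable exactly for θ < 1. This takes the place of a Riesz
potential estimate; the lost endpoint θ = 1 is not needed. -/
theorem lintegral_lintegral_segment_rpow_le (hD : Convex ℝ D) (hm : MeasurableSet D)
    {G : E d → ℝ≥0∞} (hG : Measurable G) {q r : ℝ} (hq : 1 ≤ q) (hqr : q ≤ r) :
    ∫⁻ x in D, (∫⁻ t in Ioo (0 : ℝ) 1, ∫⁻ y in D, G ((1 - t) • x + t • y)) ^ r ≤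
      weightInt (d * (1 / q - 1 / r)) ^ r *
        (2 ^ d * volume D * volume D ^ (r - r / q) * (∫⁻ y in D, G y ^ q) ^ (r / q)) := by
  have hq0 : 0 < q := by linarith
  have hr : 1 ≤ r := by linarith
  set θ : ℝ := d * (1 / q - 1 / r) with hθ
  set B := 2 ^ d * volume D * volume D ^ (r - r / q) * (∫⁻ y in D, G y ^ q) ^ (r / q) with hB
  have hθr : d * (r / q - 1) = θ * r := by rw [hθ]; field_simp
  let w : ℝ → ℝ≥0∞ := fun t => ENNReal.ofReal t ^ (-θ)
  have hw : Measurable w := ENNReal.measurable_ofReal.pow_const _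
  let I : E d → ℝ → ℝ≥0∞ := fun x t => ∫⁻ y in D, G ((1 - t) • x + t • y)
  have hI : Measurable fun p : E d × ℝ => I p.1 p.2 := by
    have : Measurable fun p : (E d × ℝ) × E d => G ((1 - p.1.2) • p.1.1 + p.1.2 • p.2) :=
      hG.comp (by fun_prop)
    exact this.lintegral_prod_right'
  have hT : ∀ t ∈ Ioo (0 : ℝ) 1, ENNReal.ofReal t ≠ 0 ∧ ENNReal.ofReal t ≠ ⊤ := fun t ht =>
    ⟨by simpa using ht.1, ENNReal.ofReal_ne_top⟩
  have hIx : ∀ x, Measurable (I x) := fun x =>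
    hI.comp (f := fun t : ℝ => (x, t)) (by fun_prop)
  have hpt : ∀ x, (∫⁻ t in Ioo (0 : ℝ) 1, I x t) ^ r ≤
      weightInt θ ^ (r - 1) * ∫⁻ t in Ioo (0 : ℝ) 1, ENNReal.ofReal t ^ (θ * r - θ) * I x t ^ r :=
    fun x => lintegral_rpow_le_weightInt_mul (hIx x) hr θ
  calc ∫⁻ x in D, (∫⁻ t in Ioo (0 : ℝ) 1, I x t) ^ r
      ≤ ∫⁻ x in D, weightInt θ ^ (r - 1) *
          ∫⁻ t in Ioo (0 : ℝ) 1, ENNReal.ofReal t ^ (θ * r - θ) * I x t ^ r :=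
        lintegral_mono hpt
    _ = weightInt θ ^ (r - 1) * ∫⁻ x in D,
          ∫⁻ t in Ioo (0 : ℝ) 1, ENNReal.ofReal t ^ (θ * r - θ) * I x t ^ r := by
        refine lintegral_const_mul _ ?_
        have : Measurable fun p : E d × ℝ => ENNReal.ofReal p.2 ^ (θ * r - θ) * I p.1 p.2 ^ r :=
          ((ENNReal.measurable_ofReal.comp measurable_snd).pow_const _).mul (hI.pow_const _)
        exact this.lintegral_prod_right'
    _ = weightInt θ ^ (r - 1) * ∫⁻ t in Ioo (0 : ℝ) 1, ENNReal.ofReal t ^ (θ * r - θ) *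
          ∫⁻ x in D, I x t ^ r := by
        rw [lintegral_lintegral_swap]
        · congr 1
          refine lintegral_congr fun t => ?_
          refine lintegral_const_mul _ ?_
          exact (hI.comp (f := fun x : E d => (x, t)) (by fun_prop)).pow_const _
        · exact (((ENNReal.measurable_ofReal.comp measurable_snd).pow_const _).mul
            (hI.pow_const _)).aemeasurable
    _ ≤ weightInt θ ^ (r - 1) * ∫⁻ t in Ioo (0 : ℝ) 1, B * w t := by
        refine mul_le_mul_right (setLIntegral_mono' measurableSet_Ioo fun t ht => ?_) _
        have h := lintegral_segment_rpow_le hD hm hG hq hqr ht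
        rw [hθr] at h
        calc ENNReal.ofReal t ^ (θ * r - θ) * ∫⁻ x in D, I x t ^ r
            ≤ ENNReal.ofReal t ^ (θ * r - θ) * (B * ENNReal.ofReal t ^ (-(θ * r))) := by
              gcongr
          _ = B * (ENNReal.ofReal t ^ (θ * r - θ) * ENNReal.ofReal t ^ (-(θ * r))) := by ring
          _ = B * w t := by
              rw [← ENNReal.rpow_add _ _ (hT t ht).1 (hT t ht).2]
              congr 2
              ring
    _ = weightInt θ ^ (r - 1) * (B * weightInt θ) := by
        rw [lintegral_const_mul _ hw]
        rfl
    _ = weightInt θ ^ r * B := by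
        have : weightInt θ ^ r = weightInt θ ^ (r - 1) * weightInt θ := by
          nth_rw 3 [← ENNReal.rpow_one (weightInt θ)]
          rw [← ENNReal.rpow_add_of_nonneg _ _ (by linarith) zero_le_one]
          congr 1; ring
        rw [this]
        ring

end Averaging

/-! ### The Poincaré inequality on convex sets -/

section Poincare

variable {d : ℕ} {F : Type*} [NormedAddCommGroup F] [NormedSpace ℝ F]

/-- The fundamental theorem of calculus along the segment from x to y, which stays in D, bounds the
difference by R times a segment average of the derivative. -/
theorem lintegral_enorm_sub_rpow_le {D : Set (E d)} (hD : Convex ℝ D) (hm : MeasurableSet D)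
    [CompleteSpace F] {h : E d → F} (hh : ContDiff ℝ 1 h) {R : ℝ≥0∞}
    (hR : ∀ x ∈ D, ∀ y ∈ D, ‖x - y‖ₑ ≤ R) {q r : ℝ} (hq : 1 ≤ q) (hqr : q ≤ r) :
    ∫⁻ x in D, (∫⁻ y in D, ‖h x - h y‖ₑ) ^ r ≤
      R ^ r * (weightInt (d * (1 / q - 1 / r)) ^ r *
        (2 ^ d * volume D * volume D ^ (r - r / q) *
          (∫⁻ y in D, ‖fderiv ℝ h y‖ₑ ^ q) ^ (r / q))) := by
  have hr0 : 0 ≤ r := by linarith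
  have hc : Continuous (fderiv ℝ h) := hh.continuous_fderiv (by simp)
  have hG : Measurable fun y => ‖fderiv ℝ h y‖ₑ := hc.enorm.measurable
  have hpt : ∀ x ∈ D, ∀ y ∈ D, ‖h x - h y‖ₑ
      ≤ R * ∫⁻ t in Ioo (0 : ℝ) 1, ‖fderiv ℝ h ((1 - t) • x + t • y)‖ₑ := by
    intro x hx y hy
    have hder : ∀ t ∈ uIcc (0 : ℝ) 1, HasDerivAt (fun t : ℝ => h ((1 - t) • x + t • y))
        (fderiv ℝ h ((1 - t) • x + t • y) (y - x)) t := by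
      intro t _
      have h1 : HasDerivAt (fun t : ℝ => (1 - t) • x + t • y) (y - x) t := by
        have := (((hasDerivAt_id t).const_sub 1).smul_const x).add
          ((hasDerivAt_id t).smul_const y)
        refine this.congr_deriv ?_
        simp [sub_eq_add_neg, add_comm]
      exact ((hh.differentiable (by simp) _).hasFDerivAt).comp_hasDerivAt t h1
    have hcont : Continuous fun t : ℝ => fderiv ℝ h ((1 - t) • x + t • y) (y - x) :=
      (hc.comp (by fun_prop)).clm_apply continuous_const
    have e := intervalIntegral.integral_eq_sub_of_hasDerivAt hder (hcont.intervalIntegrable _ _)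
    simp only [sub_zero, one_smul, zero_smul, add_zero, sub_self, zero_add] at e
    rw [← enorm_neg, neg_sub, ← e, intervalIntegral.integral_of_le zero_le_one,
      integral_Ioc_eq_integral_Ioo]
    refine (enorm_integral_le_lintegral_enorm _).trans ?_
    have hmt : Measurable fun t : ℝ => ‖fderiv ℝ h ((1 - t) • x + t • y)‖ₑ :=
      hG.comp (f := fun t : ℝ => (1 - t) • x + t • y) (by fun_prop)
    rw [← lintegral_const_mul _ hmt]
    refine lintegral_mono fun t => ?_
    rw [mul_comm]
    refine (ContinuousLinearMap.le_opENorm _ _).trans ?_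
    gcongr
    exact hR y hy x hx
  calc ∫⁻ x in D, (∫⁻ y in D, ‖h x - h y‖ₑ) ^ r
      ≤ ∫⁻ x in D, R ^ r * (∫⁻ t in Ioo (0 : ℝ) 1, ∫⁻ y in D,
          ‖fderiv ℝ h ((1 - t) • x + t • y)‖ₑ) ^ r := by
        refine setLIntegral_mono' hm fun x hx => ?_
        rw [← ENNReal.mul_rpow_of_nonneg _ _ hr0]
        refine ENNReal.rpow_le_rpow ?_ hr0
        have hm2 : Measurable fun p : E d × ℝ => ‖fderiv ℝ h ((1 - p.2) • x + p.2 • p.1)‖ₑ :=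
          hG.comp (f := fun p : E d × ℝ => (1 - p.2) • x + p.2 • p.1) (by fun_prop)
        rw [lintegral_lintegral_swap]
        · rw [← lintegral_const_mul _ hm2.lintegral_prod_right']
          exact setLIntegral_mono' hm fun y hy => hpt x hx y hy
        · exact (hG.comp (f := fun p : ℝ × E d => (1 - p.1) • x + p.1 • p.2)
            (by fun_prop)).aemeasurable
    _ = R ^ r * ∫⁻ x in D, (∫⁻ t in Ioo (0 : ℝ) 1, ∫⁻ y in D,
          ‖fderiv ℝ h ((1 - t) • x + t • y)‖ₑ) ^ r := by
        refine lintegral_const_mul _ ?_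
        have h3 : Measurable fun p : (E d × ℝ) × E d =>
            ‖fderiv ℝ h ((1 - p.1.2) • p.1.1 + p.1.2 • p.2)‖ₑ :=
          hG.comp (f := fun p : (E d × ℝ) × E d => (1 - p.1.2) • p.1.1 + p.1.2 • p.2)
            (by fun_prop)
        exact (h3.lintegral_prod_right'.lintegral_prod_right').pow_const _
    _ ≤ _ := by
        gcongr
        exact lintegral_lintegral_segment_rpow_le hD hm hG hq hqr

/-- `g` is the (first order) weak derivative of `f` on `D`. -/
structure HasWeakDeriv (D : Set (E d)) (f : E d → F) (g : E d → E d →L[ℝ] F) : Prop where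
  integrableOn : IntegrableOn f D
  integrableOn_deriv : IntegrableOn g D
  integral_eq : ∀ φ : E d → ℝ, ContDiff ℝ ∞ φ → HasCompactSupport φ → tsupport φ ⊆ D →
    ∀ a : Fin d, ∫ x in D, coordD a φ x • f x
      = - ∫ x in D, φ x • g x (EuclideanSpace.single a 1)

theorem clm_ext_single {L L' : E d →L[ℝ] F}
    (h : ∀ a, L (EuclideanSpace.single a 1) = L' (EuclideanSpace.single a 1)) : L = L' := by
  refine ContinuousLinearMap.coe_injective
    ((EuclideanSpace.basisFun (Fin d) ℝ).toBasis.ext fun a => ?_)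
  simpa using h a

open ContinuousLinearMap Convolution in
-- The derivative falls on the kernel. By the support condition y ↦ ρ(x − y) is a test function on
-- D, so the definition of the weak derivative moves it to g; the reflection in y accounts for the
-- sign.
theorem HasWeakDeriv.fderiv_convolution [CompleteSpace F] {D : Set (E d)} (hm : MeasurableSet D)
    {f : E d → F}
    {g : E d → E d →L[ℝ] F} (hfg : HasWeakDeriv D f g) {ρ : E d → ℝ} (hρ : ContDiff ℝ ∞ ρ)
    (hc : HasCompactSupport ρ) {x : E d} (hx : ∀ y, x - y ∈ tsupport ρ → y ∈ D) :
    fderiv ℝ (ρ ⋆[lsmul ℝ ℝ, volume] D.indicator f) x = ∫ y in D, ρ (x - y) • g y := by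
  have hfi : Integrable (D.indicator f) := (integrable_indicator_iff hm).2 hfg.integrableOn
  have h1 := hc.hasFDerivAt_convolution_left (L := lsmul ℝ ℝ) (μ := volume)
    (hρ.of_le (by simp)) hfi.locallyIntegrable x
  rw [h1.fderiv]
  let ψ : E d → ℝ := fun y => ρ (x - y)
  have hψ : ContDiff ℝ ∞ ψ := hρ.comp (contDiff_const.sub contDiff_id)
  have hψc : HasCompactSupport ψ := by
    have := hc.comp_homeomorph (Homeomorph.subLeft x)
    exact this
  have hψD : tsupport ψ ⊆ D := by
    intro y hy
    apply hx
    have : tsupport ψ = (Homeomorph.subLeft x) ⁻¹' tsupport ρ :=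
      tsupport_comp_eq_preimage ρ (Homeomorph.subLeft x)
    rw [this] at hy
    exact hy
  have hψb : ∃ C, ∀ y, ‖ψ y‖ ≤ C := hψ.continuous.bounded_above_of_compact_support hψc
  obtain ⟨C, hC⟩ := hψb
  have hint : IntegrableOn (fun y => ρ (x - y) • g y) D :=
    hfg.integrableOn_deriv.bdd_smul C hψ.continuous.aestronglyMeasurable
      (Eventually.of_forall hC)
  refine clm_ext_single fun a => ?_
  have e1 : (fderiv ℝ ρ ⋆[(lsmul ℝ ℝ).precompL (E d), volume] D.indicator f) x
      (EuclideanSpace.single a 1)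
      = ∫ t, fderiv ℝ ρ t (EuclideanSpace.single a 1) • D.indicator f (x - t) := by
    have hex := (hc.fderiv ℝ).convolutionExists_left ((lsmul ℝ ℝ).precompL (E d))
        (hρ.continuous_fderiv (by simp)) hfi.locallyIntegrable x
    rw [convolution_def, ContinuousLinearMap.integral_apply hex.integrable]
    rfl
  have e2 : ∀ y, coordD a ψ y = - fderiv ℝ ρ (x - y) (EuclideanSpace.single a 1) := by
    intro y
    have h2 : HasFDerivAt ψ ((fderiv ℝ ρ (x - y)).comp (-ContinuousLinearMap.id ℝ (E d))) y :=
      HasFDerivAt.comp y (hρ.differentiable (by simp) (x - y)).hasFDerivAt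
        ((hasFDerivAt_id y).const_sub x)
    rw [coordD, h2.fderiv]
    simp
  rw [e1, ← integral_sub_left_eq_self _ volume x, ContinuousLinearMap.integral_apply hint]
  have e3 := hfg.integral_eq ψ hψ hψc hψD a
  simp only [e2, neg_smul, integral_neg, neg_inj] at e3
  simp only [sub_sub_cancel, smul_apply]
  rw [← e3, ← integral_indicator hm]
  refine integral_congr_ae (Eventually.of_forall fun y => ?_)
  by_cases hy : y ∈ D <;> simp [hy]

/-- Jensen's inequality for the kernel as a density of mass at most one on D, followed by Tonelli.
Only this bound on the mollified derivatives is used later, not their convergence. -/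
theorem lintegral_enorm_integral_smul_rpow_le {G : Type*} [NormedAddCommGroup G] [NormedSpace ℝ G]
    {D D' : Set (E d)} {g : E d → G}
    (hg : AEStronglyMeasurable g (volume.restrict D)) (φ : ContDiffBump (0 : E d)) {q : ℝ}
    (hq : 1 ≤ q) :
    ∫⁻ x in D', ‖∫ y in D, φ.normed volume (x - y) • g y‖ₑ ^ q ≤ ∫⁻ y in D, ‖g y‖ₑ ^ q := by
  set ρ : E d → ℝ := φ.normed volume with hρ
  have hρc : Continuous ρ := φ.continuous_normed
  have hρ1 : ∀ x, ∫⁻ y, ‖ρ (x - y)‖ₑ = 1 := by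
    intro x
    rw [lintegral_sub_left_eq_self (fun y => ‖ρ y‖ₑ) x]
    have h1 := ofReal_integral_norm_eq_lintegral_enorm (φ.integrable_normed (μ := volume))
    rw [← h1]
    have h2 : ∀ y, ‖φ.normed volume y‖ = φ.normed volume y := fun y =>
      Real.norm_of_nonneg (φ.nonneg_normed y)
    simp only [h2, φ.integral_normed, ENNReal.ofReal_one]
  obtain ⟨g', hg'm, hg'⟩ := hg
  have hw : ∀ x, Measurable fun y => ‖ρ (x - y)‖ₑ := fun x =>
    (hρc.comp (continuous_const.sub continuous_id)).enorm.measurable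
  have hgm : Measurable fun y => ‖g' y‖ₑ := hg'm.enorm
  have hpt : ∀ x, ‖∫ y in D, ρ (x - y) • g y‖ₑ ^ q
      ≤ ∫⁻ y in D, ‖ρ (x - y)‖ₑ * ‖g' y‖ₑ ^ q := by
    intro x
    have e : ∫ y in D, ρ (x - y) • g y = ∫ y in D, ρ (x - y) • g' y := by
      refine integral_congr_ae ?_
      filter_upwards [hg'] with y hy
      rw [hy]
    rw [e]
    have hJ := lintegral_rpow_le_measure_univ_mul
      (ν := (volume.restrict D).withDensity fun y => ‖ρ (x - y)‖ₑ) hgm.aemeasurable hq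
    rw [lintegral_withDensity_eq_lintegral_mul _ (hw x) hgm,
      lintegral_withDensity_eq_lintegral_mul _ (hw x) (hgm.pow_const q),
      withDensity_apply _ MeasurableSet.univ, Measure.restrict_univ] at hJ
    have hle : (∫⁻ y in D, ‖ρ (x - y)‖ₑ) ^ (q - 1) ≤ 1 := by
      refine (ENNReal.rpow_le_rpow ((setLIntegral_le_lintegral _ _).trans (hρ1 x).le)
        (by linarith)).trans ?_
      simp
    calc ‖∫ y in D, ρ (x - y) • g' y‖ₑ ^ q
        ≤ (∫⁻ y in D, ‖ρ (x - y)‖ₑ * ‖g' y‖ₑ) ^ q := by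
          gcongr
          refine (enorm_integral_le_lintegral_enorm _).trans (le_of_eq ?_)
          simp only [enorm_smul]
      _ ≤ _ := hJ
      _ ≤ 1 * ∫⁻ y in D, ‖ρ (x - y)‖ₑ * ‖g' y‖ₑ ^ q := mul_le_mul_left hle _
      _ = _ := one_mul _
  calc ∫⁻ x in D', ‖∫ y in D, ρ (x - y) • g y‖ₑ ^ q
      ≤ ∫⁻ x in D', ∫⁻ y in D, ‖ρ (x - y)‖ₑ * ‖g' y‖ₑ ^ q := lintegral_mono hpt
    _ ≤ ∫⁻ x, ∫⁻ y in D, ‖ρ (x - y)‖ₑ * ‖g' y‖ₑ ^ q := setLIntegral_le_lintegral _ _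
    _ = ∫⁻ y in D, ∫⁻ x, ‖ρ (x - y)‖ₑ * ‖g' y‖ₑ ^ q := by
        rw [lintegral_lintegral_swap]
        have h1 : Measurable fun p : E d × E d => ‖ρ (p.1 - p.2)‖ₑ :=
          (hρc.comp (continuous_fst.sub continuous_snd)).enorm.measurable
        exact (h1.mul ((hgm.comp measurable_snd).pow_const q)).aemeasurable
    _ = ∫⁻ y in D, ‖g' y‖ₑ ^ q := by
        refine lintegral_congr fun y => ?_
        have hmy : Measurable fun x => ‖ρ (x - y)‖ₑ :=
          (hρc.comp (continuous_id.sub continuous_const)).enorm.measurable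
        rw [lintegral_mul_const _ hmy]
        have h0 := hρ1 0
        rw [lintegral_sub_left_eq_self (fun y => ‖ρ y‖ₑ) 0] at h0
        have := lintegral_sub_right_eq_self (μ := (volume : Measure (E d))) (fun y => ‖ρ y‖ₑ) y
        rw [this, h0, one_mul]
    _ = ∫⁻ y in D, ‖g y‖ₑ ^ q := by
        refine lintegral_congr_ae ?_
        filter_upwards [hg'] with y hy
        rw [hy]

/-- The points of `D` at distance at least `δ` from the complement. -/
def innerPart (D : Set (E d)) (δ : ℝ) : Set (E d) := (Metric.thickening δ Dᶜ)ᶜ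

theorem mem_innerPart {D : Set (E d)} {δ : ℝ} {x : E d} :
    x ∈ innerPart D δ ↔ ∀ y, dist x y < δ → y ∈ D := by
  rw [innerPart, mem_compl_iff, Metric.mem_thickening_iff]
  push Not
  refine forall_congr' fun y => ?_
  rw [mem_compl_iff, ← not_lt]
  tauto

theorem measurableSet_innerPart (D : Set (E d)) (δ : ℝ) : MeasurableSet (innerPart D δ) :=
  Metric.isOpen_thickening.measurableSet.compl

theorem innerPart_subset {D : Set (E d)} {δ : ℝ} (hδ : 0 < δ) : innerPart D δ ⊆ D := fun x hx =>
  mem_innerPart.1 hx x (by simpa using hδ)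

theorem Convex.innerPart {D : Set (E d)} (hD : Convex ℝ D) (δ : ℝ) :
    Convex ℝ (innerPart D δ) := by
  intro x hx y hy s t hs ht hst
  rw [mem_innerPart] at *
  intro w hw
  set v := w - (s • x + t • y) with hv
  have hvn : ‖v‖ < δ := by rwa [hv, ← dist_eq_norm, dist_comm]
  have h := hD (hx (x + v) (by simpa [dist_eq_norm] using hvn))
    (hy (y + v) (by simpa [dist_eq_norm] using hvn)) hs ht hst
  have : s • (x + v) + t • (y + v) = w := by
    rw [smul_add, smul_add, add_add_add_comm, ← add_smul, hst, one_smul, hv]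
    abel
  rwa [this] at h

theorem eventually_mem_innerPart {D : Set (E d)} (hD : IsOpen D) {δ : ℕ → ℝ}
    (hδ : Tendsto δ atTop (𝓝 0)) {x : E d} (hx : x ∈ D) : ∀ᶠ n in atTop, x ∈ innerPart D (δ n) := by
  obtain ⟨ε, hε, hb⟩ := Metric.isOpen_iff.1 hD x hx
  filter_upwards [hδ.eventually_lt_const hε] with n hn
  rw [mem_innerPart]
  intro y hy
  exact hb (by rw [Metric.mem_ball, dist_comm]; linarith)

theorem liminf_rpow {a : ℕ → ℝ≥0∞} {r : ℝ} (hr : 0 < r) :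
    (liminf a atTop) ^ r = liminf (fun n => a n ^ r) atTop :=
  (ENNReal.orderIsoRpow r hr).liminf_apply

/-- Mollification reduces the claim to the smooth case on the inner parts of D, which are again
convex and on which the mollified derivative is the mollification of g. The bounds are uniform, and
Fatou's lemma in y and then in x passes to the limit. -/
theorem HasWeakDeriv.lintegral_enorm_sub_rpow_le [CompleteSpace F] {D : Set (E d)}
    (hD : Convex ℝ D) (ho : IsOpen D) {f : E d → F} {g : E d → E d →L[ℝ] F}
    (hfg : HasWeakDeriv D f g) {R : ℝ≥0∞} (hR : ∀ x ∈ D, ∀ y ∈ D, ‖x - y‖ₑ ≤ R) {q r : ℝ}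
    (hq : 1 ≤ q) (hqr : q ≤ r) :
    ∫⁻ x in D, (∫⁻ y in D, ‖f x - f y‖ₑ) ^ r ≤
      R ^ r * (weightInt (d * (1 / q - 1 / r)) ^ r *
        (2 ^ d * volume D * volume D ^ (r - r / q) * (∫⁻ y in D, ‖g y‖ₑ ^ q) ^ (r / q))) := by
  have hq0 : 0 < q := by linarith
  have hr0 : 0 < r := by linarith
  have hrq : 0 ≤ r - r / q := by
    rw [sub_nonneg]
    exact div_le_self hr0.le hq
  have hm := ho.measurableSet
  let δ : ℕ → ℝ := fun n => 1 / (n + 1)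
  have hδ0 : ∀ n, 0 < δ n := fun n => by positivity
  have hδ : Tendsto δ atTop (𝓝 0) := tendsto_one_div_add_atTop_nhds_zero_nat
  -- An outer radius below δ keeps the kernel inside D for points of the inner part; the fixed ratio
  -- of the radii is what almost everywhere convergence of the convolutions requires.
  let φ : ℕ → ContDiffBump (0 : E d) := fun n =>
    ⟨δ n / 4, δ n / 2, by have := hδ0 n; positivity, by have := hδ0 n; linarith⟩
  have hfi : Integrable (D.indicator f) := (integrable_indicator_iff hm).2 hfg.integrableOn
  let fn : ℕ → E d → F := fun n => MeasureTheory.convolution ((φ n).normed volume)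
    (D.indicator f) (ContinuousLinearMap.lsmul ℝ ℝ) volume
  have hsm : ∀ n, ContDiff ℝ 1 (fn n) := fun n =>
    (φ n).hasCompactSupport_normed.contDiff_convolution_left _ (φ n).contDiff_normed
      hfi.locallyIntegrable
  have hconv : ∀ᵐ x, Tendsto (fun n => fn n x) atTop (𝓝 (D.indicator f x)) := by
    refine ContDiffBump.ae_convolution_tendsto_right_of_locallyIntegrable (K := 2) ?_ ?_
      hfi.locallyIntegrable
    · simpa using hδ.div_const 2
    · refine Eventually.of_forall fun n => ?_
      change δ n / 2 ≤ 2 * (δ n / 4)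
      linarith
  let B : ℝ≥0∞ := R ^ r * (weightInt (d * (1 / q - 1 / r)) ^ r *
        (2 ^ d * volume D * volume D ^ (r - r / q) * (∫⁻ y in D, ‖g y‖ₑ ^ q) ^ (r / q)))
  let S : ℕ → Set (E d) := fun n => innerPart D (δ n)
  have hSD : ∀ n, S n ⊆ D := fun n => innerPart_subset (hδ0 n)
  have hSm : ∀ n, MeasurableSet (S n) := fun n => measurableSet_innerPart D (δ n)
  have hBn : ∀ n, ∫⁻ x in S n, (∫⁻ y in S n, ‖fn n x - fn n y‖ₑ) ^ r ≤ B := by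
    intro n
    refine (_root_.lintegral_enorm_sub_rpow_le (hD.innerPart (δ n)) (hSm n) (hsm n)
      (fun x hx y hy => hR x (hSD n hx) y (hSD n hy)) hq hqr).trans ?_
    have h1 : ∫⁻ y in S n, ‖fderiv ℝ (fn n) y‖ₑ ^ q ≤ ∫⁻ y in D, ‖g y‖ₑ ^ q := by
      refine le_trans (le_of_eq ?_) (lintegral_enorm_integral_smul_rpow_le (D' := S n)
        hfg.integrableOn_deriv.aestronglyMeasurable (φ n) hq)
      refine setLIntegral_congr_fun (hSm n) fun x hx => ?_
      rw [hfg.fderiv_convolution hm (φ n).contDiff_normed (φ n).hasCompactSupport_normed]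
      intro y hy
      rw [(φ n).tsupport_normed_eq, mem_closedBall_zero_iff] at hy
      refine mem_innerPart.1 hx y ?_
      rw [dist_eq_norm]
      have : (φ n).rOut = δ n / 2 := rfl
      have := hδ0 n
      linarith
    have h2 : volume (innerPart D (δ n)) ≤ volume D := measure_mono (hSD n)
    simp only [B]
    gcongr
  have hmeas : ∀ n, Measurable fun p : E d × E d => ‖fn n p.1 - fn n p.2‖ₑ := fun n =>
    (((hsm n).continuous.comp continuous_fst).sub
      ((hsm n).continuous.comp continuous_snd)).enorm.measurable
  let J : ℕ → E d → ℝ≥0∞ := fun n x => ∫⁻ y, (S n).indicator (fun y => ‖fn n x - fn n y‖ₑ) y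
  have hJm : ∀ n, Measurable (J n) := by
    intro n
    have e : J n = fun x => ∫⁻ y in S n, ‖fn n x - fn n y‖ₑ := by
      funext x
      exact lintegral_indicator (hSm n) _
    rw [e]
    exact (hmeas n).lintegral_prod_right'
  have hae : ∀ᵐ x ∂volume.restrict D, (∫⁻ y in D, ‖f x - f y‖ₑ) ^ r
      ≤ liminf (fun n => (S n).indicator (fun x => J n x ^ r) x) atTop := by
    rw [ae_restrict_iff' hm]
    filter_upwards [hconv] with x hx hxD
    rw [indicator_of_mem hxD] at hx
    have h1 : ∫⁻ y in D, ‖f x - f y‖ₑ ≤ liminf (fun n => J n x) atTop := by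
      rw [← lintegral_indicator hm]
      refine le_trans (lintegral_mono_ae ?_) (lintegral_liminf_le fun n =>
        ((hmeas n).comp (measurable_prodMk_left (x := x))).indicator (hSm n))
      filter_upwards [hconv] with y hy
      by_cases hyD : y ∈ D
      · rw [indicator_of_mem hyD] at hy ⊢
        refine le_of_eq (Tendsto.liminf_eq ?_).symm
        refine ((hx.sub hy).enorm).congr' ?_
        filter_upwards [eventually_mem_innerPart ho hδ hyD] with n hn
        rw [indicator_of_mem hn]
      · rw [indicator_of_notMem hyD]
        exact zero_le
    refine (ENNReal.rpow_le_rpow h1 hr0.le).trans ?_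
    rw [liminf_rpow hr0]
    refine liminf_le_liminf ?_
    filter_upwards [eventually_mem_innerPart ho hδ hxD] with n hn
    rw [indicator_of_mem hn]
  calc ∫⁻ x in D, (∫⁻ y in D, ‖f x - f y‖ₑ) ^ r
      ≤ ∫⁻ x in D, liminf (fun n => (S n).indicator (fun x => J n x ^ r) x) atTop :=
        lintegral_mono_ae hae
    _ ≤ liminf (fun n => ∫⁻ x in D, (S n).indicator (fun x => J n x ^ r) x) atTop :=
        lintegral_liminf_le fun n => ((hJm n).pow_const r).indicator (hSm n)
    _ ≤ liminf (fun _ : ℕ => B) atTop := by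
        refine liminf_le_liminf (Eventually.of_forall fun n => ?_)
        refine (setLIntegral_le_lintegral _ _).trans ?_
        rw [lintegral_indicator (hSm n)]
        refine le_trans (le_of_eq ?_) (hBn n)
        refine lintegral_congr fun x => ?_
        simp only [J]
        rw [lintegral_indicator (hSm n)]
    _ = B := liminf_const B

/-- The Poincaré inequality for functions with mean value zero on a convex open set. -/
theorem HasWeakDeriv.poincare [CompleteSpace F] {D : Set (E d)}
    (hD : Convex ℝ D) (ho : IsOpen D) (hne : D.Nonempty) (hfin : volume D ≠ ⊤) {f : E d → F}
    {g : E d → E d →L[ℝ] F}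
    (hfg : HasWeakDeriv D f g) (h0 : ∫ x in D, f x = 0)
    {R : ℝ≥0∞} (hR : ∀ x ∈ D, ∀ y ∈ D, ‖x - y‖ₑ ≤ R) {q r : ℝ}
    (hq : 1 ≤ q) (hqr : q ≤ r) :
    (∫⁻ x in D, ‖f x‖ₑ ^ r) ^ (1 / r) ≤
      R * weightInt (d * (1 / q - 1 / r)) * (2 ^ d) ^ (1 / r) * volume D ^ (1 / r - 1 / q) *
        (∫⁻ y in D, ‖g y‖ₑ ^ q) ^ (1 / q) := by
  have hq0 : 0 < q := by linarith
  have hr0 : 0 < r := by linarith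
  have hv0 : volume D ≠ 0 := (ho.measure_pos volume hne).ne'
  -- Here the zero mean value enters: the integral of f x − f y over y is |D| f x.
  have hpt : ∀ x, volume D * ‖f x‖ₑ ≤ ∫⁻ y in D, ‖f x - f y‖ₑ := by
    intro x
    have e : ∫ y in D, (f x - f y) = volume.real D • f x := by
      have hci : IntegrableOn (fun _ : E d => f x) D := integrableOn_const hfin
      rw [integral_sub hci hfg.integrableOn, h0, setIntegral_const, sub_zero]
    have h1 := enorm_integral_le_lintegral_enorm (μ := volume.restrict D) (fun y => f x - f y)
    rw [e, enorm_smul] at h1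
    convert h1 using 2
    rw [measureReal_def, Real.enorm_of_nonneg ENNReal.toReal_nonneg, ENNReal.ofReal_toReal hfin]
  have h2 : volume D ^ r * ∫⁻ x in D, ‖f x‖ₑ ^ r ≤ ∫⁻ x in D, (∫⁻ y in D, ‖f x - f y‖ₑ) ^ r := by
    rw [← lintegral_const_mul' _ _ (ENNReal.rpow_ne_top_of_nonneg hr0.le hfin)]
    refine lintegral_mono fun x => ?_
    rw [← ENNReal.mul_rpow_of_nonneg _ _ hr0.le]
    exact ENNReal.rpow_le_rpow (hpt x) hr0.le
  have h3 := h2.trans (hfg.lintegral_enorm_sub_rpow_le hD ho hR hq hqr)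
  set N := ∫⁻ x in D, ‖f x‖ₑ ^ r
  set Q := ∫⁻ y in D, ‖g y‖ₑ ^ q
  set w := weightInt (d * (1 / q - 1 / r))
  set v := volume D
  have h4 := ENNReal.rpow_le_rpow h3 (one_div_nonneg.2 hr0.le)
  have hi : 0 ≤ 1 / r := one_div_nonneg.2 hr0.le
  simp only [ENNReal.mul_rpow_of_nonneg _ _ hi, ← ENNReal.rpow_mul] at h4
  rw [mul_one_div_cancel hr0.ne', ENNReal.rpow_one, ENNReal.rpow_one, ENNReal.rpow_one,
    show r / q * (1 / r) = 1 / q by field_simp] at h4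
  rw [← ENNReal.mul_le_mul_iff_right hv0 hfin]
  refine h4.trans (le_of_eq ?_)
  have h5 : v ^ (1 / r) * v ^ ((r - r / q) * (1 / r)) = v * v ^ (1 / r - 1 / q) := by
    nth_rw 3 [← ENNReal.rpow_one v]
    rw [← ENNReal.rpow_add _ _ hv0 hfin, ← ENNReal.rpow_add _ _ hv0 hfin]
    congr 1
    field_simp
    ring
  calc R * (w * ((2 ^ d) ^ (1 / r) * v ^ (1 / r) * v ^ ((r - r / q) * (1 / r)) * Q ^ (1 / q)))
      = R * (w * ((2 ^ d) ^ (1 / r) * (v ^ (1 / r) * v ^ ((r - r / q) * (1 / r))) *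
          Q ^ (1 / q))) := by ring
    _ = _ := by rw [h5]; ring

end Poincare

/-! ### Higher-order Poincaré–Sobolev estimates for mean-zero jets -/

section BrambleHilbert

variable {d : ℕ}

/-- The part of a `(k+1)`-st gradient with last index `a`. -/
noncomputable def gradSlice (k : ℕ) (a : Fin d) : GradVal d (k + 1) →L[ℝ] GradVal d k :=
  ((PiLp.continuousLinearEquiv 2 ℝ (fun _ : Fin k → Fin d => E d)).symm :
      (((_ : Fin k → Fin d) → E d) →L[ℝ] GradVal d k)).comp
    (ContinuousLinearMap.pi fun i : Fin k → Fin d =>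
      PiLp.proj (𝕜 := ℝ) 2 (fun _ : Fin (k + 1) → Fin d => E d)
        (Fin.snoc (α := fun _ => Fin d) i a))

/-- A `(k+1)`-st gradient, seen as the derivative of a `k`-th gradient. -/
noncomputable def gradOp (k : ℕ) : GradVal d (k + 1) →L[ℝ] E d →L[ℝ] GradVal d k :=
  ∑ a, (ContinuousLinearMap.smulRightL ℝ (E d) (GradVal d k)
    (EuclideanSpace.proj a : E d →L[ℝ] ℝ)).comp (gradSlice k a)

theorem gradOp_single (k : ℕ) (V : GradVal d (k + 1)) (a : Fin d) (i : Fin k → Fin d) :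
    gradOp k V (EuclideanSpace.single a 1) i = V (Fin.snoc (α := fun _ => Fin d) i a) := by
  have h : gradOp k V (EuclideanSpace.single a 1) = gradSlice k a V := by
    simp only [gradOp, sum_apply]
    rw [Finset.sum_eq_single a]
    · simp
    · intro b _ hb
      simp [hb]
    · simp
  rw [h]
  rfl

theorem IsWeakGrad.hasWeakDeriv {D : Set (E d)} {k : ℕ} {u : E d → E d} {U : E d → GradVal d k}
    {V : E d → GradVal d (k + 1)} (hU : IsWeakGrad D k u U) (hV : IsWeakGrad D (k + 1) u V)
    (hUi : IntegrableOn U D) (hVi : IntegrableOn V D) :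
    HasWeakDeriv D U (fun x => gradOp k (V x)) := by
  have hgi : IntegrableOn (fun x => gradOp k (V x)) D := (gradOp k).integrable_comp hVi
  refine ⟨hUi, hgi, fun φ h1 h2 h3 a => ?_⟩
  have hb : ∀ {ψ : E d → ℝ} {G : E d → GradVal d k}, Continuous ψ → HasCompactSupport ψ →
      IntegrableOn G D → IntegrableOn (fun x => ψ x • G x) D := by
    intro ψ G hψ hψc hG
    obtain ⟨C, hC⟩ := hψ.bounded_above_of_compact_support hψc
    exact hG.bdd_smul C hψ.aestronglyMeasurable (Eventually.of_forall hC)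
  have hgai : IntegrableOn (fun x => gradOp k (V x) (EuclideanSpace.single a 1)) D :=
    (ContinuousLinearMap.apply ℝ (GradVal d k)
      (EuclideanSpace.single a (1 : ℝ) : E d)).integrable_comp hgi
  ext1 i
  rw [gradVal_integral_apply (hb (contDiff_coordD a h1).continuous
    (hasCompactSupport_coordD a h2) hUi), PiLp.neg_apply,
    gradVal_integral_apply (hb h1.continuous h2 hgai)]
  simp only [PiLp.smul_apply, gradOp_single]
  exact hU.integral_coordD_smul hV h1 h2 h3 a i

/-- `W 0, …, W ℓ` are successive weak gradients on `D`, with mean value zero below order `ℓ`. -/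
structure IsMeanZeroJet (D : Set (E d)) (ℓ : ℕ) (W : ∀ k, E d → GradVal d k) : Prop where
  measurable : ∀ k ≤ ℓ, AEStronglyMeasurable (W k) (volume.restrict D)
  hasWeakDeriv : ∀ k < ℓ, HasWeakDeriv D (W k) (fun x => gradOp k (W (k + 1) x))
  integral_eq_zero : ∀ k < ℓ, ∫ x in D, W k x = 0

/-- The `L^r` norm on `D`, as an integral. -/
noncomputable def lpN {F : Type*} [NormedAddCommGroup F] (D : Set (E d)) (r : ℝ) (f : E d → F) :
    ℝ≥0∞ := (∫⁻ x in D, ‖f x‖ₑ ^ r) ^ (1 / r)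

theorem lpN_le_measure_rpow_mul {F : Type*} [NormedAddCommGroup F] {D : Set (E d)} {f : E d → F}
    (hf : AEStronglyMeasurable f (volume.restrict D)) {r q : ℝ} (hr : 0 < r) (hrq : r ≤ q) :
    lpN D r f ≤ volume D ^ (1 / r - 1 / q) * lpN D q f := by
  have h := eLpNorm'_le_eLpNorm'_mul_rpow_measure_univ hr hrq hf
  rw [Measure.restrict_apply_univ, mul_comm] at h
  exact h

/-- One application of the Poincaré inequality. The powers of R and |D| are kept explicit, so that C
is chosen before D and the estimate scales correctly on every cell. -/
theorem IsMeanZeroJet.lpN_le_succ (ℓ k : ℕ) (hk : k < ℓ) {q r : ℝ} (hq : 1 ≤ q) (hqr : q ≤ r)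
    (hθ : d * (1 / q - 1 / r) < 1) : ∃ C : ℝ≥0∞, C ≠ ⊤ ∧ ∀ (D : Set (E d))
      (W : ∀ k, E d → GradVal d k) (R : ℝ≥0∞), Convex ℝ D → IsOpen D → D.Nonempty →
      volume D ≠ ⊤ → (∀ x ∈ D, ∀ y ∈ D, ‖x - y‖ₑ ≤ R) → IsMeanZeroJet D ℓ W →
      lpN D r (W k) ≤ C * R * volume D ^ (1 / r - 1 / q) * lpN D q (W (k + 1)) := by
  have hq0 : 0 < q := by linarith
  have hr0 : 0 < r := by linarith
  refine ⟨weightInt (d * (1 / q - 1 / r)) * (2 ^ d) ^ (1 / r) *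
    ‖gradOp (d := d) k‖ₑ, ?_, ?_⟩
  · have := (weightInt_lt_top hθ).ne
    have : ((2 : ℝ≥0∞) ^ d) ^ (1 / r) ≠ ⊤ :=
      ENNReal.rpow_ne_top_of_nonneg (by positivity) (by simp)
    finiteness
  · intro D W R hc ho hne hfin hR hW
    have h := (hW.hasWeakDeriv k hk).poincare hc ho hne hfin (hW.integral_eq_zero k hk) hR hq hqr
    have h2 : (∫⁻ x in D, ‖gradOp k (W (k + 1) x)‖ₑ ^ q) ^ (1 / q)
        ≤ ‖gradOp (d := d) k‖ₑ * lpN D q (W (k + 1)) := by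
      rw [lpN]
      have e : ‖gradOp (d := d) k‖ₑ = (‖gradOp (d := d) k‖ₑ ^ q) ^ (1 / q) := by
        rw [← ENNReal.rpow_mul, mul_one_div_cancel hq0.ne', ENNReal.rpow_one]
      rw [e, ← ENNReal.mul_rpow_of_nonneg _ _ (by positivity),
        ← lintegral_const_mul' _ _ (ENNReal.rpow_ne_top_of_nonneg hq0.le (by finiteness))]
      gcongr with x
      rw [← ENNReal.mul_rpow_of_nonneg _ _ hq0.le]
      gcongr
      exact ContinuousLinearMap.le_opENorm _ _
    refine h.trans ((mul_le_mul_right h2 _).trans (le_of_eq ?_))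
    ring

/-- The gap 1/q − 1/r is divided into n equal portions θ, one for each derivative. Each step then
satisfies dθ < 1, and the intermediate exponents are the reciprocals of 1/q − iθ. -/
theorem IsMeanZeroJet.lpN_le_of_le (ℓ n : ℕ) (hn : n ≤ ℓ) (hn0 : 0 < n) {q r : ℝ} (hq : 1 ≤ q)
    (hqr : q ≤ r) (hθ : d * (1 / q - 1 / r) < n) : ∃ C : ℝ≥0∞, C ≠ ⊤ ∧ ∀ (D : Set (E d))
      (W : ∀ k, E d → GradVal d k) (R : ℝ≥0∞), Convex ℝ D → IsOpen D → D.Nonempty →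
      volume D ≠ ⊤ → (∀ x ∈ D, ∀ y ∈ D, ‖x - y‖ₑ ≤ R) → IsMeanZeroJet D ℓ W →
      lpN D r (W (ℓ - n)) ≤ C * R ^ n * volume D ^ (1 / r - 1 / q) * lpN D q (W ℓ) := by
  have hq0 : 0 < q := by linarith
  have hr0 : 0 < r := by linarith
  have hnR : (0 : ℝ) < n := by exact_mod_cast hn0
  set θ := (1 / q - 1 / r) / n with hθdef
  have hθ0 : 0 ≤ θ := div_nonneg (sub_nonneg.2 (one_div_le_one_div_of_le hq0 hqr)) hnR.le
  have hnθ : n * θ = 1 / q - 1 / r := by rw [hθdef]; field_simp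
  have hdθ : d * θ < 1 := by
    rw [hθdef, ← mul_div_assoc, div_lt_one hnR]
    exact hθ
  -- The reciprocal exponents decrease from 1/q to 1/r > 0, so all intermediate exponents are
  -- finite.
  have hpos : ∀ i ≤ n, 0 < 1 / q - i * θ := by
    intro i hi
    have h1 : (i : ℝ) * θ ≤ n * θ := by gcongr
    have h2 : 0 < 1 / r := by positivity
    linarith
  suffices H : ∀ i ≤ n, ∃ C : ℝ≥0∞, C ≠ ⊤ ∧ ∀ (D : Set (E d))
      (W : ∀ k, E d → GradVal d k) (R : ℝ≥0∞), Convex ℝ D → IsOpen D → D.Nonempty →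
      volume D ≠ ⊤ → (∀ x ∈ D, ∀ y ∈ D, ‖x - y‖ₑ ≤ R) → IsMeanZeroJet D ℓ W →
      lpN D (1 / (1 / q - i * θ)) (W (ℓ - i)) ≤
        C * R ^ i * volume D ^ ((1 / q - i * θ) - 1 / q) * lpN D q (W ℓ) by
    obtain ⟨C, hC, h⟩ := H n le_rfl
    refine ⟨C, hC, ?_⟩
    rw [hnθ] at h
    simpa using h
  intro i
  induction i with
  | zero =>
    intro _
    refine ⟨1, by simp, ?_⟩
    intro D W R _ _ _ _ _ _
    simp
  | succ i ih =>
    intro hi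
    obtain ⟨C, hC, h⟩ := ih (by omega)
    have p1 := hpos i (by omega)
    have p2 := hpos (i + 1) hi
    have hle : 1 / q - (i + 1 : ℕ) * θ ≤ 1 / q - i * θ := by
      push_cast
      linarith
    obtain ⟨C', hC', h'⟩ := IsMeanZeroJet.lpN_le_succ (d := d) ℓ (ℓ - (i + 1)) (by omega)
      (q := 1 / (1 / q - i * θ)) (r := 1 / (1 / q - (i + 1 : ℕ) * θ))
      ((one_le_div p1).2 (by
        have : 1 / q ≤ 1 := (div_le_one hq0).2 hq
        have : 0 ≤ (i : ℝ) * θ := by positivity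
        linarith))
      (one_div_le_one_div_of_le p2 hle) (by
        rw [one_div_one_div, one_div_one_div]
        push_cast
        linarith)
    refine ⟨C' * C, by finiteness, ?_⟩
    intro D W R hc ho hne hfin hR hW
    have a1 := h D W R hc ho hne hfin hR hW
    have a2 := h' D W R hc ho hne hfin hR hW
    rw [one_div_one_div, one_div_one_div, show ℓ - (i + 1) + 1 = ℓ - i by omega] at a2
    refine a2.trans ((mul_le_mul_right a1 _).trans (le_of_eq ?_))
    have hv0 : volume D ≠ 0 := (ho.measure_pos volume hne).ne'
    have e : volume D ^ (1 / q - (i + 1 : ℕ) * θ - 1 / q)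
        = volume D ^ (1 / q - (i + 1 : ℕ) * θ - (1 / q - i * θ))
          * volume D ^ (1 / q - i * θ - 1 / q) := by
      rw [← ENNReal.rpow_add _ _ hv0 hfin]
      congr 1
      ring
    rw [e, pow_succ]
    ring

/-- For r ≤ q the estimate with r replaced by q is combined with Hölder's inequality on D, and n = 0
is admissible. For q < r the strict inequality forces n > 0. -/
theorem IsMeanZeroJet.lpN_le (ℓ n : ℕ) (hn : n ≤ ℓ) {q r : ℝ} (hq : 1 ≤ q) (hr : 1 ≤ r)
    (hθ : r ≤ q ∨ d * (1 / q - 1 / r) < n) : ∃ C : ℝ≥0∞, C ≠ ⊤ ∧ ∀ (D : Set (E d))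
      (W : ∀ k, E d → GradVal d k) (R : ℝ≥0∞), Convex ℝ D → IsOpen D → D.Nonempty →
      volume D ≠ ⊤ → (∀ x ∈ D, ∀ y ∈ D, ‖x - y‖ₑ ≤ R) → IsMeanZeroJet D ℓ W →
      lpN D r (W (ℓ - n)) ≤ C * R ^ n * volume D ^ (1 / r - 1 / q) * lpN D q (W ℓ) := by
  rcases le_or_gt r q with hrq | hqr
  · have hqq : ∃ C : ℝ≥0∞, C ≠ ⊤ ∧ ∀ (D : Set (E d))
        (W : ∀ k, E d → GradVal d k) (R : ℝ≥0∞), Convex ℝ D → IsOpen D → D.Nonempty →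
        volume D ≠ ⊤ → (∀ x ∈ D, ∀ y ∈ D, ‖x - y‖ₑ ≤ R) → IsMeanZeroJet D ℓ W →
        lpN D q (W (ℓ - n)) ≤ C * R ^ n * lpN D q (W ℓ) := by
      rcases Nat.eq_zero_or_pos n with rfl | hn0
      · exact ⟨1, by simp, by intros; simp⟩
      · obtain ⟨C, hC, h⟩ := IsMeanZeroJet.lpN_le_of_le (d := d) ℓ n hn hn0 hq le_rfl
          (by simpa using hn0)
        exact ⟨C, hC, by simpa using h⟩
    obtain ⟨C, hC, h⟩ := hqq
    refine ⟨C, hC, fun D W R hc ho hne hfin hR hW => ?_⟩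
    refine (lpN_le_measure_rpow_mul (hW.measurable _ (by omega)) (by linarith) hrq).trans ?_
    refine (mul_le_mul_right (h D W R hc ho hne hfin hR hW) _).trans (le_of_eq ?_)
    ring
  · have hlt := hθ.resolve_left (by linarith)
    have hn0 : 0 < n := by
      by_contra h0
      obtain rfl : n = 0 := by omega
      have h1 : 0 ≤ (d : ℝ) * (1 / q - 1 / r) := mul_nonneg (by positivity)
        (sub_nonneg.2 (one_div_le_one_div_of_le (by linarith) hqr.le))
      simp only [Nat.cast_zero] at hlt
      linarith
    exact IsMeanZeroJet.lpN_le_of_le ℓ n hn hn0 hq hqr.le hlt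

theorem exists_polyField_isMeanZeroJet {D : Set (E d)} (hD : IsOpen D)
    (hb : Bornology.IsBounded D) (hne : D.Nonempty) {ℓ : ℕ} {u : E d → E d}
    {U : ∀ k, E d → GradVal d k} (hU : ∀ k ≤ ℓ, IsWeakGrad D k u (U k))
    (hi : ∀ k ≤ ℓ, IntegrableOn (U k) D) :
    ∃ Q : Fin d → MvPolynomial (Fin d) ℝ, (∀ c, (Q c).totalDegree ≤ ℓ - 1) ∧
      (∀ x, classGrad ℓ (polyField Q) x = 0) ∧
      IsMeanZeroJet D ℓ fun k x => U k x - classGrad k (polyField Q) x := by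
  obtain ⟨Q, h1, h2, h3⟩ := exists_polyField_integral_eq hD hb hne
    (fun k hk => hU k (Nat.le_of_lt hk)) (fun k hk => hi k (Nat.le_of_lt hk))
  have hcQ : ∀ k, IntegrableOn (classGrad k (polyField Q)) D := fun k =>
    integrableOn_of_continuous (continuous_classGrad k (contDiff_polyField Q)) hb
  have hW : ∀ k ≤ ℓ, IsWeakGrad D k (u - polyField Q)
      (fun x => U k x - classGrad k (polyField Q) x) :=
    fun k hk => (hU k hk).sub (isWeakGrad_of_contDiff k (contDiff_polyField Q))
  have hWi : ∀ k ≤ ℓ, IntegrableOn (fun x => U k x - classGrad k (polyField Q) x) D :=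
    fun k hk => (hi k hk).sub (hcQ k)
  exact ⟨Q, h1, h2 ℓ le_rfl, fun k hk => (hWi k hk).aestronglyMeasurable,
    fun k hk => (hW k hk.le).hasWeakDeriv (hW (k + 1) hk) (hWi k hk.le) (hWi (k + 1) hk), h3⟩

end BrambleHilbert

/-! ### Inverse estimates for polynomials -/

section InverseEstimate

variable {d : ℕ}

/-- By continuity the polynomial vanishes everywhere on the ball, which contains an open cube, a
product of infinite sets. -/
theorem mvPolynomial_eq_zero_of_ae (p : MvPolynomial (Fin d) ℝ)
    (h : ∀ᵐ x ∂volume.restrict (Metric.ball (0 : E d) 1),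
      MvPolynomial.eval (fun l => x l) p = 0) : p = 0 := by
  have hc : Continuous fun x : E d => MvPolynomial.eval (fun l => x l) p :=
    (contDiff_mvPolynomial_eval p).continuous
  have h0 : EqOn (fun x : E d => MvPolynomial.eval (fun l => x l) p) 0 (Metric.ball 0 1) :=
    Measure.eqOn_open_of_ae_eq (μ := volume) h Metric.isOpen_ball hc.continuousOn
      continuousOn_const
  have hopen : IsOpen ((WithLp.toLp 2 : (Fin d → ℝ) → E d) ⁻¹' Metric.ball 0 1) :=
    Metric.isOpen_ball.preimage (PiLp.continuous_toLp 2 _)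
  obtain ⟨ε, hε, hsub⟩ := Metric.isOpen_iff.1 hopen 0 (by simp)
  refine MvPolynomial.funext_set (fun _ => Ioo (-ε) ε)
    (fun _ => Ioo_infinite (by linarith)) fun x hx => ?_
  have hx' : x ∈ Metric.ball (0 : Fin d → ℝ) ε := by
    rw [mem_ball_zero_iff, pi_norm_lt_iff hε]
    intro l
    have := hx l (mem_univ l)
    rw [Real.norm_eq_abs, abs_lt]
    exact this
  have := h0 (hsub hx')
  simpa using this

/-- Equivalence of norms in finite dimension: the L¹ norm on the unit ball is definite on
polynomials of bounded degree, so it dominates the supremum over any fixed ball. -/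
theorem exists_abs_eval_le_integral (n : ℕ) (β : ℝ) : ∃ C : ℝ, 0 ≤ C ∧
    ∀ p : MvPolynomial (Fin d) ℝ, p.totalDegree ≤ n → ∀ y ∈ Metric.closedBall (0 : E d) β,
      |MvPolynomial.eval (fun l => y l) p| ≤
        C * ∫ x in Metric.ball (0 : E d) 1, ‖MvPolynomial.eval (fun l => x l) p‖ := by
  let B := Metric.ball (0 : E d) 1
  have hcont : ∀ p : MvPolynomial (Fin d) ℝ,
      Continuous fun x : E d => MvPolynomial.eval (fun l => x l) p := fun p =>
    (contDiff_mvPolynomial_eval p).continuous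
  have hint : ∀ p : MvPolynomial (Fin d) ℝ,
      Integrable (fun x : E d => MvPolynomial.eval (fun l => x l) p) (volume.restrict B) :=
    fun p => integrableOn_of_continuous (hcont p) Metric.isBounded_ball
  let J : MvPolynomial.restrictTotalDegree (Fin d) ℝ n →ₗ[ℝ] Lp ℝ 1 (volume.restrict B) :=
    { toFun := fun p => (hint p).toL1 _
      map_add' := fun p q => by
        rw [← Integrable.toL1_add]
        congr 1
        funext x
        simp
      map_smul' := fun c p => by
        rw [RingHom.id_apply, ← Integrable.toL1_smul]
        congr 1
        simp }
  have hJ : Function.Injective J := by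
    rw [← LinearMap.ker_eq_bot, LinearMap.ker_eq_bot']
    intro p hp
    have h1 : (hint p).toL1 _ = (integrable_zero (E d) ℝ (volume.restrict B)).toL1 _ := by
      rw [Integrable.toL1_zero]
      exact hp
    have h2 := (Integrable.toL1_eq_toL1_iff _ _ _ _).1 h1
    exact Subtype.ext (mvPolynomial_eq_zero_of_ae _ h2)
  have : CompactSpace (Metric.closedBall (0 : E d) β) :=
    isCompact_iff_compactSpace.1 (isCompact_closedBall _ _)
  let Φ : MvPolynomial.restrictTotalDegree (Fin d) ℝ n →ₗ[ℝ] C(Metric.closedBall (0 : E d) β, ℝ) :=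
    { toFun := fun p => ⟨fun y => MvPolynomial.eval (fun l => (y : E d) l) p.1,
        (hcont p).comp continuous_subtype_val⟩
      map_add' := fun p q => by
        ext y
        simp
      map_smul' := fun c p => by
        ext y
        simp }
  let e := LinearEquiv.ofInjective J hJ
  -- The map from the range of J, a finite-dimensional subspace of L¹, is linear and hence bounded;
  -- its operator norm is the constant.
  let Ψ := (Φ.comp e.symm.toLinearMap).toContinuousLinearMap
  refine ⟨‖Ψ‖, Ψ.opNorm_nonneg, fun p hp y hy => ?_⟩
  let p' : MvPolynomial.restrictTotalDegree (Fin d) ℝ n :=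
    ⟨p, (MvPolynomial.mem_restrictTotalDegree _ _ _).2 hp⟩
  have h1 : Ψ (e p') = Φ p' := by
    change Φ (e.symm (e p')) = _
    rw [e.symm_apply_apply]
  have h2 := Ψ.le_opNorm (e p')
  rw [h1] at h2
  have h3 : ‖e p'‖ = ∫ x in B, ‖MvPolynomial.eval (fun l => x l) p‖ := by
    change ‖(hint p).toL1 _‖ = _
    rw [L1.norm_of_fun_eq_integral_norm]
  rw [h3] at h2
  exact (ContinuousMap.norm_coe_le_norm (Φ p') ⟨y, hy⟩).trans h2

theorem exists_totalDegree_comp_affine_le (n : ℕ) (p : MvPolynomial (Fin d) ℝ)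
    (hp : p.totalDegree ≤ n) (x₀ : E d) (s : ℝ) : ∃ p' : MvPolynomial (Fin d) ℝ,
      p'.totalDegree ≤ n ∧ ∀ z : E d, MvPolynomial.eval (fun l => z l) p' =
        MvPolynomial.eval (fun l => (x₀ + s • z) l) p := by
  let f : Fin d → MvPolynomial (Fin d) ℝ := fun l =>
    MvPolynomial.C (x₀ l) + MvPolynomial.C s * MvPolynomial.X l
  have hf : ∀ l, (f l).totalDegree ≤ 1 := by
    intro l
    refine (MvPolynomial.totalDegree_add _ _).trans (max_le (by simp) ?_)
    refine (MvPolynomial.totalDegree_mul _ _).trans ?_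
    simp
  refine ⟨MvPolynomial.aeval f p, ?_, ?_⟩
  · rw [MvPolynomial.aeval_def, MvPolynomial.eval₂_eq]
    refine MvPolynomial.totalDegree_finsetSum_le fun m hm => ?_
    refine (MvPolynomial.totalDegree_mul _ _).trans ?_
    rw [MvPolynomial.algebraMap_eq, MvPolynomial.totalDegree_C, zero_add]
    refine (MvPolynomial.totalDegree_finsetProd _ _).trans ?_
    refine le_trans ?_ ((MvPolynomial.le_totalDegree hm).trans hp)
    refine Finset.sum_le_sum fun l _ => ?_
    refine (MvPolynomial.totalDegree_pow _ _).trans ?_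
    exact (Nat.mul_le_mul_left _ (hf l)).trans (by simp)
  · intro z
    rw [← MvPolynomial.coe_aeval_eq_eval, ← MvPolynomial.coe_aeval_eq_eval]
    simp only [RingHom.coe_coe]
    rw [← AlgHom.comp_apply, MvPolynomial.comp_aeval]
    congr 2
    funext l
    simp [f]

/-- Affine changes of variable preserve the degree, so the estimate transfers from the unit ball;
the integral is rescaled by s^(−d). -/
theorem exists_enorm_eval_le_lintegral (n : ℕ) (β : ℝ) : ∃ C : ℝ≥0∞, C ≠ ⊤ ∧
    ∀ p : MvPolynomial (Fin d) ℝ, p.totalDegree ≤ n → ∀ (x₀ : E d) (s : ℝ), 0 < s →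
      ∀ y ∈ Metric.closedBall x₀ (β * s),
      ‖MvPolynomial.eval (fun l => y l) p‖ₑ ≤ C * ENNReal.ofReal s ^ (-(d : ℝ)) *
        ∫⁻ x in Metric.ball x₀ s, ‖MvPolynomial.eval (fun l => x l) p‖ₑ := by
  obtain ⟨C, hC, h⟩ := exists_abs_eval_le_integral (d := d) n β
  refine ⟨ENNReal.ofReal C, by simp, fun p hp x₀ s hs y hy => ?_⟩
  obtain ⟨p', hp', he⟩ := exists_totalDegree_comp_affine_le n p hp x₀ s
  let z : E d := s⁻¹ • (y - x₀)
  have hyz : x₀ + s • z = y := by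
    simp [z, smul_smul, mul_inv_cancel₀ hs.ne']
  have hz : z ∈ Metric.closedBall (0 : E d) β := by
    rw [mem_closedBall_zero_iff, norm_smul, norm_inv, Real.norm_of_nonneg hs.le,
      inv_mul_le_iff₀ hs, mul_comm, ← dist_eq_norm]
    exact hy
  have h1 := h p' hp' z hz
  have hint : Integrable (fun x : E d => MvPolynomial.eval (fun l => x l) p')
      (volume.restrict (Metric.ball 0 1)) :=
    integrableOn_of_continuous (contDiff_mvPolynomial_eval p').continuous Metric.isBounded_ball
  have h2 := ENNReal.ofReal_le_ofReal h1
  rw [ENNReal.ofReal_mul hC, ofReal_integral_norm_eq_lintegral_enorm hint, he, hyz,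
    ← Real.enorm_eq_ofReal_abs] at h2
  refine h2.trans ?_
  rw [mul_assoc]
  gcongr
  let G : E d → ℝ≥0∞ := (Metric.ball x₀ s).indicator
    fun x => ‖MvPolynomial.eval (fun l => x l) p‖ₑ
  have hG : Measurable G :=
    (contDiff_mvPolynomial_eval p).continuous.enorm.measurable.indicator measurableSet_ball
  rw [← lintegral_indicator measurableSet_ball, ← lintegral_indicator measurableSet_ball,
    ← lintegral_comp_add_smul x₀ hs hG]
  refine lintegral_mono fun w => ?_
  by_cases hw : w ∈ Metric.ball (0 : E d) 1
  · have : x₀ + s • w ∈ Metric.ball x₀ s := by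
      rw [mem_ball_zero_iff] at hw
      rw [mem_ball_iff_norm, add_sub_cancel_left, norm_smul, Real.norm_of_nonneg hs.le]
      nlinarith
    simp only [G]
    rw [indicator_of_mem hw, indicator_of_mem this, he]
  · rw [indicator_of_notMem hw]
    exact zero_le

theorem piLp_norm_le_sum {ι : Type*} [Fintype ι] {G : Type*} [NormedAddCommGroup G]
    (V : PiLp 2 fun _ : ι => G) : ‖V‖ ≤ ∑ i, ‖V i‖ := by
  refine abs_le_of_sq_le_sq' ?_ (Finset.sum_nonneg fun i _ => norm_nonneg _) |>.2
  rw [PiLp.norm_sq_eq_of_L2]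
  exact Finset.sum_sq_le_sq_sum_of_nonneg fun i _ => norm_nonneg _

theorem enorm_gradVal_le_sum {j : ℕ} (V : GradVal d j) : ‖V‖ₑ ≤ ∑ i, ∑ c, ‖V i c‖ₑ := by
  have h : ‖V‖ ≤ ∑ i, ∑ c, ‖V i c‖ :=
    (piLp_norm_le_sum V).trans (Finset.sum_le_sum fun i _ => piLp_norm_le_sum (V i))
  simp only [← ofReal_norm]
  refine (ENNReal.ofReal_le_ofReal h).trans (le_of_eq ?_)
  rw [ENNReal.ofReal_sum_of_nonneg fun i _ => Finset.sum_nonneg fun c _ => norm_nonneg _]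
  refine Finset.sum_congr rfl fun i _ => ?_
  rw [ENNReal.ofReal_sum_of_nonneg fun c _ => norm_nonneg _]

theorem enorm_gradVal_apply_le {j : ℕ} (V : GradVal d j) (i : Fin j → Fin d) (c : Fin d) :
    ‖V i c‖ₑ ≤ ‖V‖ₑ := by
  simp only [← ofReal_norm]
  exact ENNReal.ofReal_le_ofReal ((PiLp.norm_apply_le (V i) c).trans (PiLp.norm_apply_le V i))

/-- The maximum of the gradient of a polynomial field on a large ball is controlled by its mean
value on a smaller ball. -/
theorem exists_enorm_classGrad_le_lintegral (n j : ℕ) (β : ℝ) : ∃ C : ℝ≥0∞, C ≠ ⊤ ∧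
    ∀ Q : Fin d → MvPolynomial (Fin d) ℝ, (∀ c, (Q c).totalDegree ≤ n) →
      ∀ (x₀ : E d) (s : ℝ), 0 < s → ∀ y ∈ Metric.closedBall x₀ (β * s),
      ‖classGrad j (polyField Q) y‖ₑ ≤ C * ENNReal.ofReal s ^ (-(d : ℝ)) *
        ∫⁻ x in Metric.ball x₀ s, ‖classGrad j (polyField Q) x‖ₑ := by
  obtain ⟨C, hC, h⟩ := exists_enorm_eval_le_lintegral (d := d) n β
  have hfin : (∑ _i : Fin j → Fin d, ∑ _c : Fin d, (1 : ℝ≥0∞)) ≠ ⊤ := by simp [ENNReal.mul_eq_top]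
  refine ⟨(∑ _i : Fin j → Fin d, ∑ _c : Fin d, 1) * C, ENNReal.mul_ne_top hfin hC, ?_⟩
  intro Q hQ x₀ s hs y hy
  refine (enorm_gradVal_le_sum _).trans ?_
  rw [mul_assoc, mul_assoc, Finset.sum_mul]
  refine Finset.sum_le_sum fun i _ => ?_
  rw [Finset.sum_mul]
  refine Finset.sum_le_sum fun c _ => ?_
  rw [one_mul, classGrad_polyField_apply]
  refine (h _ ((totalDegree_polyD_le _ _).trans (hQ c)) x₀ s hs y hy).trans ?_
  rw [mul_assoc]
  gcongr with x
  rw [← classGrad_polyField_apply]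
  exact enorm_gradVal_apply_le _ _ _

end InverseEstimate

/-! ### Cells of a triangulation and their intersections -/

section SimplexGeometry

variable {d : ℕ}

theorem convex_simplex (s : Finset (E d)) : Convex ℝ (simplex s) := convex_convexHull ℝ _

theorem isCompact_simplex (s : Finset (E d)) : IsCompact (simplex s) :=
  s.finite_toSet.isCompact_convexHull ℝ

theorem affineSpan_ne_top_of_card_le {s : Finset (E d)} (hs : s.card ≤ d) :
    affineSpan ℝ (s : Set (E d)) ≠ ⊤ := by
  classical
  intro htop
  have hdim : Module.finrank ℝ (vectorSpan ℝ (s : Set (E d))) = d := by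
    rw [← direction_affineSpan, htop, AffineSubspace.direction_top, finrank_top]
    simp
  rcases s.eq_empty_or_nonempty with rfl | hne
  · simp only [Finset.coe_empty, AffineSubspace.span_empty] at htop
    exact AffineSubspace.bot_ne_top ℝ (E d) (E d) htop
  · have h1 := finrank_vectorSpan_image_finset_le ℝ (id : E d → E d) s (n := s.card - 1)
      (by have := hne.card_pos; omega)
    rw [Finset.image_id, hdim] at h1
    have := hne.card_pos
    omega

theorem measure_affineSpan_eq_zero {s : Finset (E d)} (hs : s.card ≤ d) :
    volume (affineSpan ℝ (s : Set (E d)) : Set (E d)) = 0 :=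
  Measure.addHaar_affineSubspace _ _ (affineSpan_ne_top_of_card_le hs)

theorem measure_simplex_eq_zero {s : Finset (E d)} (hs : s.card ≤ d) : volume (simplex s) = 0 :=
  measure_mono_null (convexHull_subset_affineSpan _) (measure_affineSpan_eq_zero hs)

end SimplexGeometry

namespace Triangulation

variable {d : ℕ} {Ω : Set (E d)} (T : Triangulation Ω)

theorem finite_cells : T.cells.Finite := T.finite_faces.subset fun _ h => h.1

theorem indep_cell {s : Finset (E d)} (hs : s ∈ T.cells) :
    AffineIndependent ℝ ((↑) : s → E d) := T.indep hs.1

theorem affineSpan_cell {s : Finset (E d)} (hs : s ∈ T.cells) :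
    affineSpan ℝ (s : Set (E d)) = ⊤ := by
  have h := (T.indep_cell hs).affineSpan_eq_top_iff_card_eq_finrank_add_one.2
    (by simp [hs.2])
  simpa using h

theorem interior_simplex_nonempty {s : Finset (E d)} (hs : s ∈ T.cells) :
    (interior (simplex s)).Nonempty :=
  interior_convexHull_nonempty_iff_affineSpan_eq_top.2 (T.affineSpan_cell hs)

theorem closure_interior_simplex {s : Finset (E d)} (hs : s ∈ T.cells) :
    closure (interior (simplex s)) = simplex s := by
  rw [(convex_simplex s).closure_interior_eq_closure_of_nonempty_interior
    (T.interior_simplex_nonempty hs), (isCompact_simplex s).isClosed.closure_eq]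

theorem isBounded (T : Triangulation Ω) : Bornology.IsBounded Ω := by
  refine Bornology.IsBounded.subset ?_ (subset_closure.trans T.space_eq.symm.subset)
  exact (Bornology.isBounded_biUnion T.finite_faces).2 fun s _ =>
    (isCompact_simplex s).isBounded

theorem simplex_subset_closure {s : Finset (E d)} (hs : s ∈ T.faces) :
    simplex s ⊆ closure Ω := T.space_eq ▸ T.convexHull_subset_space hs

theorem closure_subset_iUnion : closure Ω ⊆ ⋃ s ∈ T.cells, simplex s := by
  intro x hx
  rw [← T.space_eq, Geometry.SimplicialComplex.mem_space_iff] at hx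
  obtain ⟨s, hs, hxs⟩ := hx
  obtain ⟨t, ht, hst, hc⟩ := T.pure s hs
  exact mem_biUnion (show t ∈ T.cells from ⟨ht, hc⟩) (convexHull_mono (by exact_mod_cast hst) hxs)

open Classical in
theorem simplex_inter_simplex {s t : Finset (E d)} (hs : s ∈ T.faces) (ht : t ∈ T.faces) :
    simplex s ∩ simplex t = simplex (s ∩ t) := by
  rw [simplex, simplex, simplex, T.convexHull_inter_convexHull hs ht, Finset.coe_inter]

/-- Distinct cells share at most d vertices, so their intersection lies in a proper affine subspace.
-/
theorem measure_inter_eq_zero {s t : Finset (E d)} (hs : s ∈ T.cells) (ht : t ∈ T.cells)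
    (hne : s ≠ t) : volume (simplex s ∩ simplex t) = 0 := by
  classical
  rw [T.simplex_inter_simplex hs.1 ht.1]
  refine measure_simplex_eq_zero ?_
  by_contra h
  have h1 : (s ∩ t).card ≤ s.card := Finset.card_le_card Finset.inter_subset_left
  have h2 := hs.2
  have h3 := ht.2
  have e1 : s ∩ t = s := Finset.eq_of_subset_of_card_le Finset.inter_subset_left (by omega)
  have e2 : s ∩ t = t := Finset.eq_of_subset_of_card_le Finset.inter_subset_right (by omega)
  exact hne (e1.symm.trans e2)

theorem disjoint_interior {s t : Finset (E d)} (hs : s ∈ T.cells) (ht : t ∈ T.cells)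
    (hne : s ≠ t) : Disjoint (interior (simplex s)) (interior (simplex t)) := by
  rw [disjoint_iff_inter_eq_empty]
  refine ((isOpen_interior.inter isOpen_interior).measure_eq_zero_iff volume).1 ?_
  exact measure_mono_null (inter_subset_inter interior_subset interior_subset)
    (T.measure_inter_eq_zero hs ht hne)

end Triangulation

/-! ### A Lipschitz domain is the interior of its closure -/

section LipschitzBoundary

variable {d : ℕ} {Ω : Set (E d)}

theorem orthogonalProjectionOnto_add_smul (e y : E d) (t : ℝ) :
    (ℝ ∙ e)ᗮ.orthogonalProjectionOnto (y + t • e) = (ℝ ∙ e)ᗮ.orthogonalProjectionOnto y := by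
  have h : (ℝ ∙ e)ᗮ.orthogonalProjectionOnto e = 0 :=
    Submodule.orthogonalProjectionOnto_eq_zero_iff.2
      (Submodule.le_orthogonal_orthogonal _ (Submodule.mem_span_singleton_self e))
  rw [map_add, map_smul, h, smul_zero, add_zero]

theorem inner_add_smul_of_norm_eq_one {e : E d} (he : ‖e‖ = 1) (y : E d) (t : ℝ) :
    inner ℝ e (y + t • e) = inner ℝ e y + t := by
  rw [inner_add_right, inner_smul_right, real_inner_self_eq_norm_sq, he]
  simp

/-- A boundary point is not above the graph, so moving it down along the axis gives points strictly
below, which have a neighbourhood free of Ω. This excludes slits: the triangulation is only one of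
the closure, and this places the open cells inside Ω itself. -/
theorem HasLipschitzBoundary.interior_closure_subset (hL : HasLipschitzBoundary Ω)
    (hΩ : IsOpen Ω) : interior (closure Ω) ⊆ Ω := by
  intro x hx
  by_contra hxΩ
  have hfr : x ∈ frontier Ω := by
    rw [hΩ.frontier_eq]
    exact ⟨interior_subset hx, hxΩ⟩
  obtain ⟨e, he, ε, hε, g, ⟨L, hg⟩, hb⟩ := hL x hfr
  have hx1 : inner ℝ e x ≤ g ((ℝ ∙ e)ᗮ.orthogonalProjectionOnto x) := by
    by_contra h
    exact hxΩ ((hb x (Metric.mem_ball_self hε)).2 (by linarith))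
  have hcont : Continuous fun t : ℝ => x + t • e := by fun_prop
  have hev : ∀ᶠ t in 𝓝 (0 : ℝ), x + t • e ∈ interior (closure Ω) ∩ Metric.ball x ε := by
    refine hcont.continuousAt.eventually_mem ?_
    simp only [zero_smul, add_zero]
    exact inter_mem (isOpen_interior.mem_nhds hx) (Metric.ball_mem_nhds x hε)
  obtain ⟨t, ht0, ht1, ht2⟩ : ∃ t : ℝ, t < 0 ∧ x + t • e ∈ interior (closure Ω) ∧
      x + t • e ∈ Metric.ball x ε := by
    have h1 : ∀ᶠ t in 𝓝[<] (0 : ℝ), t < 0 := self_mem_nhdsWithin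
    obtain ⟨t, h1, h2⟩ := (h1.and (hev.filter_mono nhdsWithin_le_nhds)).exists
    exact ⟨t, h1, h2.1, h2.2⟩
  set y := x + t • e with hy
  have hopen : IsOpen {z : E d | inner ℝ e z < g ((ℝ ∙ e)ᗮ.orthogonalProjectionOnto z)} :=
    isOpen_lt (by fun_prop) (hg.continuous.comp (by fun_prop))
  have hyO : y ∈ {z : E d | inner ℝ e z < g ((ℝ ∙ e)ᗮ.orthogonalProjectionOnto z)} := by
    rw [mem_ofPred_eq, hy, orthogonalProjectionOnto_add_smul, inner_add_smul_of_norm_eq_one he]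
    linarith
  obtain ⟨z, hz1, hz2⟩ := mem_closure_iff.1 (interior_subset ht1) _
    (hopen.inter Metric.isOpen_ball) ⟨hyO, ht2⟩
  have := (hb z hz1.2).1 hz2
  exact lt_asymm this hz1.1

end LipschitzBoundary

/-! ### Null boundaries, mesh size and regularity -/

namespace Triangulation

variable {d : ℕ} {Ω : Set (E d)} (T : Triangulation Ω)

theorem interior_simplex_subset (hΩ : IsOpen Ω) (hL : HasLipschitzBoundary Ω)
    {s : Finset (E d)} (hs : s ∈ T.cells) : interior (simplex s) ⊆ Ω :=
  (interior_mono (T.simplex_subset_closure hs.1)).trans (hL.interior_closure_subset hΩ)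

theorem interiors_subset (hΩ : IsOpen Ω) (hL : HasLipschitzBoundary Ω) : T.interiors ⊆ Ω :=
  iUnion₂_subset fun _ hs => T.interior_simplex_subset hΩ hL hs

theorem isOpen_interiors : IsOpen T.interiors :=
  isOpen_biUnion fun _ _ => isOpen_interior

theorem measure_closure_diff_interiors : volume (closure Ω \ T.interiors) = 0 := by
  have h : closure Ω \ T.interiors ⊆ ⋃ s ∈ T.cells, frontier (simplex s) := by
    rintro x ⟨hx, hx'⟩
    obtain ⟨s, hs, hxs⟩ := mem_iUnion₂.1 (T.closure_subset_iUnion hx)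
    refine mem_biUnion hs ?_
    rw [(isCompact_simplex s).isClosed.frontier_eq]
    exact ⟨hxs, fun hi => hx' (mem_biUnion hs hi)⟩
  refine measure_mono_null h ((measure_biUnion_null_iff T.finite_cells.countable).2 fun s _ => ?_)
  exact (convex_simplex s).addHaar_frontier _

theorem interiors_ae_eq (hΩ : IsOpen Ω) (hL : HasLipschitzBoundary Ω) :
    T.interiors =ᵐ[volume] Ω := by
  refine (ae_eq_set).2 ⟨?_, ?_⟩
  · rw [sdiff_eq_empty.2 (T.interiors_subset hΩ hL)]
    simp
  · exact measure_mono_null (sdiff_subset_sdiff_left subset_closure)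
      T.measure_closure_diff_interiors

theorem closure_ae_eq (T : Triangulation Ω) (hΩ : IsOpen Ω) (hL : HasLipschitzBoundary Ω) :
    closure Ω =ᵐ[volume] Ω := by
  refine (ae_eq_set).2 ⟨?_, ?_⟩
  · exact measure_mono_null (sdiff_subset_sdiff_right (T.interiors_subset hΩ hL))
      T.measure_closure_diff_interiors
  · rw [sdiff_eq_empty.2 subset_closure]
    simp

theorem interior_ae_eq_simplex (s : Finset (E d)) :
    interior (simplex s) =ᵐ[volume] simplex s := by
  refine (ae_eq_set).2 ⟨by rw [sdiff_eq_empty.2 interior_subset]; simp, ?_⟩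
  rw [← (isCompact_simplex s).isClosed.frontier_eq]
  exact (convex_simplex s).addHaar_frontier _

theorem cells_nonempty (hne : Ω.Nonempty) : T.cells.Nonempty := by
  obtain ⟨x, hx⟩ := hne
  obtain ⟨s, hs, _⟩ := mem_iUnion₂.1 (T.closure_subset_iUnion (subset_closure hx))
  exact ⟨s, hs⟩

theorem cellDiam_le_meshSize {s : Finset (E d)} (hs : s ∈ T.cells) : cellDiam s ≤ T.meshSize := by
  have : Finite T.cells := T.finite_cells
  exact le_ciSup (f := fun s : T.cells => cellDiam (s : Finset (E d))) (finite_range _).bddAbove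
    ⟨s, hs⟩

theorem two_mul_le_cellDiam (hd : 1 ≤ d) {s : Finset (E d)} {x : E d} {ρ : ℝ} (hρ : 0 ≤ ρ)
    (hsub : Metric.closedBall x ρ ⊆ simplex s) : 2 * ρ ≤ cellDiam s := by
  let e : E d := EuclideanSpace.single ⟨0, hd⟩ 1
  have he : ‖e‖ = 1 := by simp [e]
  have h1 : x + ρ • e ∈ simplex s := hsub (by simp [norm_smul, he, abs_of_nonneg hρ])
  have h2 : x - ρ • e ∈ simplex s := hsub (by simp [norm_smul, he, abs_of_nonneg hρ])
  have h3 := Metric.dist_le_diam_of_mem (isCompact_simplex s).isBounded h1 h2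
  refine le_trans (le_of_eq ?_) h3
  rw [dist_eq_norm, add_sub_sub_cancel, ← two_smul ℝ, norm_smul, norm_smul, he]
  simp [abs_of_nonneg hρ]

theorem bddAbove_cellRho (hd : 1 ≤ d) (s : Finset (E d)) : BddAbove {t | ∃ x : E d, ∃ ρ : ℝ,
    0 ≤ ρ ∧ Metric.closedBall x ρ ⊆ simplex s ∧ t = 2 * ρ} := by
  refine ⟨cellDiam s, ?_⟩
  rintro _ ⟨x, ρ, hρ, hsub, rfl⟩
  exact two_mul_le_cellDiam hd hρ hsub

theorem cellRho_pos (hd : 1 ≤ d) {s : Finset (E d)} (hs : s ∈ T.cells) : 0 < cellRho s := by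
  obtain ⟨x, hx⟩ := T.interior_simplex_nonempty hs
  obtain ⟨ε, hε, hb⟩ := Metric.isOpen_iff.1 isOpen_interior x hx
  have h : 2 * (ε / 2) ≤ cellRho s := le_csSup (bddAbove_cellRho hd s) ⟨x, ε / 2, by linarith,
    (Metric.closedBall_subset_ball (by linarith)).trans (hb.trans interior_subset), rfl⟩
  linarith

theorem cellRho_le_cellDiam (hd : 1 ≤ d) {s : Finset (E d)} (hs : s ∈ T.cells) :
    cellRho s ≤ cellDiam s := by
  obtain ⟨x, hx⟩ := T.interior_simplex_nonempty hs
  refine csSup_le ⟨0, x, 0, le_rfl, by simpa using interior_subset hx, by simp⟩ ?_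
  rintro _ ⟨x, ρ, hρ, hsub, rfl⟩
  exact two_mul_le_cellDiam hd hρ hsub

theorem meshSize_pos (hd : 1 ≤ d) (hne : Ω.Nonempty) : 0 < T.meshSize := by
  obtain ⟨s, hs⟩ := T.cells_nonempty hne
  exact (T.cellRho_pos hd hs).trans_le ((T.cellRho_le_cellDiam hd hs).trans
    (T.cellDiam_le_meshSize hs))

/-- The regularity of a triangulation: every simplex contains a ball of radius `a * h` -/
def IsRegular (a : ℝ) : Prop :=
  ∀ s ∈ T.cells, ∃ x, Metric.closedBall x (a * T.meshSize) ⊆ simplex s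

/-- Since `cellRho` is a supremum of diameters, some ball in the cell has diameter above half of it,
hence radius above a quarter; this is the factor 4. The absolute values and the summand 1 keep the
constant positive for every choice of γ₀ and κ. -/
theorem isRegular_of_nonDegenerate (hd : 1 ≤ d) (hne : Ω.Nonempty) {γ₀ κ : ℝ}
    (h1 : T.NonDegenerate γ₀) (h2 : T.QuasiUniform κ) :
    T.IsRegular (1 / (4 * (|κ| * |γ₀| + 1))) := by
  intro s hs
  have hρ := T.cellRho_pos hd hs
  have hh := T.meshSize_pos hd hne
  have hne' : {t | ∃ x : E d, ∃ ρ : ℝ, 0 ≤ ρ ∧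
      Metric.closedBall x ρ ⊆ simplex s ∧ t = 2 * ρ}.Nonempty := by
    obtain ⟨x, hx⟩ := T.interior_simplex_nonempty hs
    exact ⟨0, x, 0, le_rfl, by simpa using interior_subset hx, by simp⟩
  have hlt : cellRho s / 2 < sSup {t | ∃ x : E d, ∃ ρ : ℝ, 0 ≤ ρ ∧
      Metric.closedBall x ρ ⊆ simplex s ∧ t = 2 * ρ} := by
    change cellRho s / 2 < cellRho s
    linarith
  obtain ⟨_, ⟨x, ρ, hρ0, hsub, rfl⟩, hlt'⟩ := exists_lt_of_lt_csSup hne' hlt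
  refine ⟨x, (Metric.closedBall_subset_closedBall ?_).trans hsub⟩
  have a1 : cellDiam s ≤ γ₀ * cellRho s := (div_le_iff₀ hρ).1 (h1 s hs)
  have a2 := h2 s hs
  have hd0 : 0 ≤ cellDiam s := Metric.diam_nonneg
  have a3 : T.meshSize ≤ |κ| * |γ₀| * cellRho s := by
    calc T.meshSize ≤ κ * cellDiam s := a2
      _ ≤ |κ| * cellDiam s := by gcongr; exact le_abs_self κ
      _ ≤ |κ| * (|γ₀| * cellRho s) := by
          gcongr
          exact a1.trans (by gcongr; exact le_abs_self γ₀)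
      _ = _ := by ring
  have hpos : 0 < |κ| * |γ₀| + 1 := by positivity
  rw [one_div, inv_mul_le_iff₀ (by positivity)]
  nlinarith [mul_pos hpos hρ, mul_nonneg (mul_nonneg (abs_nonneg κ) (abs_nonneg γ₀)) hρ0]

end Triangulation

/-! ### Counting cells by volume, and balls around common facets -/

namespace Triangulation

variable {d : ℕ} {Ω : Set (E d)} (T : Triangulation Ω)

/-- A packing argument: the interiors are disjoint and each contains a ball of radius a h. All
bounds on numbers of cells come from here. -/
theorem card_mul_measure_ball_le {a : ℝ} (ha : T.IsRegular a) (S : Finset (Finset (E d)))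
    (hS : ∀ s ∈ S, s ∈ T.cells) {A : Set (E d)} (hA : ∀ s ∈ S, interior (simplex s) ⊆ A) :
    S.card * volume (Metric.ball (0 : E d) (a * T.meshSize)) ≤ volume A := by
  calc (S.card : ℝ≥0∞) * volume (Metric.ball (0 : E d) (a * T.meshSize))
      = ∑ _s ∈ S, volume (Metric.ball (0 : E d) (a * T.meshSize)) := by
        rw [Finset.sum_const, nsmul_eq_mul]
    _ ≤ ∑ s ∈ S, volume (interior (simplex s)) := by
        refine Finset.sum_le_sum fun s hs => ?_
        obtain ⟨x, hx⟩ := ha s (hS s hs)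
        rw [← Measure.addHaar_ball_center volume x]
        exact measure_mono (interior_maximal (Metric.ball_subset_closedBall.trans hx)
          Metric.isOpen_ball)
    _ = volume (⋃ s ∈ S, interior (simplex s)) := by
        rw [measure_biUnion_finset]
        · exact fun s hs t ht hne => T.disjoint_interior (hS s hs) (hS t ht) hne
        · exact fun s _ => isOpen_interior.measurableSet
    _ ≤ volume A := measure_mono (iUnion₂_subset hA)

theorem card_le_of_subset_closedBall {a : ℝ} (ha0 : 0 < a) (ha : T.IsRegular a)
    (hh : 0 < T.meshSize) (S : Finset (Finset (E d))) (hS : ∀ s ∈ S, s ∈ T.cells) {x : E d}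
    {R : ℝ} (hR : 0 ≤ R)
    (hA : ∀ s ∈ S, simplex s ⊆ Metric.closedBall x (R * T.meshSize)) :
    (S.card : ℝ) ≤ (R / a) ^ d := by
  have h := T.card_mul_measure_ball_le ha S hS (fun s hs => interior_subset.trans (hA s hs))
  rw [Measure.addHaar_ball_of_pos volume _ (by positivity), Measure.addHaar_closedBall volume _
    (by positivity), ← mul_assoc] at h
  have hv0 : volume (Metric.ball (0 : E d) 1) ≠ 0 :=
    (Metric.measure_ball_pos volume _ one_pos).ne'
  have hv1 : volume (Metric.ball (0 : E d) 1) ≠ ⊤ := measure_ball_lt_top.ne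
  rw [ENNReal.mul_le_mul_iff_left hv0 hv1, ← ENNReal.ofReal_natCast,
    ← ENNReal.ofReal_mul (by positivity), ENNReal.ofReal_le_ofReal_iff (by positivity)] at h
  simp only [finrank_euclideanSpace, Fintype.card_fin, mul_pow] at h
  rw [div_pow, le_div_iff₀ (by positivity)]
  have hp : 0 < T.meshSize ^ d := by positivity
  rw [← mul_assoc] at h
  exact le_of_mul_le_mul_right h hp

/-- The affine basis given by the vertices of a cell. -/
noncomputable def cellBasis {s : Finset (E d)} (hs : s ∈ T.cells) : AffineBasis s ℝ (E d) :=
  ⟨(↑), T.indep_cell hs, by simpa using T.affineSpan_cell hs⟩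

theorem cellBasis_apply {s : Finset (E d)} (hs : s ∈ T.cells) (i : s) :
    T.cellBasis hs i = (i : E d) := rfl

theorem range_cellBasis {s : Finset (E d)} (hs : s ∈ T.cells) :
    range (T.cellBasis hs) = (s : Set (E d)) := by
  change range ((↑) : s → E d) = _
  simp

theorem simplex_eq_nonneg_coord {s : Finset (E d)} (hs : s ∈ T.cells) :
    simplex s = {x | ∀ i, 0 ≤ (T.cellBasis hs).coord i x} := by
  rw [← (T.cellBasis hs).convexHull_eq_nonneg_coord, range_cellBasis, simplex]

theorem interior_simplex_eq_pos_coord {s : Finset (E d)} (hs : s ∈ T.cells) :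
    interior (simplex s) = {x | ∀ i, 0 < (T.cellBasis hs).coord i x} := by
  rw [← (T.cellBasis hs).interior_convexHull, range_cellBasis, simplex]

theorem coord_le_one {s : Finset (E d)} (hs : s ∈ T.cells) (i : s) {x : E d}
    (hx : x ∈ simplex s) : (T.cellBasis hs).coord i x ≤ 1 := by
  rw [T.simplex_eq_nonneg_coord hs] at hx
  rw [← (T.cellBasis hs).sum_coord_apply_eq_one x]
  exact Finset.single_le_sum (f := fun i => (T.cellBasis hs).coord i x) (fun j _ => hx j)
    (Finset.mem_univ i)

/-- A barycentric coordinate is affine and stays in [0, 1] on a ball of diameter 2ρ, which bounds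
its slope by 1/(2ρ). -/
theorem coord_sub_le {s : Finset (E d)} (hs : s ∈ T.cells) (i : s) {x : E d} {ρ : ℝ}
    (hρ : 0 < ρ) (hx : Metric.closedBall x ρ ⊆ simplex s) (y z : E d) :
    (T.cellBasis hs).coord i z - (T.cellBasis hs).coord i y ≤ dist y z / (2 * ρ) := by
  set f := (T.cellBasis hs).coord i with hf
  have hlin : ∀ u v : E d, f u - f v = f.linear (u - v) := fun u v => by
    rw [← vsub_eq_sub, ← f.linearMap_vsub, vsub_eq_sub]
  rcases eq_or_ne y z with rfl | hyz
  · simp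
  · have hd : 0 < ‖z - y‖ := norm_pos_iff.2 (sub_ne_zero.2 hyz.symm)
    set w := (ρ / ‖z - y‖) • (z - y) with hw
    have hwn : ‖w‖ = ρ := by
      rw [hw, norm_smul, Real.norm_of_nonneg (by positivity), div_mul_cancel₀ _ hd.ne']
    have h1 : x + w ∈ simplex s := hx (by simp [hwn])
    have h2 : x - w ∈ simplex s := hx (by simp [hwn])
    have h3 : f (x + w) ≤ 1 := T.coord_le_one hs i h1
    have h4 : 0 ≤ f (x - w) := by
      rw [T.simplex_eq_nonneg_coord hs] at h2
      exact h2 i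
    have h5 : f (x + w) - f (x - w) = 2 * (ρ / ‖z - y‖) * f.linear (z - y) := by
      rw [hlin, add_sub_sub_cancel, ← two_smul ℝ, map_smul, hw, map_smul, smul_eq_mul, smul_eq_mul]
      ring
    rw [hlin, dist_comm, dist_eq_norm, le_div_iff₀ (by positivity)]
    have h6 : 2 * (ρ / ‖z - y‖) * f.linear (z - y) ≤ 1 := by linarith
    have h7 : f.linear (z - y) * (2 * ρ) = (2 * (ρ / ‖z - y‖) * f.linear (z - y)) * ‖z - y‖ := by
      field_simp
    rw [h7]
    nlinarith

theorem affineMap_sum_smul {ι : Type*} (S : Finset ι) (f : E d →ᵃ[ℝ] ℝ) (c : ι → ℝ) (p : ι → E d)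
    (hc : ∑ i ∈ S, c i = 1) : f (∑ i ∈ S, c i • p i) = ∑ i ∈ S, c i * f (p i) := by
  have hdec : ∀ y, f y = f.linear y + f 0 := fun y => congrFun f.decomp y
  rw [hdec, map_sum]
  simp only [map_smul, smul_eq_mul]
  have : ∑ i ∈ S, c i * f (p i) = ∑ i ∈ S, (c i * f.linear (p i) + c i * f 0) := by
    refine Finset.sum_congr rfl fun i _ => ?_
    rw [hdec (p i), mul_add]
  rw [this, Finset.sum_add_distrib, ← Finset.sum_mul, hc, one_mul]

open Classical in
/-- The barycentre of a common facet is the centre of a ball contained in the two cells. -/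
theorem exists_ball_subset_union (hd : 1 ≤ d) {a : ℝ} (ha0 : 0 < a) (ha : T.IsRegular a)
    (hh : 0 < T.meshSize) {s t : Finset (E d)} (hs : s ∈ T.cells) (ht : t ∈ T.cells)
    (hst : (s ∩ t).card = d) : ∃ z ∈ simplex s ∩ simplex t,
      Metric.ball z (a / d * T.meshSize) ⊆ simplex s ∪ simplex t := by
  have hdR : (0 : ℝ) < d := by exact_mod_cast hd
  have hne : s ≠ t := by
    rintro rfl
    rw [Finset.inter_self, hs.2] at hst
    omega
  set h := T.meshSize
  set z : E d := ∑ p ∈ s ∩ t, (1 / d : ℝ) • p with hz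
  have hsum1 : ∑ _p ∈ s ∩ t, (1 / d : ℝ) = 1 := by
    rw [Finset.sum_const, hst, nsmul_eq_mul]
    field_simp
  have hzf : ∀ f : E d →ᵃ[ℝ] ℝ, f z = ∑ p ∈ s ∩ t, (1 / d : ℝ) * f p := fun f =>
    affineMap_sum_smul _ f _ _ hsum1
  have hcoord : ∀ {u : Finset (E d)} (hu : u ∈ T.cells) (_ : s ∩ t ⊆ u) (i : u),
      (i : E d) ∈ s ∩ t → (T.cellBasis hu).coord i z = 1 / d := by
    intro u hu hsub i hi
    rw [hzf, Finset.sum_eq_single (i : E d)]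
    · have := (T.cellBasis hu).coord_apply_eq i
      rw [cellBasis_apply] at this
      rw [this, mul_one]
    · intro p hp hpi
      have := (T.cellBasis hu).coord_apply_ne (i := i) (j := ⟨p, hsub hp⟩)
        (fun h => hpi (congrArg Subtype.val h).symm)
      rw [cellBasis_apply] at this
      rw [this, mul_zero]
    · exact fun h => absurd hi h
  have hcoord0 : ∀ {u : Finset (E d)} (hu : u ∈ T.cells) (_ : s ∩ t ⊆ u) (i : u),
      (i : E d) ∉ s ∩ t → ∀ p ∈ s ∩ t, (T.cellBasis hu).coord i p = 0 := by
    intro u hu hsub i hi p hp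
    have := (T.cellBasis hu).coord_apply_ne (i := i) (j := ⟨p, hsub hp⟩)
        (fun h => hi (by rw [h]; exact hp))
    rwa [cellBasis_apply] at this
  have hS : s ∩ t ⊆ s := Finset.inter_subset_left
  have hT : s ∩ t ⊆ t := Finset.inter_subset_right
  have hzmem : z ∈ simplex s ∩ simplex t := by
    rw [T.simplex_inter_simplex hs.1 ht.1]
    exact (convex_simplex _).sum_mem (fun _ _ => by positivity) hsum1
      (fun p hp => subset_convexHull ℝ _ hp)
  obtain ⟨ws, hws⟩ : ∃ w, s \ (s ∩ t) = {w} := by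
    rw [← Finset.card_eq_one, Finset.card_sdiff_of_subset hS, hst, hs.2]
    omega
  obtain ⟨wt, hwt⟩ : ∃ w, t \ (s ∩ t) = {w} := by
    rw [← Finset.card_eq_one, Finset.card_sdiff_of_subset hT, hst, ht.2]
    omega
  have hws' : ws ∈ s ∧ ws ∉ s ∩ t := Finset.mem_sdiff.1 (hws ▸ Finset.mem_singleton_self ws)
  have hwt' : wt ∈ t ∧ wt ∉ s ∩ t := Finset.mem_sdiff.1 (hwt ▸ Finset.mem_singleton_self wt)
  have hs_or : ∀ p ∈ s, p ∈ s ∩ t ∨ p = ws := fun p hp => by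
    by_cases hpt : p ∈ s ∩ t
    · exact Or.inl hpt
    · exact Or.inr (Finset.mem_singleton.1 (hws ▸ Finset.mem_sdiff.2 ⟨hp, hpt⟩))
  have ht_or : ∀ p ∈ t, p ∈ s ∩ t ∨ p = wt := fun p hp => by
    by_cases hpt : p ∈ s ∩ t
    · exact Or.inl hpt
    · exact Or.inr (Finset.mem_singleton.1 (hwt ▸ Finset.mem_sdiff.2 ⟨hp, hpt⟩))
  set bs := T.cellBasis hs with hbs
  set bt := T.cellBasis ht with hbt
  let is : s := ⟨ws, hws'.1⟩
  let it : t := ⟨wt, hwt'.1⟩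
  set f := bt.coord it with hf
  -- The coordinate f of t vanishes on the common facet, so it is a multiple of the coordinate of s
  -- with the same zero set.
  have hfy : ∀ y, f y = bs.coord is y * f ws := by
    intro y
    have h1 := bs.linear_combination_coord_eq_self y
    have h2 := affineMap_sum_smul Finset.univ f (fun i => bs.coord i y) (fun i => bs i)
      (bs.sum_coord_apply_eq_one y)
    rw [h1] at h2
    rw [h2, Finset.sum_eq_single is]
    · rfl
    · intro i _ hi
      have hi' : (i : E d) ∈ s ∩ t := (hs_or i i.2).resolve_right
        (fun h => hi (Subtype.ext h))
      have : f (bs i) = 0 := hcoord0 ht hT it hwt'.2 i hi'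
      rw [this, mul_zero]
    · simp
  -- The opposite vertices lie on different sides of the facet: otherwise a small move from the
  -- barycentre towards ws would enter the interiors of both cells.
  have hfw : f ws ≤ 0 := by
    by_contra hpos
    push Not at hpos
    let y : ℝ → E d := fun ε => AffineMap.lineMap z ws ε
    have hy : ∀ (g : E d →ᵃ[ℝ] ℝ) (ε : ℝ), g (y ε) = (1 - ε) * g z + ε * g ws := by
      intro g ε
      rw [AffineMap.apply_lineMap, AffineMap.lineMap_apply_ring']
      ring
    have hev1 : ∀ᶠ ε in 𝓝[>] (0 : ℝ), y ε ∈ interior (simplex s) := by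
      rw [T.interior_simplex_eq_pos_coord hs]
      filter_upwards [self_mem_nhdsWithin,
        nhdsWithin_le_nhds (eventually_lt_nhds (zero_lt_one (α := ℝ)))] with ε hε hε1 i
      have hε0 : 0 < ε := hε
      rw [hy]
      rcases hs_or i i.2 with hi | hi
      · rw [hcoord hs hS i hi]
        have h0 : 0 ≤ bs.coord i ws := by
          have : ws ∈ simplex s := subset_convexHull ℝ _ hws'.1
          rw [T.simplex_eq_nonneg_coord hs] at this
          exact this i
        have : 0 < (1 - ε) * (1 / (d : ℝ)) := mul_pos (by linarith) (by positivity)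
        have := mul_nonneg hε0.le h0
        linarith
      · have hi2 : i = is := Subtype.ext hi
        have h0 : bs.coord i z = 0 := by
          rw [hzf]
          refine Finset.sum_eq_zero fun p hp => ?_
          rw [hcoord0 hs hS i (by rw [hi2]; exact hws'.2) p hp, mul_zero]
        have h1 : bs.coord i ws = 1 := by
          rw [hi2]
          exact bs.coord_apply_eq is
        change 0 < (1 - ε) * bs.coord i z + ε * bs.coord i ws
        rw [h0, h1]
        linarith
    have hev2 : ∀ᶠ ε in 𝓝[>] (0 : ℝ), y ε ∈ interior (simplex t) := by
      rw [T.interior_simplex_eq_pos_coord ht]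
      change ∀ᶠ ε in 𝓝[>] (0 : ℝ), ∀ i, 0 < bt.coord i (y ε)
      rw [eventually_all]
      intro i
      rcases ht_or i i.2 with hi | hi
      · have hlim : Tendsto (fun ε : ℝ => (1 - ε) * bt.coord i z + ε * bt.coord i ws) (𝓝[>] 0)
            (𝓝 (1 / d)) := by
          have : Continuous fun ε : ℝ => (1 - ε) * bt.coord i z + ε * bt.coord i ws := by fun_prop
          have h2 := (this.tendsto 0).mono_left (nhdsWithin_le_nhds (s := Ioi (0 : ℝ)))
          rw [← hcoord ht hT i hi]
          simpa using h2
        filter_upwards [hlim.eventually_const_lt (show 0 < 1 / (d : ℝ) by positivity)] with ε hε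
        rwa [hy]
      · have hi2 : i = it := Subtype.ext hi
        filter_upwards [self_mem_nhdsWithin] with ε hε
        have hε0 : 0 < ε := hε
        have h0 : f z = 0 := by
          rw [hzf]
          refine Finset.sum_eq_zero fun p hp => ?_
          rw [hcoord0 ht hT it hwt'.2 p hp, mul_zero]
        rw [hy, hi2, ← hf, h0]
        have := mul_pos hε0 hpos
        linarith
    obtain ⟨ε, h1, h2⟩ := (hev1.and hev2).exists
    exact disjoint_left.1 (T.disjoint_interior hs ht hne) h1 h2
  refine ⟨z, hzmem, fun y hy => ?_⟩
  -- At the barycentre the coordinates of the common vertices equal 1/d, and by the slope bound they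
  -- vary by less than 1/d on the ball. Only the coordinate of the opposite vertex can change sign,
  -- and its sign decides in which cell y lies.
  have hbound : ∀ {u : Finset (E d)} (hu : u ∈ T.cells) (_ : s ∩ t ⊆ u) (i : u),
      (i : E d) ∈ s ∩ t → 0 ≤ (T.cellBasis hu).coord i y := by
    intro u hu hsub i hi
    obtain ⟨x, hx⟩ := ha u hu
    have h1 := T.coord_sub_le hu i (by positivity) hx y z
    rw [hcoord hu hsub i hi] at h1
    have h2 : dist y z / (2 * (a * h)) ≤ 1 / d := by
      rw [div_le_iff₀ (by positivity)]
      have := Metric.mem_ball.1 hy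
      have h3 : 1 / (d : ℝ) * (2 * (a * h)) = 2 * (a / d * h) := by ring
      rw [h3]
      have : 0 < a / d * h := by positivity
      linarith
    linarith
  rcases le_or_gt 0 (bs.coord is y) with hpos | hneg
  · left
    rw [T.simplex_eq_nonneg_coord hs]
    intro i
    rcases hs_or i i.2 with hi | hi
    · exact hbound hs hS i hi
    · rw [show i = is from Subtype.ext hi]
      exact hpos
  · right
    rw [T.simplex_eq_nonneg_coord ht]
    intro i
    rcases ht_or i i.2 with hi | hi
    · exact hbound ht hT i hi
    · rw [show i = it from Subtype.ext hi]
      change 0 ≤ f y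
      rw [hfy]
      exact mul_nonneg_of_nonpos_of_nonpos hneg.le hfw

end Triangulation

/-! ### Local connectedness of a Lipschitz domain at its closure -/

section LocalConnectedness

variable {d : ℕ} {Ω : Set (E d)}

/-- A set with Lipschitz boundary is locally connected at its boundary points. -/
theorem HasLipschitzBoundary.exists_isPreconnected (hL : HasLipschitzBoundary Ω) (hΩ : IsOpen Ω)
    {x : E d} (hx : x ∈ closure Ω) {ε : ℝ} (hε : 0 < ε) :
    ∃ η > 0, ∀ y ∈ Ω ∩ Metric.ball x η, ∀ y' ∈ Ω ∩ Metric.ball x η,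
      ∃ C, IsPreconnected C ∧ C ⊆ Ω ∩ Metric.ball x ε ∧ y ∈ C ∧ y' ∈ C := by
  by_cases hxΩ : x ∈ Ω
  · obtain ⟨δ, hδ, hb⟩ := Metric.isOpen_iff.1 hΩ x hxΩ
    refine ⟨min δ ε, lt_min hδ hε, fun y hy y' hy' => ⟨Metric.ball x (min δ ε),
      (convex_ball x _).isPreconnected, subset_inter ?_ ?_, hy.2, hy'.2⟩⟩
    · exact (Metric.ball_subset_ball (min_le_left _ _)).trans hb
    · exact Metric.ball_subset_ball (min_le_right _ _)
  obtain ⟨e, he, ε₀, hε₀, g, ⟨L, hg⟩, hmem⟩ := hL x (by rw [hΩ.frontier_eq]; exact ⟨hx, hxΩ⟩)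
  set π := (ℝ ∙ e)ᗮ.orthogonalProjectionOnto with hπ
  -- The radius leaves room for a lift by t = 2Lη along the axis within the given balls. This lift
  -- carries every segment between points of Ω near x above the graph, which oscillates by at most
  -- Lη about its value at x.
  set η := min ε ε₀ / (1 + 2 * L) with hη
  have hLpos : (0 : ℝ) < 1 + 2 * L := by positivity
  have hη0 : 0 < η := div_pos (lt_min hε hε₀) hLpos
  set t : ℝ := 2 * L * η with ht
  have ht0 : 0 ≤ t := by positivity
  have hηt : η + t = min ε ε₀ := by
    rw [ht, hη]
    field_simp
  -- The strict bound needs a positive Lipschitz constant; for L = 0 the function g is constant.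
  have hgx : ∀ y ∈ Metric.ball x η, |g (π y) - g (π x)| < L * η ∨ L * η = 0 ∧
      |g (π y) - g (π x)| = 0 := by
    intro y hy
    have h1 : |g (π y) - g (π x)| ≤ L * dist y x := by
      rw [← Real.dist_eq]
      refine (hg.dist_le_mul _ _).trans ?_
      gcongr
      rw [dist_eq_norm, dist_eq_norm, ← map_sub]
      exact (ℝ ∙ e)ᗮ.norm_orthogonalProjectionOnto_apply_le _
    rcases eq_or_lt_of_le L.coe_nonneg with h0 | h0
    · right
      rw [← h0, zero_mul] at h1 ⊢
      exact ⟨rfl, le_antisymm h1 (abs_nonneg _)⟩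
    · left
      exact h1.trans_lt (mul_lt_mul_of_pos_left (Metric.mem_ball.1 hy) h0)
  have hball : ∀ y ∈ Metric.ball x η, ∀ τ, 0 ≤ τ → τ ≤ t →
      y + τ • e ∈ Metric.ball x (min ε ε₀) := by
    intro y hy τ h0 h1
    rw [Metric.mem_ball, dist_eq_norm, add_sub_right_comm, ← hηt]
    refine (norm_add_le _ _).trans_lt ?_
    rw [norm_smul, he, mul_one, Real.norm_of_nonneg h0, ← dist_eq_norm]
    exact add_lt_add_of_lt_of_le hy h1
  have hup : ∀ y ∈ Metric.ball x η, ∀ τ, 0 ≤ τ → τ ≤ t → g (π y) < inner ℝ e y + τ →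
      y + τ • e ∈ Ω ∩ Metric.ball x ε := by
    intro y hy τ h0 h1 h2
    have hb := hball y hy τ h0 h1
    refine ⟨(hmem _ (Metric.ball_subset_ball (min_le_right _ _) hb)).2 ?_,
      Metric.ball_subset_ball (min_le_left _ _) hb⟩
    rwa [orthogonalProjectionOnto_add_smul, inner_add_smul_of_norm_eq_one he]
  have hlow : ∀ y ∈ Ω ∩ Metric.ball x η, g (π y) < inner ℝ e y := by
    intro y hy
    refine (hmem y (Metric.ball_subset_ball (min_le_right ε ε₀) ?_)).1 hy.1
    have := hball y hy.2 0 le_rfl ht0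
    rwa [zero_smul, add_zero] at this
  have hvert : ∀ y ∈ Ω ∩ Metric.ball x η, segment ℝ y (y + t • e) ⊆ Ω ∩ Metric.ball x ε := by
    intro y hy p hp
    obtain ⟨θ, hθ, rfl⟩ := (segment_eq_image' ℝ y (y + t • e)) ▸ hp
    have h1 : y + θ • (y + t • e - y) = y + (θ * t) • e := by
      rw [add_sub_cancel_left, smul_smul]
    change y + θ • (y + t • e - y) ∈ _
    rw [h1]
    have h0 : 0 ≤ θ * t := mul_nonneg hθ.1 ht0
    exact hup y hy.2 _ h0 (mul_le_of_le_one_left ht0 hθ.2) (by linarith [hlow y hy])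
  -- The connecting path goes up from y, across at the lifted height, and down to y'.
  refine ⟨η, hη0, fun y hy y' hy' => ⟨segment ℝ y (y + t • e) ∪
    (segment ℝ (y + t • e) (y' + t • e) ∪ segment ℝ y' (y' + t • e)), ?_, ?_,
    Or.inl (left_mem_segment ℝ _ _), Or.inr (Or.inr (left_mem_segment ℝ _ _))⟩⟩
  · refine IsPreconnected.union (y + t • e) (right_mem_segment ℝ _ _)
      (Or.inl (left_mem_segment ℝ _ _)) (convex_segment _ _).isPreconnected ?_
    exact IsPreconnected.union (y' + t • e) (right_mem_segment ℝ _ _) (right_mem_segment ℝ _ _)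
      (convex_segment _ _).isPreconnected (convex_segment _ _).isPreconnected
  · refine union_subset (hvert y hy) (union_subset ?_ (hvert y' hy'))
    intro p hp
    obtain ⟨θ, hθ, rfl⟩ := (segment_eq_image' ℝ (y + t • e) (y' + t • e)) ▸ hp
    set w := y + θ • (y' - y) with hw
    have h1 : y + t • e + θ • (y' + t • e - (y + t • e)) = w + t • e := by
      rw [add_sub_add_right_eq_sub, hw]
      abel
    change y + t • e + θ • (y' + t • e - (y + t • e)) ∈ _
    rw [h1]
    have hwb : w ∈ Metric.ball x η :=
      (convex_ball x η).add_smul_sub_mem hy.2 hy'.2 hθ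
    refine hup w hwb t ht0 le_rfl ?_
    have hin : inner ℝ e w = (1 - θ) * inner ℝ e y + θ * inner ℝ e y' := by
      rw [hw, inner_add_right, inner_smul_right, inner_sub_right]
      ring
    have hbd : ∀ z ∈ Ω ∩ Metric.ball x η, g (π x) - L * η < inner ℝ e z := by
      intro z hz
      have a1 := hlow z hz
      rcases hgx z hz.2 with a2 | ⟨a2, a3⟩
      · have := (abs_lt.1 a2).1
        linarith
      · have := abs_eq_zero.1 a3
        linarith
    have b1 := hbd y hy
    have b2 := hbd y' hy'
    have b3 : g (π x) - L * η < inner ℝ e w := by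
      rw [hin]
      rcases eq_or_lt_of_le hθ.1 with h0 | h0
      · rw [← h0]
        linarith
      · nlinarith [hθ.2]
    have b4 : g (π w) - g (π x) ≤ L * η := by
      rcases hgx w hwb with a2 | ⟨a2, a3⟩
      · exact (abs_lt.1 a2).2.le
      · rw [abs_eq_zero.1 a3, a2]
    have : t = L * η + L * η := by ring
    linarith

end LocalConnectedness

/-! ### Cells at a vertex are connected through facets -/

namespace Triangulation

variable {d : ℕ} {Ω : Set (E d)} (T : Triangulation Ω)

open Classical in
/-- The cells with vertex `x`; two of them are joined if they have a common facet. -/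
def vertexGraph (x : E d) : SimpleGraph {s : Finset (E d) // s ∈ T.cells ∧ x ∈ s} where
  Adj s t := s ≠ t ∧ ((s : Finset (E d)) ∩ t).card = d
  symm := ⟨fun s t h => ⟨h.1.symm, by rw [Finset.inter_comm]; exact h.2⟩⟩
  loopless := ⟨fun _ h => h.1 rfl⟩

/-- The vertex is itself a face, so conformity makes its intersection with t the hull of common
vertices, which must be nonempty. -/
theorem mem_of_mem_simplex {s t : Finset (E d)} (hs : s ∈ T.cells) (ht : t ∈ T.cells) {x : E d}
    (hxs : x ∈ s) (hxt : x ∈ simplex t) : x ∈ t := by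
  classical
  have hx : {x} ∈ T.faces := T.down_closed hs.1 (by simpa using hxs) (by simp)
  have h : x ∈ simplex ({x} ∩ t) := by
    rw [← T.simplex_inter_simplex hx ht.1]
    exact ⟨by simp [simplex], hxt⟩
  by_contra hxt'
  rw [Finset.singleton_inter_of_notMem hxt'] at h
  simp [simplex] at h

/-- Suppose the cells at x split into a component, with union A, and the rest, with union B. Near x
these closed sets cover Ω, so local connectedness yields a point of A ∩ B in Ω. Around it, cells of
different parts meet only in faces of codimension at least two, and a generic segment from one part
to the other avoids them, although by connectedness it must meet A ∩ B. -/
theorem vertexGraph_preconnected (hΩ : IsOpen Ω) (hL : HasLipschitzBoundary Ω) (x : E d) :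
    (T.vertexGraph x).Preconnected := by
  classical
  intro s₀ t₀
  by_contra hst
  let V := {s : Finset (E d) // s ∈ T.cells ∧ x ∈ s}
  have hfinV : Finite V := (T.finite_cells.subset fun _ h => h.1).to_subtype
  let S : Set V := {t | (T.vertexGraph x).Reachable s₀ t}
  let A : Set (E d) := ⋃ t ∈ S, simplex (t : Finset (E d))
  let B : Set (E d) := ⋃ t ∈ Sᶜ, simplex (t : Finset (E d))
  let F : Set (E d) := ⋃ t ∈ {t ∈ T.cells | x ∉ t}, simplex t
  have hA : IsClosed A := S.toFinite.isClosed_biUnion fun t _ => (isCompact_simplex _).isClosed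
  have hB : IsClosed B := Sᶜ.toFinite.isClosed_biUnion fun t _ => (isCompact_simplex _).isClosed
  have hF : IsClosed F := (T.finite_cells.subset fun _ h => h.1).isClosed_biUnion
    fun t _ => (isCompact_simplex _).isClosed
  have hxF : x ∉ F := fun h => by
    obtain ⟨t, ht, hxt⟩ := mem_iUnion₂.1 h
    exact ht.2 (T.mem_of_mem_simplex s₀.2.1 ht.1 s₀.2.2 hxt)
  -- Cells without the vertex x do not contain the point x, so near x only cells at this vertex
  -- occur.
  obtain ⟨ε, hε, hεF⟩ := Metric.isOpen_iff.1 hF.isOpen_compl x hxF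
  have hcover : Ω ∩ Metric.ball x ε ⊆ A ∪ B := by
    rintro y ⟨hy, hyb⟩
    obtain ⟨t, ht, hyt⟩ := mem_iUnion₂.1 (T.closure_subset_iUnion (subset_closure hy))
    by_cases hxt : x ∈ t
    · by_cases htS : (⟨t, ht, hxt⟩ : V) ∈ S
      · exact Or.inl (mem_biUnion htS hyt)
      · exact Or.inr (mem_biUnion (show (⟨t, ht, hxt⟩ : V) ∈ Sᶜ from htS) hyt)
    · exact absurd (mem_biUnion (show t ∈ {t ∈ T.cells | x ∉ t} from ⟨ht, hxt⟩) hyt) (hεF hyb)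
  have hxv : ∀ t : V, x ∈ simplex (t : Finset (E d)) := fun t => subset_convexHull ℝ _ t.2.2
  have hnear : ∀ (t : V) (y : E d) (δ : ℝ), 0 < δ → y ∈ simplex (t : Finset (E d)) →
      (interior (simplex (t : Finset (E d))) ∩ Metric.ball y δ).Nonempty := by
    intro t y δ hδ hy
    rw [← T.closure_interior_simplex t.2.1] at hy
    obtain ⟨z, hz, hd⟩ := Metric.mem_closure_iff.1 hy δ hδ
    exact ⟨z, hz, by rwa [Metric.mem_ball, dist_comm]⟩
  obtain ⟨η, hη, hconn⟩ := hL.exists_isPreconnected hΩ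
    (T.simplex_subset_closure s₀.2.1.1 (hxv s₀)) hε
  obtain ⟨y₁, hy₁, hy₁b⟩ := hnear s₀ x η hη (hxv s₀)
  obtain ⟨y₂, hy₂, hy₂b⟩ := hnear t₀ x η hη (hxv t₀)
  obtain ⟨C, hC, hCW, hCy₁, hCy₂⟩ := hconn y₁ ⟨T.interior_simplex_subset hΩ hL s₀.2.1 hy₁, hy₁b⟩
    y₂ ⟨T.interior_simplex_subset hΩ hL t₀.2.1 hy₂, hy₂b⟩
  have hs₀S : s₀ ∈ S := SimpleGraph.Reachable.refl s₀
  have ht₀S : t₀ ∈ Sᶜ := hst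
  obtain ⟨y₀, hy₀C, hy₀A, hy₀B⟩ := isPreconnected_closed_iff.1 hC A B hA hB (hCW.trans hcover)
    ⟨y₁, hCy₁, mem_biUnion hs₀S (interior_subset hy₁)⟩
    ⟨y₂, hCy₂, mem_biUnion ht₀S (interior_subset hy₂)⟩
  obtain ⟨δ, hδ, hδW⟩ := Metric.isOpen_iff.1 (hΩ.inter Metric.isOpen_ball) y₀ (hCW hy₀C)
  obtain ⟨t₁, ht₁, hyt₁⟩ := mem_iUnion₂.1 hy₀A
  obtain ⟨t₂, ht₂, hyt₂⟩ := mem_iUnion₂.1 hy₀B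
  have hcard : ∀ u ∈ S, ∀ w ∈ Sᶜ, ((u : Finset (E d)) ∩ w).card < d := by
    intro u hu w hw
    have hne : u ≠ w := fun h => hw (h ▸ hu)
    have h1 : ((u : Finset (E d)) ∩ w).card ≠ d := fun h =>
      hw ((show (T.vertexGraph x).Reachable s₀ u from hu).trans
        (SimpleGraph.Adj.reachable ⟨hne, h⟩))
    have h2 : ((u : Finset (E d)) ∩ w).card < d + 1 := by
      rw [← u.2.1.2]
      refine Finset.card_lt_card (Finset.ssubset_iff_subset_ne.2 ⟨Finset.inter_subset_left, ?_⟩)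
      intro h
      refine hne (Subtype.ext (Finset.eq_of_subset_of_card_le (Finset.inter_eq_left.1 h) ?_))
      rw [u.2.1.2, w.2.1.2]
    omega
  have hpick : ∀ (t : V) (N : Set (E d)), y₀ ∈ simplex (t : Finset (E d)) → volume N = 0 →
      ∃ y ∈ interior (simplex (t : Finset (E d))) ∩ Metric.ball y₀ δ, y ∉ N := by
    intro t N ht hN
    by_contra! hcon
    exact (isOpen_interior.inter Metric.isOpen_ball).measure_ne_zero volume (hnear t y₀ δ hδ ht)
      (measure_mono_null hcon hN)
  -- Cells of different parts have fewer than d common vertices, so y can avoid the spans of their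
  -- common faces. Adding y still leaves at most d points, so the enlarged spans are null as well
  -- and y' can avoid those.
  obtain ⟨y, ⟨hyi, hyb⟩, hyN⟩ := hpick t₁
    (⋃ u ∈ S, ⋃ w ∈ Sᶜ, affineSpan ℝ (((u : Finset (E d)) ∩ w : Finset (E d)) : Set (E d))) hyt₁
    ((measure_biUnion_null_iff S.to_countable).2 fun u hu =>
      (measure_biUnion_null_iff Sᶜ.to_countable).2 fun w hw =>
        measure_affineSpan_eq_zero (hcard u hu w hw).le)
  obtain ⟨y', ⟨hyi', hyb'⟩, hyN'⟩ := hpick t₂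
    (⋃ u ∈ S, ⋃ w ∈ Sᶜ,
      affineSpan ℝ ((insert y ((u : Finset (E d)) ∩ w) : Finset (E d)) : Set (E d))) hyt₂
    ((measure_biUnion_null_iff S.to_countable).2 fun u hu =>
      (measure_biUnion_null_iff Sᶜ.to_countable).2 fun w hw =>
        measure_affineSpan_eq_zero ((Finset.card_insert_le _ _).trans (hcard u hu w hw)))
  have hseg : segment ℝ y y' ⊆ A ∪ B :=
    (((convex_ball y₀ δ).segment_subset hyb hyb').trans hδW).trans hcover
  obtain ⟨p, hp, hpA, hpB⟩ := isPreconnected_closed_iff.1 (convex_segment y y').isPreconnected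
    A B hA hB hseg ⟨y, left_mem_segment ℝ _ _, mem_biUnion ht₁ (interior_subset hyi)⟩
    ⟨y', right_mem_segment ℝ _ _, mem_biUnion ht₂ (interior_subset hyi')⟩
  obtain ⟨u, hu, hpu⟩ := mem_iUnion₂.1 hpA
  obtain ⟨w, hw, hpw⟩ := mem_iUnion₂.1 hpB
  have hpF : p ∈ affineSpan ℝ (((u : Finset (E d)) ∩ w : Finset (E d)) : Set (E d)) := by
    refine convexHull_subset_affineSpan _ ?_
    change p ∈ simplex _
    rw [← T.simplex_inter_simplex u.2.1.1 w.2.1.1]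
    exact ⟨hpu, hpw⟩
  have hpy : p ≠ y := by
    rintro rfl
    exact hyN (mem_biUnion hu (mem_biUnion hw hpF))
  rw [segment_eq_image_lineMap] at hp
  obtain ⟨θ, hθ, rfl⟩ := hp
  have hθ0 : θ ≠ 0 := by
    rintro rfl
    simp at hpy
  refine hyN' (mem_biUnion hu (mem_biUnion hw ?_))
  -- If the segment met such a face at p ≠ y, then y' would lie on the line through y and p, hence
  -- in the enlarged span.
  have hline : y' = AffineMap.lineMap y (AffineMap.lineMap y y' θ) θ⁻¹ := by
    simp [AffineMap.lineMap_apply, smul_smul, hθ0]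
  rw [hline]
  refine AffineMap.lineMap_mem _ (mem_affineSpan ℝ (by simp)) ?_
  exact affineSpan_mono ℝ (by simp) hpF

end Triangulation

/-! ### Polynomial approximation and comparison on overlapping sets -/

section JetApprox

variable {d : ℕ}

/-- `polyField Q` has degree less than `ℓ` and the same mean derivatives on `D` as a field with the
weak gradients `U k`. -/
structure IsJetApprox (D : Set (E d)) (ℓ : ℕ) (U : ∀ k, E d → GradVal d k)
    (Q : Fin d → MvPolynomial (Fin d) ℝ) : Prop where
  totalDegree_le : ∀ c, (Q c).totalDegree ≤ ℓ - 1
  classGrad_eq_zero : ∀ x, classGrad ℓ (polyField Q) x = 0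
  isMeanZeroJet : IsMeanZeroJet D ℓ fun k x => U k x - classGrad k (polyField Q) x

theorem IsJetApprox.exists_of_isWeakGrad {Ω D : Set (E d)} (hD : IsOpen D)
    (hb : Bornology.IsBounded D) (hne : D.Nonempty) (hsub : D ⊆ Ω) {ℓ : ℕ} {u : E d → E d}
    {U : ∀ k, E d → GradVal d k} (hU : ∀ k ≤ ℓ, IsWeakGrad Ω k u (U k))
    (hi : ∀ k ≤ ℓ, IntegrableOn (U k) Ω) : ∃ Q, IsJetApprox D ℓ U Q := by
  obtain ⟨Q, h1, h2, h3⟩ := exists_polyField_isMeanZeroJet hD hb hne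
    (fun k hk => (hU k hk).mono hsub) (fun k hk => (hi k hk).mono_set hsub)
  exact ⟨Q, h1, h2, h3⟩

/-- The gradient of order ℓ of the approximating polynomial vanishes, so the right-hand side
involves that of the field alone. A set in a ball of radius h has diameter at most 2h, whence the
factor 2^(ℓ − k). -/
theorem IsJetApprox.exists_lpN_le {ℓ k : ℕ} (hk : k ≤ ℓ) {q r : ℝ} (hq : 1 ≤ q) (hr : 1 ≤ r)
    (hθ : r ≤ q ∨ d * (1 / q - 1 / r) < (ℓ - k : ℕ)) : ∃ C : ℝ≥0∞, C ≠ ⊤ ∧ ∀ (D : Set (E d))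
      (U : ∀ k, E d → GradVal d k) (Q) (x : E d) (h : ℝ), Convex ℝ D → IsOpen D → D.Nonempty →
      D ⊆ Metric.closedBall x h → IsJetApprox D ℓ U Q →
      lpN D r (fun y => U k y - classGrad k (polyField Q) y)
        ≤ C * ENNReal.ofReal h ^ (ℓ - k) * volume D ^ (1 / r - 1 / q) * lpN D q (U ℓ) := by
  obtain ⟨C, hC, H⟩ := IsMeanZeroJet.lpN_le (d := d) ℓ (ℓ - k) (Nat.sub_le _ _) hq hr hθ
  refine ⟨C * 2 ^ (ℓ - k), by finiteness, ?_⟩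
  intro D U Q x h hconv hopen hne hsub hQ
  have hdist : ∀ y ∈ D, ∀ z ∈ D, ‖y - z‖ₑ ≤ 2 * ENNReal.ofReal h := by
    intro y hy z hz
    have h2 : 2 * ENNReal.ofReal h = ENNReal.ofReal (2 * h) := by
      rw [ENNReal.ofReal_mul zero_le_two, ENNReal.ofReal_ofNat]
    rw [← ofReal_norm, h2, ← dist_eq_norm]
    refine ENNReal.ofReal_le_ofReal ((dist_triangle_right y z x).trans ?_)
    linarith [Metric.mem_closedBall.1 (hsub hy), Metric.mem_closedBall.1 (hsub hz)]
  have h1 := H D _ _ hconv hopen hne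
    ((measure_mono hsub).trans_lt measure_closedBall_lt_top).ne hdist hQ.isMeanZeroJet
  rw [Nat.sub_sub_self hk] at h1
  simp only [hQ.classGrad_eq_zero, sub_zero] at h1
  rwa [mul_pow, ← mul_assoc] at h1

theorem lpN_one {F : Type*} [NormedAddCommGroup F] (D : Set (E d)) (f : E d → F) :
    lpN D 1 f = ∫⁻ x in D, ‖f x‖ₑ := by
  simp [lpN]

theorem IsJetApprox.exists_lintegral_le {ℓ k : ℕ} (hk : k ≤ ℓ) : ∃ C : ℝ≥0∞, C ≠ ⊤ ∧
    ∀ (D : Set (E d)) (U : ∀ k, E d → GradVal d k) (Q) (x : E d) (h : ℝ), Convex ℝ D →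
      IsOpen D → D.Nonempty → D ⊆ Metric.closedBall x h → IsJetApprox D ℓ U Q →
      ∫⁻ y in D, ‖U k y - classGrad k (polyField Q) y‖ₑ
        ≤ C * ENNReal.ofReal h ^ (ℓ - k) * ∫⁻ y in D, ‖U ℓ y‖ₑ := by
  obtain ⟨C, hC, H⟩ := IsJetApprox.exists_lpN_le (d := d) hk (q := 1) (r := 1) le_rfl le_rfl
    (Or.inl le_rfl)
  refine ⟨C, hC, fun D U Q x h hconv hopen hne hsub hQ => ?_⟩
  have := H D U Q x h hconv hopen hne hsub hQ
  simpa [lpN_one] using this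

/-- Two polynomial approximations on overlapping sets are close to each other. -/
theorem IsJetApprox.exists_enorm_sub_le {ℓ k : ℕ} (hk : k ≤ ℓ) {c : ℝ} (hc : 0 < c) :
    ∃ C : ℝ≥0∞, C ≠ ⊤ ∧ ∀ (D D' S : Set (E d)) (U : ∀ k, E d → GradVal d k) (Q Q')
      (x y : E d) (h : ℝ), 0 < h → Convex ℝ D → IsOpen D → Convex ℝ D' → IsOpen D' →
      D ⊆ Metric.closedBall x h → D' ⊆ Metric.closedBall x h →
      Metric.ball y (c * h) ⊆ D → Metric.ball y (c * h) ⊆ D' →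
      D ⊆ S → D' ⊆ S → IsJetApprox D ℓ U Q → IsJetApprox D' ℓ U Q' →
      ∀ w ∈ Metric.closedBall x h,
      ‖classGrad k (polyField Q) w - classGrad k (polyField Q') w‖ₑ
        ≤ C * ENNReal.ofReal h ^ (-(d : ℝ)) *
          (ENNReal.ofReal h ^ (ℓ - k) * ∫⁻ z in S, ‖U ℓ z‖ₑ) := by
  obtain ⟨C₁, hC₁, H₁⟩ := IsJetApprox.exists_lintegral_le (d := d) hk
  obtain ⟨C₂, hC₂, H₂⟩ := exists_enorm_classGrad_le_lintegral (d := d) (ℓ - 1) k (2 / c)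
  have hc' : ENNReal.ofReal c ^ (-(d : ℝ)) ≠ ⊤ :=
    ENNReal.rpow_ne_top_of_ne_zero (by simpa using hc) ENNReal.ofReal_ne_top
  refine ⟨C₂ * ENNReal.ofReal c ^ (-(d : ℝ)) * (2 * C₁), by finiteness, ?_⟩
  intro D D' S U Q Q' x y h hh hconv hopen hconv' hopen' hx hx' hy hy' hS hS' hQ hQ' w hw
  have hyD : y ∈ Metric.ball y (c * h) := Metric.mem_ball_self (by positivity)
  -- The ball of radius 2h about y contains the ball of radius h about x; this determines the ratio
  -- 2/c in the inverse estimate.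
  have hwy : w ∈ Metric.closedBall y (2 / c * (c * h)) := by
    have h2 : 2 / c * (c * h) = h + h := by field_simp; ring
    rw [h2, Metric.mem_closedBall]
    refine (dist_triangle_right w y x).trans (add_le_add hw ?_)
    exact hx (hy hyD)
  have hdeg : ∀ i, ((Q - Q') i).totalDegree ≤ ℓ - 1 := fun i =>
    (MvPolynomial.totalDegree_sub _ _).trans (max_le (hQ.totalDegree_le i) (hQ'.totalDegree_le i))
  have h1 := H₂ (Q - Q') hdeg y (c * h) (by positivity) w hwy
  simp only [classGrad_polyField_sub] at h1
  refine h1.trans ?_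
  have hM : ∀ D₁ Q₁, Convex ℝ D₁ → IsOpen D₁ → D₁ ⊆ Metric.closedBall x h →
      Metric.ball y (c * h) ⊆ D₁ → D₁ ⊆ S → IsJetApprox D₁ ℓ U Q₁ →
      ∫⁻ z in Metric.ball y (c * h), ‖U k z - classGrad k (polyField Q₁) z‖ₑ
        ≤ C₁ * (ENNReal.ofReal h ^ (ℓ - k) * ∫⁻ z in S, ‖U ℓ z‖ₑ) := by
    intro D₁ Q₁ a1 a2 a3 a4 a5 a6
    refine (lintegral_mono_set a4).trans ((H₁ D₁ U Q₁ x h a1 a2 ⟨y, a4 hyD⟩ a3 a6).trans ?_)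
    rw [mul_assoc]
    gcongr
  -- On the small common ball both polynomial gradients are close to U k; the inverse estimate
  -- applied to their difference extends this to the large ball.
  have h2 : ∫⁻ z in Metric.ball y (c * h),
      ‖classGrad k (polyField Q) z - classGrad k (polyField Q') z‖ₑ
      ≤ 2 * C₁ * (ENNReal.ofReal h ^ (ℓ - k) * ∫⁻ z in S, ‖U ℓ z‖ₑ) := by
    calc ∫⁻ z in Metric.ball y (c * h),
          ‖classGrad k (polyField Q) z - classGrad k (polyField Q') z‖ₑ
        ≤ ∫⁻ z in Metric.ball y (c * h), (‖U k z - classGrad k (polyField Q') z‖ₑ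
            + ‖U k z - classGrad k (polyField Q) z‖ₑ) := by
          refine lintegral_mono fun z => ?_
          rw [← sub_sub_sub_cancel_left _ _ (U k z)]
          exact enorm_sub_le
      _ = (∫⁻ z in Metric.ball y (c * h), ‖U k z - classGrad k (polyField Q') z‖ₑ)
            + ∫⁻ z in Metric.ball y (c * h), ‖U k z - classGrad k (polyField Q) z‖ₑ :=
          lintegral_add_left' ((hQ'.isMeanZeroJet.measurable k hk).mono_measure
            (Measure.restrict_mono hy' le_rfl)).enorm _
      _ ≤ _ := by
          rw [two_mul, add_mul]
          exact add_le_add (hM D' Q' hconv' hopen' hx' hy' hS' hQ')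
            (hM D Q hconv hopen hx hy hS hQ)
  rw [ENNReal.ofReal_mul hc.le, ENNReal.mul_rpow_of_ne_top ENNReal.ofReal_ne_top
    ENNReal.ofReal_ne_top]
  calc _ ≤ C₂ * (ENNReal.ofReal c ^ (-(d : ℝ)) * ENNReal.ofReal h ^ (-(d : ℝ))) *
        (2 * C₁ * (ENNReal.ofReal h ^ (ℓ - k) * ∫⁻ z in S, ‖U ℓ z‖ₑ)) := by gcongr
    _ = _ := by ring

end JetApprox

/-! ### Comparison of mean polynomials across a patch -/

namespace Triangulation

variable {d : ℕ} {Ω : Set (E d)} (T : Triangulation Ω)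

theorem simplex_subset_closedBall {s : Finset (E d)} (hs : s ∈ T.cells) {x : E d}
    (hx : x ∈ simplex s) : simplex s ⊆ Metric.closedBall x T.meshSize := fun _ hy =>
  (Metric.dist_le_diam_of_mem (isCompact_simplex s).isBounded hy hx).trans
    (T.cellDiam_le_meshSize hs)

/-- The inscribed ball is contracted towards z by the factor τ = b/(1 + a). Convexity keeps the
image in the cell, and since the old centre is within h of z, the image lies within τ(1 + a)h = b h
of z. -/
theorem exists_ball_subset_inter_ball {a b : ℝ} (ha0 : 0 < a) (hb0 : 0 < b)
    (hb : b ≤ 1) (ha : T.IsRegular a) (hh : 0 < T.meshSize) {s : Finset (E d)} (hs : s ∈ T.cells)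
    {z : E d} (hz : z ∈ simplex s) : ∃ y,
      Metric.ball y (a * b / (1 + a) * T.meshSize)
        ⊆ interior (simplex s) ∩ Metric.ball z (b * T.meshSize) := by
  obtain ⟨x, hx⟩ := ha s hs
  set h := T.meshSize
  set τ := b / (1 + a) with hτ
  have hτ0 : 0 < τ := by positivity
  have hτ1 : τ ≤ 1 := (div_le_one (by positivity)).2 (by linarith)
  have hrad : a * b / (1 + a) * h = τ * (a * h) := by rw [hτ]; ring
  have hxs : x ∈ simplex s := hx (Metric.mem_closedBall_self (by positivity))
  have hdist : dist x z ≤ h := T.simplex_subset_closedBall hs hz hxs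
  refine ⟨z + τ • (x - z), subset_inter (interior_maximal ?_ Metric.isOpen_ball) ?_⟩
  · intro w hw
    rw [hrad, Metric.mem_ball, dist_eq_norm] at hw
    have hmem : x + τ⁻¹ • (w - (z + τ • (x - z))) ∈ simplex s := by
      refine hx ?_
      rw [Metric.mem_closedBall, dist_eq_norm, add_sub_cancel_left, norm_smul,
        Real.norm_of_nonneg (by positivity), inv_mul_le_iff₀ hτ0]
      exact hw.le
    have := (convex_simplex s).add_smul_sub_mem hz hmem ⟨hτ0.le, hτ1⟩
    convert this using 1
    rw [smul_sub, smul_add, smul_smul, mul_inv_cancel₀ hτ0.ne', one_smul, smul_sub]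
    abel
  · refine Metric.ball_subset_ball' ?_
    rw [dist_eq_norm, add_sub_cancel_left, norm_smul, Real.norm_of_nonneg hτ0.le, ← dist_eq_norm,
      hrad]
    have : b * h = τ * (a * h) + τ * h := by rw [hτ]; field_simp; ring
    rw [this]
    gcongr

/-- Comparison of the polynomial approximations on two cells with a common facet. -/
theorem exists_enorm_sub_le_of_adj (hd : 1 ≤ d) {ℓ k : ℕ} (hk : k ≤ ℓ) {a : ℝ} (ha0 : 0 < a)
    (ha1 : a ≤ 1) :
    ∃ C : ℝ≥0∞, C ≠ ⊤ ∧ ∀ (Ω : Set (E d)) (_ : IsOpen Ω) (_ : HasLipschitzBoundary Ω)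
      (T : Triangulation Ω) (_ : T.IsRegular a) (_ : 0 < T.meshSize) (u : E d → E d)
      (U : ∀ k, E d → GradVal d k) (_ : ∀ k ≤ ℓ, IsWeakGrad Ω k u (U k))
      (_ : ∀ k ≤ ℓ, IntegrableOn (U k) Ω) (x : E d) (s t) (_ : (T.vertexGraph x).Adj s t)
      (S : Set (E d)) (_ : simplex (s : Finset (E d)) ⊆ S) (_ : simplex (t : Finset (E d)) ⊆ S)
      (Q Q') (_ : IsJetApprox (interior (simplex (s : Finset (E d)))) ℓ U Q)
      (_ : IsJetApprox (interior (simplex (t : Finset (E d)))) ℓ U Q'),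
      ∀ w ∈ Metric.closedBall x T.meshSize,
      ‖classGrad k (polyField Q) w - classGrad k (polyField Q') w‖ₑ
        ≤ C * ENNReal.ofReal T.meshSize ^ (-(d : ℝ)) *
          (ENNReal.ofReal T.meshSize ^ (ℓ - k) * ∫⁻ z in S, ‖U ℓ z‖ₑ) := by
  classical
  have hdR : (0 : ℝ) < d := by exact_mod_cast hd
  have hb0 : 0 < a / d := by positivity
  have hb1 : a / d ≤ 1 := (div_le_one hdR).2 (ha1.trans (by exact_mod_cast hd))
  obtain ⟨C, hC, H⟩ := IsJetApprox.exists_enorm_sub_le (d := d) hk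
    (c := a * (a / d) / (1 + a)) (by positivity)
  refine ⟨2 * C, by finiteness, ?_⟩
  intro Ω hΩ hL T ha hh u U hU hi x s t hst S hsS htS Q Q' hQ hQ' w hw
  obtain ⟨z, ⟨hzs, hzt⟩, hz⟩ := T.exists_ball_subset_union hd ha0 ha hh s.2.1 t.2.1 hst.2
  have hsub : ∀ v : {s : Finset (E d) // s ∈ T.cells ∧ x ∈ s},
      simplex (v : Finset (E d)) ⊆ Metric.closedBall x T.meshSize := fun v =>
    T.simplex_subset_closedBall v.2.1 (subset_convexHull ℝ _ v.2.2)
  have hzΩ : Metric.ball z (a / d * T.meshSize) ⊆ Ω := by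
    refine (interior_maximal ?_ Metric.isOpen_ball).trans (hL.interior_closure_subset hΩ)
    exact hz.trans (union_subset (T.simplex_subset_closure s.2.1.1)
      (T.simplex_subset_closure t.2.1.1))
  -- The mean polynomial of the ball about the barycentre of the common facet is the intermediary:
  -- this ball lies in Ω and contains a smaller ball inside each of the two cells.
  obtain ⟨P, hP⟩ := IsJetApprox.exists_of_isWeakGrad Metric.isOpen_ball Metric.isBounded_ball
    (Metric.nonempty_ball.2 (mul_pos hb0 hh)) hzΩ hU hi
  have key : ∀ v : {s : Finset (E d) // s ∈ T.cells ∧ x ∈ s}, z ∈ simplex (v : Finset (E d)) →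
      simplex (v : Finset (E d)) ⊆ S → ∀ R,
      IsJetApprox (interior (simplex (v : Finset (E d)))) ℓ U R →
      ‖classGrad k (polyField R) w - classGrad k (polyField P) w‖ₑ
        ≤ C * ENNReal.ofReal T.meshSize ^ (-(d : ℝ)) *
          (ENNReal.ofReal T.meshSize ^ (ℓ - k) * ∫⁻ z in S, ‖U ℓ z‖ₑ) := by
    intro v hzv hvS R hR
    obtain ⟨y, hy⟩ := T.exists_ball_subset_inter_ball ha0 hb0 hb1 ha hh v.2.1 hzv
    exact H _ _ S U R P x y T.meshSize hh (convex_simplex _).interior isOpen_interior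
      (convex_ball _ _) Metric.isOpen_ball (interior_subset.trans (hsub v))
      (hz.trans (union_subset (hsub s) (hsub t))) (hy.trans inter_subset_left)
      (hy.trans inter_subset_right) (interior_subset.trans hvS)
      (hz.trans (union_subset hsS htS)) hR hP w hw
  rw [← sub_sub_sub_cancel_right _ _ (classGrad k (polyField P) w)]
  refine enorm_sub_le.trans ((add_le_add (key s hzs hsS Q hQ) (key t hzt htS Q' hQ')).trans ?_)
  rw [← two_mul]
  exact le_of_eq (by ring)

theorem card_vertex_le {a : ℝ} (ha0 : 0 < a) (ha : T.IsRegular a)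
    (hh : 0 < T.meshSize) (x : E d) [Fintype {s : Finset (E d) // s ∈ T.cells ∧ x ∈ s}] :
    (Fintype.card {s : Finset (E d) // s ∈ T.cells ∧ x ∈ s} : ℝ) ≤ (1 / a) ^ d := by
  classical
  have h := T.card_le_of_subset_closedBall ha0 ha hh
    (Finset.univ.image (Subtype.val : {s : Finset (E d) // s ∈ T.cells ∧ x ∈ s} → _)) (x := x)
    (R := 1) ?_ zero_le_one ?_
  · rwa [Finset.card_image_of_injective _ Subtype.val_injective, Finset.card_univ] at h
  · intro s hs
    obtain ⟨s, -, rfl⟩ := Finset.mem_image.1 hs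
    exact s.2.1
  · intro s hs
    obtain ⟨s, -, rfl⟩ := Finset.mem_image.1 hs
    rw [one_mul]
    exact T.simplex_subset_closedBall s.2.1 (subset_convexHull ℝ _ s.2.2)

theorem patch_subset {s : Finset (E d)} : T.patch s ⊆ closure Ω :=
  iUnion₂_subset fun _ ht => T.simplex_subset_closure ht.1.1

theorem simplex_subset_patch {s t : Finset (E d)} (ht : t ∈ T.cells)
    (hst : (simplex t ∩ simplex s).Nonempty) : simplex t ⊆ T.patch s :=
  subset_biUnion_of_mem (show t ∈ {t ∈ T.cells | (simplex t ∩ simplex s).Nonempty} from ⟨ht, hst⟩)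

theorem exists_common_vertex {s t : Finset (E d)} (hs : s ∈ T.cells) (ht : t ∈ T.cells)
    (hst : (simplex t ∩ simplex s).Nonempty) : ∃ x, x ∈ s ∧ x ∈ t := by
  classical
  rw [T.simplex_inter_simplex ht.1 hs.1] at hst
  obtain ⟨x, hx⟩ := convexHull_nonempty_iff.1 hst
  have := Finset.mem_inter.1 (Finset.mem_coe.1 hx)
  exact ⟨x, this.2, this.1⟩

/-- Comparison of the polynomial approximations on two touching cells. -/
theorem exists_enorm_sub_le_of_touch (hd : 1 ≤ d) {ℓ k : ℕ} (hk : k ≤ ℓ) {a : ℝ} (ha0 : 0 < a)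
    (ha1 : a ≤ 1) :
    ∃ C : ℝ≥0∞, C ≠ ⊤ ∧ ∀ (Ω : Set (E d)) (_ : IsOpen Ω) (_ : HasLipschitzBoundary Ω)
      (T : Triangulation Ω) (_ : T.IsRegular a) (_ : 0 < T.meshSize) (u : E d → E d)
      (U : ∀ k, E d → GradVal d k) (_ : ∀ k ≤ ℓ, IsWeakGrad Ω k u (U k))
      (_ : ∀ k ≤ ℓ, IntegrableOn (U k) Ω) (s t) (_ : s ∈ T.cells) (_ : t ∈ T.cells)
      (_ : (simplex t ∩ simplex s).Nonempty)
      (Q Q') (_ : IsJetApprox (interior (simplex s)) ℓ U Q)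
      (_ : IsJetApprox (interior (simplex t)) ℓ U Q'),
      ∀ w ∈ simplex t,
      ‖classGrad k (polyField Q) w - classGrad k (polyField Q') w‖ₑ
        ≤ C * ENNReal.ofReal T.meshSize ^ (-(d : ℝ)) *
          (ENNReal.ofReal T.meshSize ^ (ℓ - k) * ∫⁻ z in T.patch s, ‖U ℓ z‖ₑ) := by
  classical
  obtain ⟨C, hC, H⟩ := exists_enorm_sub_le_of_adj hd hk ha0 ha1
  obtain ⟨C', hC', H'⟩ := IsJetApprox.exists_enorm_sub_le (d := d) hk ha0
  refine ⟨ENNReal.ofReal ((1 / a) ^ d) * (C + C'), by finiteness, ?_⟩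
  intro Ω hΩ hL T ha hh u U hU hi s t hs ht hst Q Q' hQ hQ' w hw
  obtain ⟨x, hxs, hxt⟩ := T.exists_common_vertex hs ht hst
  let V := {s : Finset (E d) // s ∈ T.cells ∧ x ∈ s}
  have hfinV : Finite V := (T.finite_cells.subset fun _ h => h.1).to_subtype
  have := Fintype.ofFinite V
  let s' : V := ⟨s, hs, hxs⟩
  let t' : V := ⟨t, ht, hxt⟩
  have hpatch : ∀ v : V, simplex (v : Finset (E d)) ⊆ T.patch s := fun v =>
    T.simplex_subset_patch v.2.1
      ⟨x, subset_convexHull ℝ _ v.2.2, subset_convexHull ℝ _ hxs⟩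
  have hwx : w ∈ Metric.closedBall x T.meshSize :=
    T.simplex_subset_closedBall ht (subset_convexHull ℝ _ hxt) hw
  set B := (C + C') * ENNReal.ofReal T.meshSize ^ (-(d : ℝ)) *
          (ENNReal.ofReal T.meshSize ^ (ℓ - k) * ∫⁻ z in T.patch s, ‖U ℓ z‖ₑ) with hB
  have hCB : C * ENNReal.ofReal T.meshSize ^ (-(d : ℝ)) *
      (ENNReal.ofReal T.meshSize ^ (ℓ - k) * ∫⁻ z in T.patch s, ‖U ℓ z‖ₑ) ≤ B := by
    rw [hB]
    gcongr
    exact le_self_add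
  -- One comparison for each edge, and one more at the end of the walk, where two possibly different
  -- approximations on the same cell have to be compared.
  have hwalk : ∀ (v v' : V) (p : (T.vertexGraph x).Walk v v') (R R'),
      IsJetApprox (interior (simplex (v : Finset (E d)))) ℓ U R →
      IsJetApprox (interior (simplex (v' : Finset (E d)))) ℓ U R' →
      ‖classGrad k (polyField R) w - classGrad k (polyField R') w‖ₑ
        ≤ (p.length + 1 : ℕ) * B := by
    intro v v' p
    induction p with
    | @nil v =>
      intro R R' hR hR'
      obtain ⟨y, hy⟩ := ha v v.2.1
      have hball := interior_maximal (Metric.ball_subset_closedBall.trans hy) Metric.isOpen_ball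
      have hsub := T.simplex_subset_closedBall v.2.1 (subset_convexHull ℝ _ v.2.2)
      refine (H' _ _ (T.patch s) U R R' x y T.meshSize hh (convex_simplex _).interior
        isOpen_interior (convex_simplex _).interior isOpen_interior (interior_subset.trans hsub)
        (interior_subset.trans hsub) hball hball (interior_subset.trans (hpatch v))
        (interior_subset.trans (hpatch v)) hR hR' w hwx).trans ?_
      rw [SimpleGraph.Walk.length_nil, zero_add, Nat.cast_one, one_mul, hB]
      gcongr
      exact le_add_self
    | @cons v₁ v₂ v₃ hadj p ih =>
      intro R R' hR hR'
      obtain ⟨R₂, hR₂⟩ := IsJetApprox.exists_of_isWeakGrad isOpen_interior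
        ((isCompact_simplex (v₂ : Finset (E d))).isBounded.subset interior_subset)
        (T.interior_simplex_nonempty v₂.2.1) (T.interior_simplex_subset hΩ hL v₂.2.1) hU hi
      have h1 := H Ω hΩ hL T ha hh u U hU hi x v₁ v₂ hadj (T.patch s) (hpatch _) (hpatch _) R R₂
        hR hR₂ w hwx
      have h2 := ih R₂ R' hR₂ hR'
      rw [← sub_add_sub_cancel _ (classGrad k (polyField R₂) w)]
      refine (enorm_add_le _ _).trans ((add_le_add (h1.trans hCB) h2).trans (le_of_eq ?_))
      rw [SimpleGraph.Walk.length_cons]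
      push_cast
      ring
  obtain ⟨p⟩ := T.vertexGraph_preconnected hΩ hL x s' t'
  -- A path visits each cell at most once, so its number of vertices is at most the number of cells
  -- at x.
  have hlen : ((p.toPath.1.length + 1 : ℕ) : ℝ≥0∞) ≤ ENNReal.ofReal ((1 / a) ^ d) := by
    rw [← ENNReal.ofReal_natCast]
    refine ENNReal.ofReal_le_ofReal ((Nat.cast_le.2 p.toPath.2.length_lt).trans ?_)
    exact T.card_vertex_le ha0 ha hh x
  refine (hwalk s' t' p.toPath.1 Q Q' hQ hQ').trans ((mul_le_mul_left hlen _).trans (le_of_eq ?_))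
  rw [hB]
  ring

end Triangulation

theorem lintegral_biUnion_finset_le {α ι : Type*} [MeasurableSpace α] {μ : Measure α}
    (S : Finset ι) (A : ι → Set α) (f : α → ℝ≥0∞) :
    ∫⁻ x in ⋃ i ∈ S, A i, f x ∂μ ≤ ∑ i ∈ S, ∫⁻ x in A i, f x ∂μ := by
  have h : ⋃ i ∈ S, A i = ⋃ i : S, A i := by
    ext
    simp
  rw [h]
  refine (lintegral_iUnion_le _ _).trans (le_of_eq ?_)
  rw [tsum_fintype, Finset.sum_coe_sort S fun i => ∫⁻ x in A i, f x ∂μ]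

namespace Triangulation

variable {d : ℕ} {Ω : Set (E d)} (T : Triangulation Ω)

/-- The cells that touch the simplex with vertices `s`. -/
noncomputable def touching (s : Finset (E d)) : Finset (Finset (E d)) :=
  (T.finite_cells.subset (sep_subset T.cells fun t => (simplex t ∩ simplex s).Nonempty)).toFinset

theorem mem_touching {s t : Finset (E d)} :
    t ∈ T.touching s ↔ t ∈ T.cells ∧ (simplex t ∩ simplex s).Nonempty := by
  simp [touching]

theorem patch_eq_biUnion_touching (s : Finset (E d)) :
    T.patch s = ⋃ t ∈ T.touching s, simplex t := by
  simp [patch, mem_touching]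

theorem card_touching_le {a : ℝ} (ha0 : 0 < a) (ha : T.IsRegular a) (hh : 0 < T.meshSize)
    {s : Finset (E d)} (hs : s ∈ T.cells) : ((T.touching s).card : ℝ) ≤ (2 / a) ^ d := by
  obtain ⟨x, hx⟩ := T.interior_simplex_nonempty hs
  refine T.card_le_of_subset_closedBall ha0 ha hh _ (fun t ht => (T.mem_touching.1 ht).1)
    (x := x) zero_le_two fun t ht => ?_
  obtain ⟨htc, y, hyt, hys⟩ := T.mem_touching.1 ht
  refine (T.simplex_subset_closedBall htc hyt).trans (Metric.closedBall_subset_closedBall' ?_)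
  have := Metric.mem_closedBall.1 (T.simplex_subset_closedBall hs (interior_subset hx) hys)
  linarith

theorem measure_simplex_le (hh : 0 < T.meshSize) {s : Finset (E d)} (hs : s ∈ T.cells) :
    volume (simplex s)
      ≤ ENNReal.ofReal T.meshSize ^ (d : ℝ) * volume (Metric.ball (0 : E d) 1) := by
  obtain ⟨x, hx⟩ := T.interior_simplex_nonempty hs
  refine (measure_mono (T.simplex_subset_closedBall hs (interior_subset hx))).trans (le_of_eq ?_)
  rw [Measure.addHaar_closedBall volume _ hh.le, finrank_euclideanSpace_fin, ENNReal.rpow_natCast,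
    ENNReal.ofReal_pow hh.le]

theorem lintegral_interior (s : Finset (E d)) (f : E d → ℝ≥0∞) :
    ∫⁻ x in interior (simplex s), f x = ∫⁻ x in simplex s, f x :=
  setLIntegral_congr (interior_ae_eq_simplex s)

/-- The approximation of a field on the patch by the polynomial of one cell. -/
theorem exists_lintegral_patch_le (hd : 1 ≤ d) {ℓ k : ℕ} (hk : k ≤ ℓ) {a : ℝ} (ha0 : 0 < a)
    (ha1 : a ≤ 1) :
    ∃ C : ℝ≥0∞, C ≠ ⊤ ∧ ∀ (Ω : Set (E d)) (_ : IsOpen Ω) (_ : HasLipschitzBoundary Ω)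
      (T : Triangulation Ω) (_ : T.IsRegular a) (_ : 0 < T.meshSize) (u : E d → E d)
      (U : ∀ k, E d → GradVal d k) (_ : ∀ k ≤ ℓ, IsWeakGrad Ω k u (U k))
      (_ : ∀ k ≤ ℓ, IntegrableOn (U k) Ω) (s) (_ : s ∈ T.cells) (Q)
      (_ : IsJetApprox (interior (simplex s)) ℓ U Q),
      ∫⁻ x in T.patch s, ‖U k x - classGrad k (polyField Q) x‖ₑ
        ≤ C * (ENNReal.ofReal T.meshSize ^ (ℓ - k) * ∫⁻ x in T.patch s, ‖U ℓ x‖ₑ) := by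
  obtain ⟨C₁, hC₁, H₁⟩ := IsJetApprox.exists_lintegral_le (d := d) hk
  obtain ⟨C₂, hC₂, H₂⟩ := exists_enorm_sub_le_of_touch hd hk ha0 ha1
  have hb : volume (Metric.ball (0 : E d) 1) ≠ ⊤ := measure_ball_lt_top.ne
  refine ⟨ENNReal.ofReal ((2 / a) ^ d) * (C₁ + volume (Metric.ball (0 : E d) 1) * C₂),
    by finiteness, ?_⟩
  intro Ω hΩ hL T ha hh u U hU hi s hs Q hQ
  set M := ENNReal.ofReal T.meshSize ^ (ℓ - k) * ∫⁻ x in T.patch s, ‖U ℓ x‖ₑ with hM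
  have hcell : ∀ t ∈ T.touching s, ∫⁻ x in simplex t, ‖U k x - classGrad k (polyField Q) x‖ₑ
      ≤ (C₁ + volume (Metric.ball (0 : E d) 1) * C₂) * M := by
    intro t ht
    obtain ⟨htc, hts⟩ := T.mem_touching.1 ht
    obtain ⟨R, hR⟩ := IsJetApprox.exists_of_isWeakGrad isOpen_interior
      ((isCompact_simplex t).isBounded.subset interior_subset)
      (T.interior_simplex_nonempty htc) (T.interior_simplex_subset hΩ hL htc) hU hi
    obtain ⟨x, hx⟩ := T.interior_simplex_nonempty htc
    rw [← lintegral_interior]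
    calc ∫⁻ x in interior (simplex t), ‖U k x - classGrad k (polyField Q) x‖ₑ
        ≤ ∫⁻ x in interior (simplex t), (‖U k x - classGrad k (polyField R) x‖ₑ
            + ‖classGrad k (polyField Q) x - classGrad k (polyField R) x‖ₑ) := by
          refine lintegral_mono fun z => ?_
          rw [← sub_sub_sub_cancel_right _ _ (classGrad k (polyField R) z)]
          exact enorm_sub_le
      _ = (∫⁻ x in interior (simplex t), ‖U k x - classGrad k (polyField R) x‖ₑ)
            + ∫⁻ x in interior (simplex t),
              ‖classGrad k (polyField Q) x - classGrad k (polyField R) x‖ₑ :=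
          lintegral_add_left' (hR.isMeanZeroJet.measurable k hk).enorm _
      _ ≤ C₁ * M + volume (Metric.ball (0 : E d) 1) * C₂ * M := by
          refine add_le_add ?_ ?_
          · refine (H₁ _ U R x T.meshSize (convex_simplex t).interior isOpen_interior ⟨x, hx⟩
              (interior_subset.trans (T.simplex_subset_closedBall htc (interior_subset hx)))
              hR).trans ?_
            rw [mul_assoc, hM]
            gcongr
            exact interior_subset.trans (T.simplex_subset_patch htc hts)
          · refine (setLIntegral_mono' isOpen_interior.measurableSet fun w hw =>
              H₂ Ω hΩ hL T ha hh u U hU hi s t hs htc hts Q R hQ hR w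
                (interior_subset hw)).trans ?_
            rw [setLIntegral_const]
            refine (mul_le_mul_right ((measure_mono interior_subset).trans
              (T.measure_simplex_le hh htc)) _).trans (le_of_eq ?_)
            -- The factor h^(−d) of the pointwise comparison cancels against the volume of the cell.
            have h0 : ENNReal.ofReal T.meshSize ≠ 0 := by simpa using hh
            have h1 : ENNReal.ofReal T.meshSize ^ (-(d : ℝ)) *
                ENNReal.ofReal T.meshSize ^ (d : ℝ) = 1 := by
              rw [← ENNReal.rpow_add _ _ h0 ENNReal.ofReal_ne_top, neg_add_cancel,
                ENNReal.rpow_zero]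
            calc _ = volume (Metric.ball (0 : E d) 1) * C₂ * M *
                  (ENNReal.ofReal T.meshSize ^ (-(d : ℝ)) *
                    ENNReal.ofReal T.meshSize ^ (d : ℝ)) := by ring
              _ = _ := by rw [h1, mul_one]
      _ = _ := by rw [add_mul]
  rw [patch_eq_biUnion_touching]
  refine (lintegral_biUnion_finset_le _ _ _).trans ((Finset.sum_le_sum hcell).trans ?_)
  rw [Finset.sum_const, nsmul_eq_mul, mul_assoc]
  gcongr
  rw [← ENNReal.ofReal_natCast]
  exact ENNReal.ofReal_le_ofReal (T.card_touching_le ha0 ha hh hs)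

end Triangulation

/-! ### Test fields: rescaled bumps and plane waves -/

section TestFields

variable {d : ℕ}

theorem coordD_const_smul {F : Type*} [NormedAddCommGroup F] [NormedSpace ℝ F] (a : Fin d) (c : ℝ)
    {u : E d → F} (hu : ContDiff ℝ ∞ u) : coordD a (c • u) = c • coordD a u := by
  funext x
  have h : DifferentiableAt ℝ u x := (hu.differentiable (by simp)).differentiableAt
  simp [coordD, fderiv_const_smul h]

theorem coordD_comp_smul_sub {F : Type*} [NormedAddCommGroup F] [NormedSpace ℝ F] (a : Fin d)
    (t : ℝ) (x₀ : E d) {u : E d → F} (hu : ContDiff ℝ ∞ u) :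
    coordD a (fun x => u (t • (x - x₀))) = fun x => t • coordD a u (t • (x - x₀)) := by
  funext x
  have h1 : HasFDerivAt (fun x : E d => t • (x - x₀)) (t • ContinuousLinearMap.id ℝ (E d)) x :=
    ((hasFDerivAt_id x).sub_const x₀).const_smul t
  have h2 : HasFDerivAt u (fderiv ℝ u (t • (x - x₀))) (t • (x - x₀)) :=
    (hu.differentiable (by simp)).differentiableAt.hasFDerivAt
  have h3 := (h2.comp x h1).fderiv
  change fderiv ℝ (u ∘ fun x => t • (x - x₀)) x _ = _
  rw [h3]
  simp [coordD]

theorem listD_rescale {F : Type*} [NormedAddCommGroup F] [NormedSpace ℝ F] (L : List (Fin d))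
    (c t : ℝ) (x₀ : E d) {u : E d → F} (hu : ContDiff ℝ ∞ u) :
    listD L (fun x => c • u (t • (x - x₀)))
      = fun x => (c * t ^ L.length) • listD L u (t • (x - x₀)) := by
  induction L with
  | nil => simp
  | cons a L ih =>
    have hL := contDiff_listD L hu
    rw [listD_cons, ih]
    have h1 : ContDiff ℝ ∞ fun x => listD L u (t • (x - x₀)) := hL.comp (by fun_prop)
    have h2 := coordD_const_smul a (c * t ^ L.length) h1
    rw [coordD_comp_smul_sub a t x₀ hL] at h2
    refine h2.trans ?_
    funext x
    simp only [Pi.smul_apply, smul_smul, List.length_cons, listD_cons]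
    rw [pow_succ, mul_assoc]

theorem classGrad_rescale (j : ℕ) (c t : ℝ) (x₀ : E d) {u : E d → E d} (hu : ContDiff ℝ ∞ u)
    (x : E d) : classGrad j (fun x => c • u (t • (x - x₀))) x
      = (c * t ^ j) • classGrad j u (t • (x - x₀)) := by
  ext i k
  simp [classGrad, listD_rescale _ c t x₀ hu]

theorem listD_congr_nhds {F : Type*} [NormedAddCommGroup F] [NormedSpace ℝ F] (L : List (Fin d))
    {u v : E d → F} {x : E d} (h : u =ᶠ[𝓝 x] v) : listD L u =ᶠ[𝓝 x] listD L v := by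
  induction L with
  | nil => exact h
  | cons a L ih =>
    filter_upwards [ih.fderiv (𝕜 := ℝ)] with y hy
    simp [coordD, hy]

/-- A wave in the direction of a coordinate axis. -/
noncomputable def planeWave (a : Fin d) (n θ : ℝ) (x : E d) : E d :=
  Real.sin (n * x a + θ) • EuclideanSpace.single a (1 : ℝ)

theorem contDiff_planeWave (a : Fin d) (n θ : ℝ) : ContDiff ℝ ∞ (planeWave a n θ) := by
  unfold planeWave
  have h : ContDiff ℝ ∞ fun x : E d => x a := (EuclideanSpace.proj (𝕜 := ℝ) a).contDiff
  exact (Real.contDiff_sin.comp ((contDiff_const.mul h).add contDiff_const)).smul contDiff_const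

theorem coordD_planeWave (a b : Fin d) (n θ : ℝ) : coordD b (planeWave a n θ)
    = (if b = a then n else 0) • planeWave a n (θ + Real.pi / 2) := by
  funext x
  have h1 : HasFDerivAt (fun x : E d => n * x a + θ) (n • (EuclideanSpace.proj (𝕜 := ℝ) a)) x :=
    ((EuclideanSpace.proj (𝕜 := ℝ) a).hasFDerivAt.const_mul n).add_const θ
  have h2 := (h1.sin.smul_const (EuclideanSpace.single a (1 : ℝ) : E d)).fderiv
  change fderiv ℝ (fun x => Real.sin (n * x a + θ) • EuclideanSpace.single a (1 : ℝ)) x _ = _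
  rw [h2]
  by_cases hb : b = a
  · subst hb
    simp [planeWave, ← add_assoc, Real.sin_add_pi_div_two, smul_smul, mul_comm]
  · simp [hb, Ne.symm hb]

/-- Each derivative along the wave shifts the phase by π/2 and produces a factor n; a derivative in
any other direction annihilates it. -/
theorem listD_planeWave (a : Fin d) (L : List (Fin d)) (n θ : ℝ) : listD L (planeWave a n θ)
    = (if ∀ b ∈ L, b = a then n ^ L.length else 0)
      • planeWave a n (θ + L.length * (Real.pi / 2)) := by
  induction L with
  | nil => simp
  | cons b L ih =>
    rw [listD_cons, ih, coordD_const_smul _ _ (contDiff_planeWave _ _ _), coordD_planeWave,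
      smul_smul]
    congr 1
    · by_cases h1 : b = a <;> by_cases h2 : ∀ c ∈ L, c = a <;> simp [h1, h2, pow_succ]
    · rw [List.length_cons]
      push_cast
      congr 1
      ring

theorem enorm_classGrad_planeWave_le (a : Fin d) (k : ℕ) {n : ℝ} (hn : 0 ≤ n) (θ : ℝ) (x : E d) :
    ‖classGrad k (planeWave a n θ) x‖ₑ
      ≤ (Fintype.card (Fin k → Fin d)) * ENNReal.ofReal n ^ k := by
  have h : ‖classGrad k (planeWave a n θ) x‖
      ≤ ∑ i : Fin k → Fin d, ‖classGrad k (planeWave a n θ) x i‖ := piLp_norm_le_sum _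
  have h2 : ∀ i, ‖classGrad k (planeWave a n θ) x i‖ ≤ n ^ k := by
    intro i
    simp only [classGrad, listD_planeWave, Pi.smul_apply, List.length_ofFn]
    rw [norm_smul, planeWave, norm_smul]
    have h3 : ‖Real.sin (n * x a + (θ + k * (Real.pi / 2)))‖ ≤ 1 := Real.abs_sin_le_one _
    have h4 : ‖if ∀ b ∈ List.ofFn i, b = a then n ^ k else 0‖ ≤ n ^ k := by
      split_ifs
      · rw [Real.norm_of_nonneg (by positivity)]
      · simp [pow_nonneg hn]
    simp only [PiLp.norm_single, norm_one, mul_one]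
    exact (mul_le_mul h4 h3 (norm_nonneg _) (by positivity)).trans (mul_one _).le
  rw [← ofReal_norm, ← ENNReal.ofReal_pow hn, ← ENNReal.ofReal_natCast,
    ← ENNReal.ofReal_mul (by positivity)]
  refine ENNReal.ofReal_le_ofReal (h.trans ((Finset.sum_le_sum fun i _ => h2 i).trans ?_))
  simp

theorem classGrad_planeWave_apply (a : Fin d) (k : ℕ) (n θ : ℝ) (x : E d) :
    classGrad k (planeWave a n θ) x (fun _ => a)
      = n ^ k • planeWave a n (θ + k * (Real.pi / 2)) x := by
  simp [classGrad, listD_planeWave]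

/-- A smooth compactly supported field whose gradient of order `m` does not vanish. -/
theorem exists_contDiff_classGrad_ne_zero (hd : 1 ≤ d) (m : ℕ) : ∃ u : E d → E d,
    ContDiff ℝ ∞ u ∧ tsupport u ⊆ Metric.closedBall 0 1 ∧ classGrad m u 0 ≠ 0 := by
  let a : Fin d := ⟨0, hd⟩
  let φ : ContDiffBump (0 : E d) := ⟨1 / 2, 1, by norm_num, by norm_num⟩
  -- The phase is chosen such that the derivative of order m along the axis equals sin(π/2) = 1 at
  -- the origin.
  let w : E d → E d := planeWave a 1 (Real.pi / 2 - m * (Real.pi / 2))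
  refine ⟨fun x => φ x • w x, φ.contDiff.smul (contDiff_planeWave _ _ _), ?_, ?_⟩
  · refine (closure_mono (Function.support_smul_subset_left φ w)).trans ?_
    change tsupport φ ⊆ _
    rw [φ.tsupport_eq]
  · intro h0
    have hloc : (fun x => φ x • w x) =ᶠ[𝓝 0] w := by
      filter_upwards [φ.eventuallyEq_one] with x hx
      simp [hx]
    have h1 : classGrad m w 0 = 0 := by
      rw [← h0]
      ext i k
      simp only [classGrad]
      rw [(listD_congr_nhds _ hloc).self_of_nhds]
    have h2 := classGrad_planeWave_apply a m 1 (Real.pi / 2 - m * (Real.pi / 2)) (0 : E d)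
    rw [show classGrad m (planeWave a 1 (Real.pi / 2 - m * (Real.pi / 2))) (0 : E d) = 0 from h1]
      at h2
    have h3 := congrFun (congrArg WithLp.ofLp h2) a
    simp [planeWave] at h3

end TestFields

/-! ### A compact embedding forces m ≤ ℓ -/

section NecessaryConditions

variable {d : ℕ} {Ω : Set (E d)}

theorem memLp_of_continuous {F : Type*} [NormedAddCommGroup F] {f : E d → F}
    (hf : Continuous f) (hb : Bornology.IsBounded Ω) (p : ℝ≥0∞) :
    MemLp f p (volume.restrict Ω) := by
  obtain ⟨C, hC⟩ := hb.isCompact_closure.exists_bound_of_continuousOn hf.continuousOn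
  have : IsFiniteMeasure (volume.restrict Ω) :=
    ⟨by simpa using hb.measure_lt_top⟩
  have h : ∀ᵐ x ∂volume.restrict (closure Ω), ‖f x‖ ≤ C :=
    (ae_restrict_iff' isClosed_closure.measurableSet).2 (ae_of_all _ hC)
  exact MemLp.of_bound hf.aestronglyMeasurable C (ae_restrict_of_ae_restrict_of_subset
    subset_closure h)

theorem weakGrad_ae_eq_classGrad (hΩ : IsOpen Ω) (j : ℕ) {f : E d → E d} (hf : ContDiff ℝ ∞ f)
    {u : E d → E d} (hu : u =ᵐ[volume.restrict Ω] f) :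
    weakGrad Ω j u =ᵐ[volume.restrict Ω] classGrad j f :=
  weakGrad_ae_eq hΩ ((isWeakGrad_of_contDiff j hf).congr hu.symm)

theorem mem_sobolev_of_contDiff (hb : Bornology.IsBounded Ω) {f : E d → E d}
    (hf : ContDiff ℝ ∞ f) {u : VField Ω} (hu : u =ᵐ[volume.restrict Ω] f) (k : ℕ) (p : ℝ≥0∞) :
    u ∈ sobolev Ω k p := fun j _ =>
  ⟨classGrad j f, (isWeakGrad_of_contDiff j hf).congr hu.symm,
    memLp_of_continuous (continuous_classGrad j hf) hb p⟩

theorem gradNorm_le_sobNorm {k j : ℕ} (hj : j ≤ k) (p : ℝ≥0∞) (u : VField Ω) :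
    gradNorm Ω j p u ≤ sobNorm Ω k p u :=
  Finset.single_le_sum (f := fun j => gradNorm Ω j p u) (fun _ _ => zero_le)
    (Finset.mem_range.2 (Nat.lt_succ_of_le hj))

theorem isWeakGrad_of_mem_sobolev {k j : ℕ} (hj : j ≤ k) {p : ℝ≥0∞} {u : VField Ω}
    (hu : u ∈ sobolev Ω k p) : IsWeakGrad Ω j u (weakGrad Ω j u) := by
  obtain ⟨U, hU, -⟩ := hu j hj
  exact isWeakGrad_weakGrad hU

theorem memLp_weakGrad (hΩ : IsOpen Ω) {k j : ℕ} (hj : j ≤ k) {p : ℝ≥0∞} {u : VField Ω}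
    (hu : u ∈ sobolev Ω k p) : MemLp (weakGrad Ω j u) p (volume.restrict Ω) := by
  obtain ⟨U, hU, hp⟩ := hu j hj
  exact (memLp_congr_ae (weakGrad_ae_eq hΩ hU)).2 hp

theorem weakGrad_sub_ae_eq (hΩ : IsOpen Ω) {j : ℕ} {u v : VField Ω}
    {U V : E d → GradVal d j} (hu : IsWeakGrad Ω j u U) (hv : IsWeakGrad Ω j v V) :
    weakGrad Ω j ((u - v : VField Ω) : E d → E d) =ᵐ[volume.restrict Ω] U - V :=
  weakGrad_ae_eq hΩ ((hu.sub hv).congr (AEEqFun.coeFn_sub u v).symm)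

/-- The conclusion of a compact embedding for a sequence of smooth fields. -/
theorem CompactEmbedding.exists_tendsto {ℓ m : ℕ} {q r : ℝ≥0∞}
    (h : CompactEmbedding Ω ℓ q m r) (hΩ : IsOpen Ω) (hb : Bornology.IsBounded Ω)
    {f : ℕ → E d → E d} (hf : ∀ n, ContDiff ℝ ∞ (f n)) {M : ℕ → ℝ≥0∞} (hM : ∀ k, M k ≠ ⊤)
    (hfM : ∀ k ≤ ℓ, ∀ n, eLpNorm (classGrad k (f n)) q (volume.restrict Ω) ≤ M k) :
    ∃ σ : ℕ → ℕ, StrictMono σ ∧ ∃ W : E d → GradVal d m, MemLp W r (volume.restrict Ω) ∧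
      Tendsto (fun n => eLpNorm (classGrad m (f (σ n)) - W) r (volume.restrict Ω)) atTop
        (𝓝 0) := by
  let u : ℕ → VField Ω := fun n => AEEqFun.mk (f n) (hf n).continuous.aestronglyMeasurable
  have hu : ∀ n, u n =ᵐ[volume.restrict Ω] f n := fun n => AEEqFun.coeFn_mk _ _
  obtain ⟨σ, hσ, w, hw, hlim⟩ := h.2 u (fun n => mem_sobolev_of_contDiff hb (hf n) (hu n) ℓ q)
    ⟨∑ k ∈ Finset.range (ℓ + 1), M k, by simp [hM], fun n => Finset.sum_le_sum fun k hk => by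
      rw [gradNorm, eLpNorm_congr_ae (weakGrad_ae_eq_classGrad hΩ k (hf n) (hu n))]
      exact hfM k (Nat.lt_succ_iff.1 (Finset.mem_range.1 hk)) n⟩
  refine ⟨σ, hσ, weakGrad Ω m w, memLp_weakGrad hΩ le_rfl hw, ?_⟩
  refine tendsto_of_tendsto_of_tendsto_of_le_of_le tendsto_const_nhds hlim
    (fun _ => zero_le) fun n => ?_
  have h1 := weakGrad_sub_ae_eq hΩ ((isWeakGrad_of_contDiff m (hf (σ n))).congr (hu (σ n)).symm)
    (isWeakGrad_of_mem_sobolev le_rfl hw)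
  refine le_trans (le_of_eq ?_) (gradNorm_le_sobNorm le_rfl r _)
  rw [gradNorm, eLpNorm_congr_ae h1]

/-- Plane waves of frequency t and amplitude t^(−ℓ) are bounded in the first space. If m > ℓ, the L¹
norms of their gradients of order m grow at least like t, so no subsequence can converge in the
second space. -/
theorem CompactEmbedding.le_of_isOpen {ℓ m : ℕ} {q r : ℝ} (hr : 1 ≤ r)
    (h : CompactEmbedding Ω ℓ (ENNReal.ofReal q) m (ENNReal.ofReal r)) (hd : 1 ≤ d)
    (hΩ : IsOpen Ω) (hb : Bornology.IsBounded Ω) (hne : Ω.Nonempty) : m ≤ ℓ := by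
  by_contra! hlm
  let a : Fin d := ⟨0, hd⟩
  have hμ : volume Ω ≠ ⊤ := hb.measure_lt_top.ne
  have hμ0 : volume Ω ≠ 0 := hΩ.measure_ne_zero volume hne
  have : IsFiniteMeasure (volume.restrict Ω) := ⟨by simpa using hb.measure_lt_top⟩
  -- Since |sin| + |cos| ≥ 1, one of the phases 0 and π/2 does; this avoids any asymptotics of
  -- oscillating integrals.
  have hsc : ∀ n : ℝ, ∃ θ, volume Ω / 2 ≤ ∫⁻ x in Ω, ‖Real.sin (n * x a + θ)‖ₑ := by
    intro n
    have hx : Continuous fun x : E d => n * x a := by fun_prop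
    have hsum : volume Ω ≤ (∫⁻ x in Ω, ‖Real.sin (n * x a + 0)‖ₑ)
        + ∫⁻ x in Ω, ‖Real.sin (n * x a + Real.pi / 2)‖ₑ := by
      rw [← lintegral_add_left (by fun_prop)]
      calc volume Ω = ∫⁻ x in Ω, 1 := by simp
        _ ≤ _ := by
          refine lintegral_mono fun x => ?_
          rw [add_zero, Real.sin_add_pi_div_two, ← ofReal_norm, ← ofReal_norm,
            ← ENNReal.ofReal_add (norm_nonneg _) (norm_nonneg _), ENNReal.one_le_ofReal]
          have h1 := Real.sin_sq_add_cos_sq (n * x a)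
          have h2 := Real.abs_sin_le_one (n * x a)
          have h3 := Real.abs_cos_le_one (n * x a)
          rw [Real.norm_eq_abs, Real.norm_eq_abs]
          rw [← sq_abs (Real.sin _), ← sq_abs (Real.cos _)] at h1
          nlinarith [abs_nonneg (Real.sin (n * x a)), abs_nonneg (Real.cos (n * x a))]
    by_contra! hcon
    have := ENNReal.add_lt_add (hcon 0) (hcon (Real.pi / 2))
    rw [ENNReal.add_halves] at this
    exact absurd hsum this.not_ge
  choose θ hθ using hsc
  let t : ℕ → ℝ := fun n => n + 1
  have ht : ∀ n, 1 ≤ t n := fun n => by simp [t]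
  have ht0 : ∀ n, 0 < t n := fun n => one_pos.trans_le (ht n)
  -- The phase is shifted back by mπ/2 in advance, because m derivatives shift it forward by that
  -- amount.
  let w : ℕ → E d → E d := fun n => planeWave a (t n) (θ (t n) - m * (Real.pi / 2))
  let f : ℕ → E d → E d := fun n x => ((t n) ^ ℓ)⁻¹ • w n x
  have hw : ∀ n, ContDiff ℝ ∞ (w n) := fun n => contDiff_planeWave _ _ _
  have hf : ∀ n, ContDiff ℝ ∞ (f n) := fun n => (hw n).const_smul _
  have hgrad : ∀ k n x, classGrad k (f n) x = ((t n) ^ ℓ)⁻¹ • classGrad k (w n) x := by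
    intro k n x
    have := classGrad_rescale k ((t n) ^ ℓ)⁻¹ 1 (0 : E d) (hw n) x
    simpa only [one_smul, sub_zero, one_pow, mul_one] using this
  obtain ⟨σ, hσ, W, hW, hlim⟩ := h.exists_tendsto hΩ hb hf
    (M := fun k => Fintype.card (Fin k → Fin d) * volume Ω ^ ((ENNReal.ofReal q).toReal)⁻¹)
    (fun k => by finiteness) (by
      intro k hk n
      refine (eLpNorm_le_of_ae_enorm_bound (C := Fintype.card (Fin k → Fin d))
        (ae_of_all _ fun x => ?_)).trans (le_of_eq ?_)
      · rw [hgrad, enorm_smul]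
        refine (mul_le_mul_right (enorm_classGrad_planeWave_le a k (ht0 n).le _ x) _).trans ?_
        rw [mul_left_comm, ← ofReal_norm, Real.norm_of_nonneg (by have := ht0 n; positivity),
          ← ENNReal.ofReal_pow (ht0 n).le, ← ENNReal.ofReal_mul (by have := ht0 n; positivity)]
        refine mul_le_of_le_one_right' (ENNReal.ofReal_le_one.2 ?_)
        rw [inv_mul_le_iff₀ (pow_pos (ht0 n) _), mul_one]
        exact pow_le_pow_right₀ (ht n) hk
      · rw [Measure.restrict_apply_univ, smul_eq_mul])
  set B := (1 + eLpNorm W (ENNReal.ofReal r) (volume.restrict Ω)) *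
    volume Ω ^ (1 - 1 / r) with hB
  have hBtop : B ≠ ⊤ := by
    have := hW.2.ne
    have hr1 : 0 ≤ 1 - 1 / r := by
      rw [sub_nonneg, div_le_one (by linarith)]
      exact hr
    finiteness
  have hlow : ∀ n, ENNReal.ofReal (t n) * (volume Ω / 2)
      ≤ ∫⁻ x in Ω, ‖classGrad m (f n) x‖ₑ := by
    intro n
    refine (mul_le_mul_right (hθ (t n)) _).trans ?_
    rw [← lintegral_const_mul' _ _ ENNReal.ofReal_ne_top]
    refine lintegral_mono fun x => ?_
    refine le_trans ?_ (enorm_gradVal_apply_le _ (fun _ => a) a)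
    rw [hgrad]
    change _ ≤ ‖(((t n) ^ ℓ)⁻¹ • classGrad m (w n) x (fun _ => a)) a‖ₑ
    rw [classGrad_planeWave_apply, sub_add_cancel, smul_smul, PiLp.smul_apply, planeWave,
      PiLp.smul_apply, PiLp.single_apply, if_pos rfl, smul_eq_mul, smul_eq_mul, mul_one, enorm_mul]
    gcongr
    rw [← ofReal_norm, Real.norm_of_nonneg (by have := ht0 n; positivity)]
    refine ENNReal.ofReal_le_ofReal ?_
    rw [le_inv_mul_iff₀ (pow_pos (ht0 n) _), ← pow_succ]
    exact pow_le_pow_right₀ (ht n) hlm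
  -- Convergence along σ bounds the L¹ norms; since σ n ≥ n, the lower bound for the frequency t (σ
  -- n) is at least that for t n.
  have hup : ∀ᶠ n in atTop, ENNReal.ofReal (t n) * (volume Ω / 2) ≤ B := by
    filter_upwards [hlim.eventually_lt_const one_pos] with n hn
    have h1 : ∫⁻ x in Ω, ‖classGrad m (f (σ n)) x‖ₑ ≤ B := by
      rw [← eLpNorm_one_eq_lintegral_enorm]
      have hmeas := (continuous_classGrad m (hf (σ n))).aestronglyMeasurable
        (μ := volume.restrict Ω)
      refine (eLpNorm_le_eLpNorm_mul_rpow_measure_univ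
        (ENNReal.one_le_ofReal.2 hr) hmeas).trans ?_
      rw [Measure.restrict_apply_univ, ENNReal.toReal_one,
        ENNReal.toReal_ofReal (by linarith), div_one]
      refine mul_le_mul_left ?_ _
      have := eLpNorm_add_le (hmeas.sub hW.1) hW.1 (p := ENNReal.ofReal r)
        (ENNReal.one_le_ofReal.2 hr)
      rw [sub_add_cancel] at this
      exact this.trans (add_le_add hn.le le_rfl)
    refine le_trans ?_ ((hlow (σ n)).trans h1)
    gcongr
    simp only [t]
    gcongr
    exact hσ.id_le n
  have hdiv : Tendsto (fun n => ENNReal.ofReal (t n) * (volume Ω / 2)) atTop (𝓝 ⊤) := by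
    have h1 : Tendsto (fun n => ENNReal.ofReal (t n)) atTop (𝓝 ⊤) :=
      ENNReal.tendsto_ofReal_atTop.comp (tendsto_atTop_add_const_right _ 1
        tendsto_natCast_atTop_atTop)
    have h2 := ENNReal.Tendsto.mul_const h1 (b := volume Ω / 2) (Or.inl ENNReal.top_ne_zero)
    rwa [ENNReal.top_mul (by simp [hμ0])] at h2
  obtain ⟨n, h1, h2⟩ := (hup.and (hdiv.eventually_const_lt hBtop.lt_top)).exists
  exact absurd h1 h2.not_ge

end NecessaryConditions

/-! ### A compact embedding is strictly subcritical -/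

section Concentration

variable {d : ℕ} {Ω : Set (E d)}

theorem classGrad_eq_zero_of_notMem_tsupport (j : ℕ) {u : E d → E d} {x : E d}
    (hx : x ∉ tsupport u) : classGrad j u x = 0 := by
  ext i k
  have h : x ∉ tsupport (listD (List.ofFn i) u) := fun h => hx (tsupport_listD_subset _ u h)
  simp [classGrad, image_eq_zero_of_notMem_tsupport h]

theorem eLpNorm_comp_smul_sub {F : Type*} [NormedAddCommGroup F] {G : E d → F}
    (hG : Continuous G) {p : ℝ} (hp : 0 < p) (x₀ : E d) {t : ℝ} (ht : 0 < t) :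
    eLpNorm (fun x => G (t • (x - x₀))) (ENNReal.ofReal p) volume
      = ENNReal.ofReal t ^ (-(d / p)) * eLpNorm G (ENNReal.ofReal p) volume := by
  have hp0 : ENNReal.ofReal p ≠ 0 := by simpa using hp
  rw [eLpNorm_eq_lintegral_rpow_enorm_toReal hp0 ENNReal.ofReal_ne_top,
    eLpNorm_eq_lintegral_rpow_enorm_toReal hp0 ENNReal.ofReal_ne_top, ENNReal.toReal_ofReal hp.le]
  have h := lintegral_comp_add_smul (-(t • x₀)) ht (G := fun x => ‖G x‖ₑ ^ p)
    (hG.enorm.measurable.pow_const p)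
  have h2 : ∀ x : E d, t • (x - x₀) = -(t • x₀) + t • x := fun x => by
    rw [smul_sub]
    abel
  simp only [h2]
  rw [h, ENNReal.mul_rpow_of_nonneg _ _ (by positivity), ← ENNReal.rpow_mul]
  congr 2
  ring

/-- The compactness of the embedding excludes the concentration of bounded sequences. -/
theorem CompactEmbedding.lt_of_lt {ℓ m : ℕ} {q r : ℝ} (hq : 1 ≤ q) (hqr : q < r) (hml : m ≤ ℓ)
    (h : CompactEmbedding Ω ℓ (ENNReal.ofReal q) m (ENNReal.ofReal r)) (hd : 1 ≤ d)
    (hΩ : IsOpen Ω) (hb : Bornology.IsBounded Ω) (hne : Ω.Nonempty) :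
    d * (1 / q - 1 / r) < (ℓ - m : ℕ) := by
  by_contra! hcrit
  rw [Nat.cast_sub hml] at hcrit
  have hq0 : 0 < q := by linarith
  have hr0 : 0 < r := by linarith
  obtain ⟨x₀, hx₀⟩ := hne
  obtain ⟨δ', hδ', hball⟩ := Metric.isOpen_iff.1 hΩ x₀ hx₀
  set δ := min (δ' / 2) 1 with hδ
  have hδ0 : 0 < δ := by positivity
  have hδΩ : Metric.closedBall x₀ δ ⊆ Ω := by
    refine (Metric.closedBall_subset_ball ?_).trans hball
    have := min_le_left (δ' / 2) 1
    linarith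
  obtain ⟨g, hg, hgs, hg0⟩ := exists_contDiff_classGrad_ne_zero hd m
  have hcomp : HasCompactSupport g :=
    (isCompact_closedBall (0 : E d) 1).of_isClosed_subset (isClosed_tsupport g) hgs
  let N : ℕ → ℝ → ℝ≥0∞ := fun k p => eLpNorm (classGrad k g) (ENNReal.ofReal p) volume
  have hN : ∀ k p, N k p ≠ ⊤ := fun k p =>
    ((continuous_classGrad k hg).memLp_of_hasCompactSupport
      (HasCompactSupport.of_support_subset_isCompact hcomp fun x hx => by
        by_contra hx'
        exact hx (classGrad_eq_zero_of_notMem_tsupport k hx'))).2.ne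
  have hN0 : N m r ≠ 0 := by
    intro h0
    rw [eLpNorm_eq_zero_iff (continuous_classGrad m hg).aestronglyMeasurable
      (by simpa using hr0)] at h0
    have h1 := (Continuous.ae_eq_iff_eq volume (continuous_classGrad m hg)
      continuous_zero).1 h0
    exact hg0 (congrFun h1 0)
  let t : ℕ → ℝ := fun n => (n + 1) / δ
  have ht : ∀ n, 1 ≤ t n := fun n => by
    rw [one_le_div hδ0]
    have := min_le_right (δ' / 2) 1
    have : (0 : ℝ) ≤ n := n.cast_nonneg
    linarith
  have ht0 : ∀ n, 0 < t n := fun n => one_pos.trans_le (ht n)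
  -- The amplitude keeps the L^q norm of the gradient of order ℓ fixed under concentration, and
  -- lower orders bounded since t ≥ 1. The L^r norm of the gradient of order m then scales like t to
  -- the power d(1/q − 1/r) − (ℓ − m), which is nonnegative by assumption.
  let c : ℕ → ℝ := fun n => t n ^ (d / q - ℓ)
  let f : ℕ → E d → E d := fun n x => c n • g (t n • (x - x₀))
  have hf : ∀ n, ContDiff ℝ ∞ (f n) := fun n => by
    have h1 : ContDiff ℝ ∞ fun x : E d => t n • (x - x₀) := by fun_prop
    exact (hg.comp h1).const_smul (c n)
  have hgrad : ∀ k n x, classGrad k (f n) x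
      = (c n * t n ^ k) • classGrad k g (t n • (x - x₀)) :=
    fun k n x => classGrad_rescale k (c n) (t n) x₀ hg x
  have hout : ∀ k n x, 1 < t n * dist x x₀ → classGrad k (f n) x = 0 := by
    intro k n x hx
    rw [hgrad, classGrad_eq_zero_of_notMem_tsupport, smul_zero]
    intro hmem
    have := hgs hmem
    rw [mem_closedBall_zero_iff, norm_smul, Real.norm_of_nonneg (ht0 n).le, ← dist_eq_norm] at this
    linarith
  have hnorm : ∀ k p n, 0 < p → eLpNorm (classGrad k (f n)) (ENNReal.ofReal p) volume
      = ENNReal.ofReal (t n) ^ (d / q - ℓ + k - d / p) * N k p := by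
    intro k p n hp
    have h0 : ENNReal.ofReal (t n) ≠ 0 := by simpa using ht0 n
    have h1 : classGrad k (f n)
        = (c n * t n ^ k) • fun x => classGrad k g (t n • (x - x₀)) := funext fun x => hgrad k n x
    rw [h1, eLpNorm_const_smul, eLpNorm_comp_smul_sub (continuous_classGrad k hg) hp x₀ (ht0 n),
      ← mul_assoc, ← ofReal_norm, Real.norm_of_nonneg (by have := ht0 n; positivity)]
    congr 1
    rw [ENNReal.ofReal_mul (by have := ht0 n; positivity), ← Real.rpow_natCast,
      ← ENNReal.ofReal_rpow_of_pos (ht0 n), ← ENNReal.ofReal_rpow_of_pos (ht0 n),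
      ← ENNReal.rpow_add _ _ h0 ENNReal.ofReal_ne_top,
      ← ENNReal.rpow_add _ _ h0 ENNReal.ofReal_ne_top]
    rfl
  obtain ⟨σ, hσ, W, hW, hlim⟩ := h.exists_tendsto hΩ hb hf (M := fun k => N k q)
    (fun k => hN k q) (by
      intro k hk n
      refine (eLpNorm_mono_measure _ Measure.restrict_le_self).trans ?_
      rw [hnorm k q n hq0]
      refine mul_le_of_le_one_left' ((ENNReal.rpow_le_rpow_of_exponent_le
        (ENNReal.one_le_ofReal.2 (ht n)) (z := 0) ?_).trans_eq ENNReal.rpow_zero)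
      have : (k : ℝ) ≤ ℓ := by exact_mod_cast hk
      linarith)
  have hσt : Tendsto (fun n => t (σ n)) atTop atTop := by
    have h1 : Tendsto t atTop atTop := Tendsto.atTop_div_const hδ0
      (tendsto_atTop_add_const_right _ 1 tendsto_natCast_atTop_atTop)
    exact h1.comp hσ.tendsto_atTop
  -- Outside any fixed ball about x₀ the fields eventually vanish, hence so does the limit; a single
  -- point being null, the limit is zero, against the lower bound on the norms.
  have hWε : ∀ k : ℕ, ∀ᵐ x ∂volume.restrict Ω, 1 / ((k : ℝ) + 1) < dist x x₀ → W x = 0 := by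
    intro k
    set A : Set (E d) := {x | 1 / ((k : ℝ) + 1) < dist x x₀} with hA
    have hAm : MeasurableSet A := (isOpen_lt continuous_const (by fun_prop)).measurableSet
    refine (ae_restrict_iff' hAm).1 ?_
    have h0 : eLpNorm W (ENNReal.ofReal r) ((volume.restrict Ω).restrict A) = 0 := by
      refine le_antisymm (ge_of_tendsto hlim ?_) zero_le
      filter_upwards [hσt.eventually_ge_atTop ((k : ℝ) + 1)] with n hn
      refine le_trans (le_of_eq ?_) (eLpNorm_mono_measure _
        (Measure.restrict_le_self (s := A)))
      rw [← eLpNorm_neg]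
      refine eLpNorm_congr_ae ?_
      filter_upwards [ae_restrict_mem hAm] with x hx
      rw [Pi.sub_apply, hout m (σ n) x, zero_sub, Pi.neg_apply]
      have hx' : 1 / ((k : ℝ) + 1) < dist x x₀ := hx
      rw [div_lt_iff₀ (by positivity)] at hx'
      have := dist_nonneg (x := x) (y := x₀)
      nlinarith
    exact (eLpNorm_eq_zero_iff hW.1.restrict (by simpa using hr0)).1 h0
  have hW0 : W =ᵐ[volume.restrict Ω] 0 := by
    have hx : ∀ᵐ x ∂volume.restrict Ω, x ≠ x₀ := by
      refine ae_restrict_of_ae ?_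
      have := measure_simplex_eq_zero (s := {x₀}) (by simpa using hd)
      rw [ae_iff]
      simpa [simplex] using this
    filter_upwards [ae_all_iff.2 hWε, hx] with x h1 h2
    obtain ⟨k, hk⟩ := exists_nat_one_div_lt (dist_pos.2 h2)
    exact h1 k hk
  have hlow : ∀ n, N m r ≤ eLpNorm (classGrad m (f n) - W) (ENNReal.ofReal r)
      (volume.restrict Ω) := by
    intro n
    have h1 : classGrad m (f n) - W =ᵐ[volume.restrict Ω] classGrad m (f n) := by
      filter_upwards [hW0] with x hx
      rw [Pi.sub_apply, hx, Pi.zero_apply, sub_zero]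
    rw [eLpNorm_congr_ae h1, eLpNorm_restrict_eq_of_support_subset, hnorm m r n hr0]
    · refine le_mul_of_one_le_left' (ENNReal.rpow_zero.symm.trans_le
        (ENNReal.rpow_le_rpow_of_exponent_le (ENNReal.one_le_ofReal.2 (ht n)) ?_))
      have : d * (1 / q - 1 / r) = d / q - d / r := by ring
      linarith
    · intro x hx
      refine hδΩ ?_
      by_contra hx'
      refine hx (hout m n x ?_)
      rw [Metric.mem_closedBall, not_le] at hx'
      have h2 : t n * δ = n + 1 := div_mul_cancel₀ _ hδ0.ne'
      have h3 : (0 : ℝ) ≤ n := n.cast_nonneg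
      have h4 := mul_lt_mul_of_pos_left hx' (ht0 n)
      linarith
  exact hN0 (le_antisymm (ge_of_tendsto' hlim fun n => hlow (σ n)) zero_le)

end Concentration

theorem lpN_eq_eLpNorm {d : ℕ} {F : Type*} [NormedAddCommGroup F] (D : Set (E d)) {r : ℝ}
    (hr : 0 < r) (f : E d → F) :
    lpN D r f = eLpNorm f (ENNReal.ofReal r) (volume.restrict D) := by
  rw [eLpNorm_eq_lintegral_rpow_enorm_toReal (by simpa using hr) ENNReal.ofReal_ne_top,
    ENNReal.toReal_ofReal hr.le, lpN]

/-! ### The error estimate on a single cell -/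

namespace Triangulation

variable {d : ℕ} {Ω : Set (E d)} (T : Triangulation Ω)

theorem le_measure_simplex {a : ℝ} (ha0 : 0 < a) (ha : T.IsRegular a) (hh : 0 < T.meshSize)
    {s : Finset (E d)} (hs : s ∈ T.cells) :
    ENNReal.ofReal T.meshSize ^ (d : ℝ) *
      (ENNReal.ofReal a ^ (d : ℝ) * volume (Metric.ball (0 : E d) 1)) ≤ volume (simplex s) := by
  have h := T.card_mul_measure_ball_le ha {s} (by simpa using hs) (A := simplex s)
    (by simpa using interior_subset)
  rw [Finset.card_singleton, Nat.cast_one, one_mul,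
    Measure.addHaar_ball_of_pos volume _ (show 0 < a * T.meshSize by positivity),
    finrank_euclideanSpace_fin] at h
  refine le_trans (le_of_eq ?_) h
  rw [ENNReal.ofReal_pow (by positivity), ENNReal.ofReal_mul ha0.le, mul_pow, ENNReal.rpow_natCast,
    ENNReal.rpow_natCast]
  ring

theorem card_cells_mul_le (hΩ : IsOpen Ω) (hL : HasLipschitzBoundary Ω) {a : ℝ} (ha0 : 0 < a)
    (ha : T.IsRegular a) (hh : 0 < T.meshSize) :
    T.finite_cells.toFinset.card * (ENNReal.ofReal T.meshSize ^ (d : ℝ) *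
      (ENNReal.ofReal a ^ (d : ℝ) * volume (Metric.ball (0 : E d) 1))) ≤ volume Ω := by
  refine le_trans (le_of_eq ?_) (T.card_mul_measure_ball_le ha T.finite_cells.toFinset
    (by simp) (A := Ω) (fun s hs => T.interior_simplex_subset hΩ hL (by simpa using hs)))
  rw [Measure.addHaar_ball_of_pos volume _ (show 0 < a * T.meshSize by positivity),
    finrank_euclideanSpace_fin,
    ENNReal.ofReal_pow (by positivity), ENNReal.ofReal_mul ha0.le, mul_pow, ENNReal.rpow_natCast,
    ENNReal.rpow_natCast]
  ring

/-- Nonnegative exponents use the upper bound on the volume of a cell, negative ones the lower bound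
from the inscribed ball. Both signs occur, since 1/r − 1/q has either. -/
theorem exists_measure_simplex_rpow_le (d : ℕ) {a : ℝ} (ha0 : 0 < a) (e : ℝ) :
    ∃ C : ℝ≥0∞, C ≠ ⊤ ∧ ∀ (Ω : Set (E d)) (T : Triangulation Ω), T.IsRegular a →
      0 < T.meshSize → ∀ s ∈ T.cells,
      volume (simplex s) ^ e ≤ C * ENNReal.ofReal T.meshSize ^ (d * e) := by
  set β := volume (Metric.ball (0 : E d) 1) with hβ
  have hβ0 : β ≠ 0 := (Metric.measure_ball_pos volume _ one_pos).ne'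
  have hβ1 : β ≠ ⊤ := measure_ball_lt_top.ne
  have ha : ENNReal.ofReal a ≠ 0 := by simpa using ha0
  rcases le_or_gt 0 e with he | he
  · refine ⟨β ^ e, by finiteness, fun Ω T _ hh s hs => ?_⟩
    refine (ENNReal.rpow_le_rpow (T.measure_simplex_le hh hs) he).trans (le_of_eq ?_)
    rw [ENNReal.mul_rpow_of_nonneg _ _ he, ← ENNReal.rpow_mul, mul_comm]
  · have hc0 : ENNReal.ofReal a ^ (d : ℝ) * β ≠ 0 :=
      mul_ne_zero (by simp [ha]) hβ0
    have hc1 : ENNReal.ofReal a ^ (d : ℝ) * β ≠ ⊤ := by finiteness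
    refine ⟨(ENNReal.ofReal a ^ (d : ℝ) * β) ^ e, ENNReal.rpow_ne_top_of_ne_zero hc0 hc1,
      fun Ω T hT hh s hs => ?_⟩
    have h := T.le_measure_simplex ha0 hT hh hs
    have h2 : volume (simplex s) ^ e ≤ (ENNReal.ofReal T.meshSize ^ (d : ℝ) *
        (ENNReal.ofReal a ^ (d : ℝ) * β)) ^ e := by
      rw [← neg_neg e, ENNReal.rpow_neg, ENNReal.rpow_neg _ (-e)]
      exact ENNReal.inv_le_inv.2 (ENNReal.rpow_le_rpow h (by linarith))
    refine h2.trans (le_of_eq ?_)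
    rw [ENNReal.mul_rpow_of_ne_top (by finiteness) hc1, ← ENNReal.rpow_mul, mul_comm]

theorem measure_patch_le {a : ℝ} (ha0 : 0 < a) (ha : T.IsRegular a) (hh : 0 < T.meshSize)
    {s : Finset (E d)} (hs : s ∈ T.cells) :
    volume (T.patch s) ≤ ENNReal.ofReal ((2 / a) ^ d) *
      (ENNReal.ofReal T.meshSize ^ (d : ℝ) * volume (Metric.ball (0 : E d) 1)) := by
  rw [patch_eq_biUnion_touching]
  refine (measure_biUnion_finset_le _ _).trans ((Finset.sum_le_sum fun t ht =>
    T.measure_simplex_le hh (T.mem_touching.1 ht).1).trans ?_)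
  rw [Finset.sum_const, nsmul_eq_mul]
  gcongr
  rw [← ENNReal.ofReal_natCast]
  exact ENNReal.ofReal_le_ofReal (T.card_touching_le ha0 ha hh hs)

theorem exists_polyField_ae_eq (hΩ : IsOpen Ω) (hL : HasLipschitzBoundary Ω) {k : ℕ}
    {w : VField Ω} (hw : IsPiecewisePoly T k w) :
    ∃ R : Finset (E d) → Fin d → MvPolynomial (Fin d) ℝ, ∀ s ∈ T.cells,
      (∀ c, (R s c).totalDegree ≤ k) ∧
      w =ᵐ[volume.restrict (interior (simplex s))] polyField (R s) := by
  have h : ∀ s ∈ T.cells, ∃ R : Fin d → MvPolynomial (Fin d) ℝ, (∀ c, (R c).totalDegree ≤ k) ∧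
      w =ᵐ[volume.restrict (interior (simplex s))] polyField R := by
    intro s hs
    obtain ⟨p, hp, hwp⟩ := hw s hs
    obtain ⟨R, hR, rfl⟩ := isPolyField_iff.1 hp
    refine ⟨R, hR, ?_⟩
    filter_upwards [ae_restrict_of_ae_restrict_of_subset (T.interior_simplex_subset hΩ hL hs) hwp,
      ae_restrict_mem isOpen_interior.measurableSet] with x hx hxs
    exact hx (interior_subset hxs)
  choose! R hR using h
  exact ⟨R, hR⟩

theorem exists_isWeakGrad_interiors {w : E d → E d}
    {R : Finset (E d) → Fin d → MvPolynomial (Fin d) ℝ}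
    (hR : ∀ s ∈ T.cells, w =ᵐ[volume.restrict (interior (simplex s))] polyField (R s)) (j : ℕ) :
    ∃ W, IsWeakGrad T.interiors j w W ∧
      ∀ s ∈ T.cells, ∀ x ∈ interior (simplex s), W x = classGrad j (polyField (R s)) x := by
  have : Finite T.cells := T.finite_cells
  obtain ⟨W, hW, hW'⟩ := exists_isWeakGrad_iUnion
    (O := fun s : T.cells => interior (simplex (s : Finset (E d)))) (fun _ => isOpen_interior)
    (fun s t hst => T.disjoint_interior s.2 t.2 (fun h => hst (Subtype.ext h))) (j := j) (u := w)
    (V := fun s => classGrad j (polyField (R s)))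
    (fun s => (isWeakGrad_of_contDiff j (contDiff_polyField _)).congr (hR s s.2).symm)
  refine ⟨W, ?_, fun s hs x hx => hW' ⟨s, hs⟩ x hx⟩
  rwa [interiors, biUnion_eq_iUnion]

theorem interior_simplex_subset_interiors {s : Finset (E d)} (hs : s ∈ T.cells) :
    interior (simplex s) ⊆ T.interiors :=
  subset_biUnion_of_mem (u := fun s : Finset (E d) => interior (simplex s)) hs

/-- Gluing provides a weak gradient on the union of the open cells, and uniqueness identifies the
chosen one with the classical gradient of the polynomial on each cell. -/
theorem brokenGrad_ae_eq {w : VField Ω}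
    {R : Finset (E d) → Fin d → MvPolynomial (Fin d) ℝ}
    (hR : ∀ s ∈ T.cells, w =ᵐ[volume.restrict (interior (simplex s))] polyField (R s)) (j : ℕ)
    {s : Finset (E d)} (hs : s ∈ T.cells) : T.brokenGrad j w
      =ᵐ[volume.restrict (interior (simplex s))] classGrad j (polyField (R s)) := by
  obtain ⟨W, hW, hWR⟩ := T.exists_isWeakGrad_interiors hR j
  filter_upwards [ae_restrict_of_ae_restrict_of_subset (T.interior_simplex_subset_interiors hs)
    (weakGrad_ae_eq T.isOpen_interiors hW), ae_restrict_mem isOpen_interior.measurableSet]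
    with x h1 h2
  rw [brokenGrad, h1, hWR s hs x h2]

theorem brokenGrad_sub_ae_eq (hΩ : IsOpen Ω) (hL : HasLipschitzBoundary Ω) {v w : VField Ω}
    {j : ℕ} {V : E d → GradVal d j} (hV : IsWeakGrad Ω j v V)
    {R : Finset (E d) → Fin d → MvPolynomial (Fin d) ℝ}
    (hR : ∀ s ∈ T.cells, w =ᵐ[volume.restrict (interior (simplex s))] polyField (R s))
    {s : Finset (E d)} (hs : s ∈ T.cells) : T.brokenGrad j (v - w)
      =ᵐ[volume.restrict (interior (simplex s))]
        fun x => V x - classGrad j (polyField (R s)) x := by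
  obtain ⟨W, hW, hWR⟩ := T.exists_isWeakGrad_interiors hR j
  have h1 : IsWeakGrad T.interiors j ((v - w : VField Ω) : E d → E d) (V - W) :=
    ((hV.mono (T.interiors_subset hΩ hL)).sub hW).congr
      (ae_restrict_of_ae_restrict_of_subset (T.interiors_subset hΩ hL)
        (AEEqFun.coeFn_sub v w).symm)
  filter_upwards [ae_restrict_of_ae_restrict_of_subset (T.interior_simplex_subset_interiors hs)
    (weakGrad_ae_eq T.isOpen_interiors h1), ae_restrict_mem isOpen_interior.measurableSet]
    with x h1 h2
  rw [brokenGrad, h1, Pi.sub_apply, hWR s hs x h2]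

theorem integrableOn_patch (hΩ : IsOpen Ω) (hL : HasLipschitzBoundary Ω) {F : Type*}
    [NormedAddCommGroup F] {f : E d → F} (hf : IntegrableOn f Ω) (s : Finset (E d)) :
    IntegrableOn f (T.patch s) :=
  (hf.congr_set_ae (T.closure_ae_eq hΩ hL)).mono_set T.patch_subset

theorem ae_restrict_patch (hΩ : IsOpen Ω) (hL : HasLipschitzBoundary Ω) {p : E d → Prop}
    (h : ∀ᵐ x ∂volume.restrict Ω, p x) (s : Finset (E d)) :
    ∀ᵐ x ∂volume.restrict (T.patch s), p x := by
  rw [← Measure.restrict_congr_set (T.closure_ae_eq hΩ hL)] at h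
  exact ae_restrict_of_ae_restrict_of_subset T.patch_subset h

/-- The local stability, in terms of integrals. -/
theorem lintegral_brokenGrad_le (hd : 1 ≤ d) (hΩ : IsOpen Ω) (hL : HasLipschitzBoundary Ω)
    {a : ℝ} (ha0 : 0 < a) (ha : T.IsRegular a) (hh : 0 < T.meshSize) {ℓ₀ ℓ m k₁ : ℕ} {A : ℝ}
    {P : sobolev Ω ℓ₀ 1 →ₗ[ℝ] VField Ω} (hP : LocallyStable T P ℓ m A)
    {w : sobolev Ω ℓ₀ 1} (hw : (w : VField Ω) ∈ sobolev Ω ℓ 1)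
    (hpp : IsPiecewisePoly T k₁ (P w)) {j : ℕ} (hj : j ≤ m) {s : Finset (E d)}
    (hs : s ∈ T.cells) :
    ENNReal.ofReal (2 * a * T.meshSize) ^ j * ∫⁻ x in simplex s, ‖T.brokenGrad j (P w) x‖ₑ
      ≤ ENNReal.ofReal |A| * ∑ k ∈ Finset.range (ℓ + 1), ENNReal.ofReal T.meshSize ^ k *
        ∫⁻ x in T.patch s, ‖weakGrad Ω k (w : VField Ω) x‖ₑ := by
  obtain ⟨R, hR⟩ := T.exists_polyField_ae_eq hΩ hL hpp
  have hb : Bornology.IsBounded (simplex s) := (isCompact_simplex s).isBounded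
  have hI : IntegrableOn (T.brokenGrad j (P w)) (simplex s) := by
    refine IntegrableOn.congr_set_ae ?_ (interior_ae_eq_simplex s).symm
    exact ((integrableOn_of_continuous (continuous_classGrad j (contDiff_polyField (R s)))
      (hb.subset interior_subset)).congr
      (T.brokenGrad_ae_eq (fun s hs => (hR s hs).2) j hs).symm)
  have hJ : ∀ k ∈ Finset.range (ℓ + 1),
      IntegrableOn (weakGrad Ω k (w : VField Ω)) (T.patch s) := fun k hk =>
    T.integrableOn_patch hΩ hL (memLp_one_iff_integrable.1 (memLp_weakGrad hΩ
      (Nat.lt_succ_iff.1 (Finset.mem_range.1 hk)) hw)) s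
  set I := ∫ x in simplex s, ‖T.brokenGrad j (P w) x‖ with hIdef
  set J : ℕ → ℝ := fun k => ∫ x in T.patch s, ‖weakGrad Ω k (w : VField Ω) x‖ with hJdef
  have hI0 : 0 ≤ I := integral_nonneg fun _ => norm_nonneg _
  have hJ0 : ∀ k, 0 ≤ J k := fun k => integral_nonneg fun _ => norm_nonneg _
  have hpatch : simplex s ⊆ T.patch s := T.simplex_subset_patch hs (by
    rw [inter_self]
    exact (T.interior_simplex_nonempty hs).mono interior_subset)
  have hfin : volume (T.patch s) ≠ ⊤ :=
    ((T.isBounded.closure.subset T.patch_subset).measure_lt_top).ne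
  have hvs : 0 < volume.real (simplex s) := by
    refine ENNReal.toReal_pos ?_ hb.measure_lt_top.ne
    exact ((isOpen_interior.measure_pos volume (T.interior_simplex_nonempty hs)).trans_le
      (measure_mono interior_subset)).ne'
  have hvp : volume.real (simplex s) ≤ volume.real (T.patch s) := measureReal_mono hpatch hfin
  have hdiam := T.cellDiam_le_meshSize hs
  obtain ⟨x, hx⟩ := ha s hs
  have hdiam2 : 2 * a * T.meshSize ≤ cellDiam s := by
    have := two_mul_le_cellDiam hd (by positivity) hx
    linarith
  have hdiam0 : 0 ≤ cellDiam s := le_trans (by positivity) hdiam2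
  -- The means become integrals after multiplication by |K|, because |K| ≤ |S_K|; powers of h_K are
  -- replaced using 2ah ≤ h_K ≤ h. Passing to |A| avoids a sign condition on A.
  have hreal : (2 * a * T.meshSize) ^ j * I
      ≤ |A| * ∑ k ∈ Finset.range (ℓ + 1), T.meshSize ^ k * J k := by
    have h1 : cellDiam s ^ j * ((volume.real (simplex s))⁻¹ * I)
        ≤ A * ∑ k ∈ Finset.range (ℓ + 1),
          cellDiam s ^ k * ((volume.real (T.patch s))⁻¹ * J k) := by
      have h := hP w hw s hs
      simp only [setAverage_eq, smul_eq_mul] at h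
      refine le_trans ?_ h
      refine Finset.single_le_sum (f := fun j => cellDiam s ^ j * ((volume.real (simplex s))⁻¹ *
        ∫ x in simplex s, ‖T.brokenGrad j (P w) x‖)) (fun i _ => ?_)
        (Finset.mem_range.2 (Nat.lt_succ_of_le hj))
      have : 0 ≤ ∫ x in simplex s, ‖T.brokenGrad i (P w) x‖ :=
        integral_nonneg fun _ => norm_nonneg _
      positivity
    have h2 : A * ∑ k ∈ Finset.range (ℓ + 1),
          cellDiam s ^ k * ((volume.real (T.patch s))⁻¹ * J k)
        ≤ |A| * ∑ k ∈ Finset.range (ℓ + 1),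
          T.meshSize ^ k * ((volume.real (simplex s))⁻¹ * J k) := by
      refine mul_le_mul (le_abs_self A) (Finset.sum_le_sum fun k _ => ?_)
        (Finset.sum_nonneg fun k _ => ?_) (abs_nonneg A)
      · have := hJ0 k
        gcongr
      · have := hJ0 k
        positivity
    have h3 := mul_le_mul_of_nonneg_left (h1.trans h2) hvs.le
    have h4 : volume.real (simplex s) * (cellDiam s ^ j * ((volume.real (simplex s))⁻¹ * I))
        = cellDiam s ^ j * I := by field_simp
    have h5 : volume.real (simplex s) * (|A| * ∑ k ∈ Finset.range (ℓ + 1),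
          T.meshSize ^ k * ((volume.real (simplex s))⁻¹ * J k))
        = |A| * ∑ k ∈ Finset.range (ℓ + 1), T.meshSize ^ k * J k := by
      rw [mul_left_comm, Finset.mul_sum]
      congr 1
      refine Finset.sum_congr rfl fun k _ => ?_
      field_simp
    rw [h4, h5] at h3
    refine le_trans ?_ h3
    gcongr
  rw [← ofReal_integral_norm_eq_lintegral_enorm hI]
  have hsum : ∑ k ∈ Finset.range (ℓ + 1), ENNReal.ofReal T.meshSize ^ k *
        ∫⁻ x in T.patch s, ‖weakGrad Ω k (w : VField Ω) x‖ₑ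
      = ENNReal.ofReal (∑ k ∈ Finset.range (ℓ + 1), T.meshSize ^ k * J k) := by
    rw [ENNReal.ofReal_sum_of_nonneg fun k _ => mul_nonneg (by positivity) (hJ0 k)]
    refine Finset.sum_congr rfl fun k hk => ?_
    rw [← ofReal_integral_norm_eq_lintegral_enorm (hJ k hk), ENNReal.ofReal_mul (by positivity),
      ENNReal.ofReal_pow hh.le]
  rw [hsum, ← ENNReal.ofReal_mul (abs_nonneg A), ← ENNReal.ofReal_pow (by positivity),
    ← ENNReal.ofReal_mul (by positivity)]
  exact ENNReal.ofReal_le_ofReal hreal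

end Triangulation

theorem lpN_le_of_enorm_le {d : ℕ} {F : Type*} [NormedAddCommGroup F] {D : Set (E d)}
    (hD : MeasurableSet D) {r : ℝ} (hr : 0 < r) {f : E d → F} {K : ℝ≥0∞}
    (hf : ∀ x ∈ D, ‖f x‖ₑ ≤ K) : lpN D r f ≤ K * volume D ^ (1 / r) := by
  have h : ∫⁻ x in D, ‖f x‖ₑ ^ r ≤ K ^ r * volume D := by
    rw [← setLIntegral_const]
    exact setLIntegral_mono' hD fun x hx => ENNReal.rpow_le_rpow (hf x hx) hr.le
  refine (ENNReal.rpow_le_rpow h (by positivity)).trans (le_of_eq ?_)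
  rw [ENNReal.mul_rpow_of_nonneg _ _ (by positivity), ← ENNReal.rpow_mul,
    mul_one_div_cancel hr.ne', ENNReal.rpow_one]

theorem mem_sobolev_one {d : ℕ} {Ω : Set (E d)} (hb : Bornology.IsBounded Ω) {ℓ : ℕ} {q : ℝ≥0∞}
    (hq : 1 ≤ q) {u : VField Ω} (hu : u ∈ sobolev Ω ℓ q) : u ∈ sobolev Ω ℓ 1 := by
  intro j hj
  obtain ⟨U, hU, hUq⟩ := hu j hj
  have : IsFiniteMeasure (volume.restrict Ω) := ⟨by simpa using hb.measure_lt_top⟩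
  exact ⟨U, hU, hUq.mono_exponent hq⟩

namespace Triangulation

variable {d : ℕ}

/-- The inverse estimate on a cell. -/
theorem exists_enorm_classGrad_le (j k₁ : ℕ) {a : ℝ} (ha0 : 0 < a) :
    ∃ C : ℝ≥0∞, C ≠ ⊤ ∧ ∀ (Ω : Set (E d)) (T : Triangulation Ω), T.IsRegular a →
      0 < T.meshSize → ∀ s ∈ T.cells, ∀ R : Fin d → MvPolynomial (Fin d) ℝ,
      (∀ c, (R c).totalDegree ≤ k₁) → ∀ y ∈ simplex s,
      ‖classGrad j (polyField R) y‖ₑ ≤ C * ENNReal.ofReal T.meshSize ^ (-(d : ℝ)) *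
        ∫⁻ x in interior (simplex s), ‖classGrad j (polyField R) x‖ₑ := by
  obtain ⟨C, hC, H⟩ := exists_enorm_classGrad_le_lintegral (d := d) k₁ j (1 / a)
  have ha' : ENNReal.ofReal a ^ (-(d : ℝ)) ≠ ⊤ :=
    ENNReal.rpow_ne_top_of_ne_zero (by simpa using ha0) ENNReal.ofReal_ne_top
  refine ⟨C * ENNReal.ofReal a ^ (-(d : ℝ)), by finiteness, ?_⟩
  intro Ω T ha hh s hs R hR y hy
  obtain ⟨x, hx⟩ := ha s hs
  have hxs : x ∈ simplex s := hx (Metric.mem_closedBall_self (by positivity))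
  have h := H R hR x (a * T.meshSize) (by positivity) y (by
    rw [show 1 / a * (a * T.meshSize) = T.meshSize by field_simp]
    exact T.simplex_subset_closedBall hs hxs hy)
  rw [ENNReal.ofReal_mul ha0.le, ENNReal.mul_rpow_of_ne_top ENNReal.ofReal_ne_top
    ENNReal.ofReal_ne_top, ← mul_assoc] at h
  refine h.trans ?_
  gcongr
  exact interior_maximal (Metric.ball_subset_closedBall.trans hx) Metric.isOpen_ball

/-- The error estimate on a cell. -/
theorem exists_lpN_cell_le (hd : 1 ≤ d) {ℓ m j r₀ r₁ : ℕ} (hℓ : ℓ ≤ r₀ + 1) (hjm : j ≤ m)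
    (hml : m ≤ ℓ) {q r : ℝ} (hq : 1 ≤ q) (hr : 1 ≤ r)
    (hθ : r ≤ q ∨ d * (1 / q - 1 / r) < (ℓ - m : ℕ)) {a : ℝ} (ha0 : 0 < a) (ha1 : a ≤ 1)
    (A : ℝ) :
    ∃ C : ℝ≥0∞, C ≠ ⊤ ∧ ∀ (Ω : Set (E d)), IsOpen Ω → HasLipschitzBoundary Ω →
      ∀ T : Triangulation Ω, T.IsRegular a → 0 < T.meshSize →
      ∀ (ℓ₀ : ℕ) (P : sobolev Ω ℓ₀ 1 →ₗ[ℝ] VField Ω), (∀ v, IsPiecewisePoly T r₁ (P v)) →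
      LocallyStable T P ℓ m A → ReproducesPoly P r₀ →
      ∀ v : sobolev Ω ℓ₀ 1, (v : VField Ω) ∈ sobolev Ω ℓ (ENNReal.ofReal q) → ∀ s ∈ T.cells,
      ENNReal.ofReal T.meshSize ^ j *
        lpN (interior (simplex s)) r (T.brokenGrad j ((v : VField Ω) - P v))
        ≤ C * (ENNReal.ofReal T.meshSize ^ (ℓ + d * (1 / r - 1 / q)) *
          lpN (T.patch s) q (weakGrad Ω ℓ (v : VField Ω))) := by
  have hjl : j ≤ ℓ := hjm.trans hml
  have hr0 : 0 < r := by linarith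
  have hq0 : 0 < q := by linarith
  have hq1 : 0 ≤ 1 - 1 / q := by
    rw [sub_nonneg, div_le_one hq0]
    exact hq
  have hθj : r ≤ q ∨ d * (1 / q - 1 / r) < (ℓ - j : ℕ) :=
    hθ.imp_right fun h => h.trans_le (by exact_mod_cast Nat.sub_le_sub_left hjm ℓ)
  obtain ⟨C₁, hC₁, H₁⟩ := IsJetApprox.exists_lpN_le (d := d) hjl hq hr hθj
  obtain ⟨C₂, hC₂, H₂⟩ := exists_measure_simplex_rpow_le d ha0 (1 / r - 1 / q)
  obtain ⟨C₃, hC₃, H₃⟩ := exists_measure_simplex_rpow_le d ha0 (1 / r)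
  obtain ⟨C₄, hC₄, H₄⟩ := exists_enorm_classGrad_le (d := d) j r₁ ha0
  -- The bound k ≤ ℓ is placed after the constant, so that the constants form a function of k and
  -- can be summed.
  have hpatch : ∀ k : ℕ, ∃ C : ℝ≥0∞, k ≤ ℓ → C ≠ ⊤ ∧ ∀ (Ω : Set (E d)) (_ : IsOpen Ω)
      (_ : HasLipschitzBoundary Ω)
      (T : Triangulation Ω) (_ : T.IsRegular a) (_ : 0 < T.meshSize) (u : E d → E d)
      (U : ∀ k, E d → GradVal d k) (_ : ∀ k ≤ ℓ, IsWeakGrad Ω k u (U k))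
      (_ : ∀ k ≤ ℓ, IntegrableOn (U k) Ω) (s) (_ : s ∈ T.cells) (Q)
      (_ : IsJetApprox (interior (simplex s)) ℓ U Q),
      ∫⁻ x in T.patch s, ‖U k x - classGrad k (polyField Q) x‖ₑ
        ≤ C * (ENNReal.ofReal T.meshSize ^ (ℓ - k) * ∫⁻ x in T.patch s, ‖U ℓ x‖ₑ) := by
    intro k
    by_cases hk : k ≤ ℓ
    · obtain ⟨C, h⟩ := exists_lintegral_patch_le hd hk ha0 ha1
      exact ⟨C, fun _ => h⟩
    · exact ⟨0, fun h => absurd h hk⟩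
  choose C₅ hC₅ using hpatch
  have ha2 : ENNReal.ofReal (2 * a) ^ j ≠ 0 := pow_ne_zero _ (by simpa using ha0)
  set N₁ := ENNReal.ofReal ((2 / a) ^ d) * volume (Metric.ball (0 : E d) 1) with hN₁
  have hN₁top : N₁ ≠ ⊤ := ENNReal.mul_ne_top ENNReal.ofReal_ne_top measure_ball_lt_top.ne
  set S := ∑ k ∈ Finset.range (ℓ + 1), C₅ k with hS
  have hStop : S ≠ ⊤ := ENNReal.sum_ne_top.2 fun k hk =>
    (hC₅ k (Nat.lt_succ_iff.1 (Finset.mem_range.1 hk))).1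
  refine ⟨C₁ * C₂ + C₄ * (ENNReal.ofReal (2 * a) ^ j)⁻¹ * ENNReal.ofReal |A| * S *
    N₁ ^ (1 - 1 / q) * C₃, by finiteness, ?_⟩
  intro Ω hΩ hL T ha hh ℓ₀ P hpp hstab hrep v hv s hs
  set H := ENNReal.ofReal T.meshSize with hH
  have hH0 : H ≠ 0 := by simpa [hH] using hh
  have hHt : H ≠ ⊤ := ENNReal.ofReal_ne_top
  have hb := T.isBounded
  have hone : (1 : ℝ≥0∞) ≤ ENNReal.ofReal q := ENNReal.one_le_ofReal.2 hq
  have hv1 : (v : VField Ω) ∈ sobolev Ω ℓ 1 := mem_sobolev_one hb hone hv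
  set U : ∀ k, E d → GradVal d k := fun k => weakGrad Ω k (v : VField Ω) with hUdef
  have hU : ∀ k ≤ ℓ, IsWeakGrad Ω k (v : VField Ω) (U k) := fun k hk =>
    isWeakGrad_of_mem_sobolev hk hv1
  have hi : ∀ k ≤ ℓ, IntegrableOn (U k) Ω := fun k hk =>
    memLp_one_iff_integrable.1 (memLp_weakGrad hΩ hk hv1)
  have hsΩ := T.interior_simplex_subset hΩ hL hs
  have hsb : Bornology.IsBounded (simplex s) := (isCompact_simplex s).isBounded
  have hne := T.interior_simplex_nonempty hs
  obtain ⟨Q, hQ⟩ := IsJetApprox.exists_of_isWeakGrad isOpen_interior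
    (hsb.subset interior_subset) hne hsΩ hU hi
  have hQc := contDiff_polyField Q
  let p : VField Ω := AEEqFun.mk (polyField Q) hQc.continuous.aestronglyMeasurable
  have hp : p =ᵐ[volume.restrict Ω] polyField Q := AEEqFun.coeFn_mk _ _
  let p' : sobolev Ω ℓ₀ 1 := ⟨p, mem_sobolev_of_contDiff hb hQc hp ℓ₀ 1⟩
  -- The mean polynomial has degree at most ℓ − 1 ≤ r₀, so it is reproduced.
  have hPp : P p' = p := hrep p' ⟨polyField Q, isPolyField_iff.2 ⟨Q, fun c =>
    (hQ.totalDegree_le c).trans (by omega), rfl⟩, hp⟩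
  set w : sobolev Ω ℓ₀ 1 := v - p' with hw
  have hwv : (w : VField Ω) = v - p := rfl
  have hw1 : (w : VField Ω) ∈ sobolev Ω ℓ 1 :=
    (sobolev Ω ℓ 1).sub_mem hv1 (mem_sobolev_of_contDiff hb hQc hp ℓ 1)
  have hPw : (v : VField Ω) - P v = (w : VField Ω) - P w := by
    have h1 : P w = P v - p := by
      rw [← hPp]
      exact map_sub P v p'
    rw [h1, hwv]
    abel
  obtain ⟨R, hR⟩ := T.exists_polyField_ae_eq hΩ hL (hpp w)
  have hwgrad : ∀ k ≤ ℓ, IsWeakGrad Ω k (w : VField Ω)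
      (fun x => U k x - classGrad k (polyField Q) x) := fun k hk =>
    ((hU k hk).sub ((isWeakGrad_of_contDiff k hQc).congr hp.symm)).congr
      (AEEqFun.coeFn_sub _ _).symm
  have hmeas : MeasurableSet (interior (simplex s)) := isOpen_interior.measurableSet
  obtain ⟨x, hx⟩ := hne
  have hsub : interior (simplex s) ⊆ Metric.closedBall x T.meshSize :=
    interior_subset.trans (T.simplex_subset_closedBall hs (interior_subset hx))
  have hspatch : interior (simplex s) ⊆ T.patch s := interior_subset.trans
    (T.simplex_subset_patch hs ⟨x, interior_subset hx, interior_subset hx⟩)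
  have hvol : volume (interior (simplex s)) = volume (simplex s) :=
    measure_congr (interior_ae_eq_simplex s)
  set L := lpN (T.patch s) q (U ℓ) with hLdef
  have hsplit : lpN (interior (simplex s)) r (T.brokenGrad j ((v : VField Ω) - P v))
      ≤ lpN (interior (simplex s)) r (fun x => U j x - classGrad j (polyField Q) x)
        + lpN (interior (simplex s)) r (classGrad j (polyField (R s))) := by
    rw [lpN_eq_eLpNorm _ hr0, lpN_eq_eLpNorm _ hr0, lpN_eq_eLpNorm _ hr0, hPw,
      eLpNorm_congr_ae (T.brokenGrad_sub_ae_eq hΩ hL (hwgrad j hjl)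
        (fun s hs => (hR s hs).2) hs)]
    exact eLpNorm_sub_le (hQ.isMeanZeroJet.measurable j hjl)
      (continuous_classGrad j (contDiff_polyField _)).aestronglyMeasurable
      (ENNReal.one_le_ofReal.2 hr)
  have hfirst : H ^ j * lpN (interior (simplex s)) r
      (fun x => U j x - classGrad j (polyField Q) x)
      ≤ C₁ * C₂ * (H ^ (ℓ + d * (1 / r - 1 / q)) * L) := by
    have h1 := H₁ _ U Q x T.meshSize (convex_simplex s).interior isOpen_interior ⟨x, hx⟩ hsub hQ
    rw [hvol] at h1
    have h2 : lpN (interior (simplex s)) q (U ℓ) ≤ L :=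
      ENNReal.rpow_le_rpow (lintegral_mono_set hspatch) (by positivity)
    have h3 : H ^ j * H ^ (ℓ - j) = H ^ (ℓ : ℝ) := by
      rw [← pow_add, Nat.add_sub_cancel' hjl, ENNReal.rpow_natCast]
    calc H ^ j * lpN (interior (simplex s)) r (fun x => U j x - classGrad j (polyField Q) x)
        ≤ H ^ j * (C₁ * H ^ (ℓ - j) * (C₂ * H ^ (d * (1 / r - 1 / q))) * L) := by
          gcongr
          refine h1.trans ?_
          gcongr
          exact H₂ Ω T ha hh s hs
      _ = C₁ * C₂ * ((H ^ j * H ^ (ℓ - j)) * H ^ (d * (1 / r - 1 / q)) * L) := by ring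
      _ = _ := by rw [h3, ← ENNReal.rpow_add _ _ hH0 hHt]
  -- Hölder's inequality on the patch, whose volume is at most N₁ h^d.
  have hM : ∫⁻ y in T.patch s, ‖U ℓ y‖ₑ ≤ N₁ ^ (1 - 1 / q) * H ^ (d * (1 - 1 / q)) * L := by
    have h1 := lpN_le_measure_rpow_mul (D := T.patch s) (f := U ℓ)
      (T.integrableOn_patch hΩ hL (hi ℓ le_rfl) s).aestronglyMeasurable one_pos hq
    rw [lpN_one, div_one] at h1
    refine h1.trans ?_
    gcongr
    refine (ENNReal.rpow_le_rpow (T.measure_patch_le ha0 ha hh hs) hq1).trans (le_of_eq ?_)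
    rw [mul_left_comm, mul_comm, ← hN₁, ENNReal.mul_rpow_of_nonneg _ _ hq1, ← ENNReal.rpow_mul]
  have hstab' : H ^ j * ∫⁻ y in interior (simplex s), ‖classGrad j (polyField (R s)) y‖ₑ
      ≤ (ENNReal.ofReal (2 * a) ^ j)⁻¹ * ENNReal.ofReal |A| *
        (S * (H ^ ℓ * ∫⁻ y in T.patch s, ‖U ℓ y‖ₑ)) := by
    have h1 := T.lintegral_brokenGrad_le hd hΩ hL ha0 ha hh hstab hw1 (hpp w) hjm hs
    rw [← lintegral_interior, ENNReal.ofReal_mul (by positivity), mul_pow] at h1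
    have h2 : ∫⁻ y in interior (simplex s), ‖T.brokenGrad j (P w) y‖ₑ
        = ∫⁻ y in interior (simplex s), ‖classGrad j (polyField (R s)) y‖ₑ := by
      refine lintegral_congr_ae ?_
      filter_upwards [T.brokenGrad_ae_eq (fun s hs => (hR s hs).2) j hs] with y hy
      rw [hy]
    rw [h2, mul_assoc] at h1
    have h3 : ∑ k ∈ Finset.range (ℓ + 1), H ^ k *
        ∫⁻ y in T.patch s, ‖weakGrad Ω k (w : VField Ω) y‖ₑ
        ≤ S * (H ^ ℓ * ∫⁻ y in T.patch s, ‖U ℓ y‖ₑ) := by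
      rw [hS, Finset.sum_mul]
      refine Finset.sum_le_sum fun k hk => ?_
      have hk' : k ≤ ℓ := Nat.lt_succ_iff.1 (Finset.mem_range.1 hk)
      have h4 : ∫⁻ y in T.patch s, ‖weakGrad Ω k (w : VField Ω) y‖ₑ
          = ∫⁻ y in T.patch s, ‖U k y - classGrad k (polyField Q) y‖ₑ := by
        refine lintegral_congr_ae ?_
        filter_upwards [T.ae_restrict_patch hΩ hL (weakGrad_ae_eq hΩ (hwgrad k hk')) s] with y hy
        rw [hy]
      rw [h4]
      refine (mul_le_mul_right ((hC₅ k hk').2 Ω hΩ hL T ha hh _ U hU hi s hs Q hQ) _).trans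
        (le_of_eq ?_)
      rw [mul_left_comm, ← mul_assoc (H ^ k), ← pow_add, Nat.add_sub_cancel' hk']
    have h6 := h1.trans (mul_le_mul_right h3 _)
    rw [mul_assoc (_)⁻¹]
    refine le_trans (le_of_eq ?_) (mul_le_mul_right h6 _)
    rw [← mul_assoc, ENNReal.inv_mul_cancel ha2 (by finiteness), one_mul]
  have hsecond : H ^ j * lpN (interior (simplex s)) r (classGrad j (polyField (R s)))
      ≤ C₄ * (ENNReal.ofReal (2 * a) ^ j)⁻¹ * ENNReal.ofReal |A| * S * N₁ ^ (1 - 1 / q) * C₃ *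
        (H ^ (ℓ + d * (1 / r - 1 / q)) * L) := by
    have h1 := lpN_le_of_enorm_le hmeas hr0 (fun y hy =>
      H₄ Ω T ha hh s hs (R s) (hR s hs).1 y (interior_subset hy))
    rw [hvol] at h1
    -- The powers of h come, in this order, from the inverse estimate, from stability with
    -- approximation on the patch, from Hölder's inequality on the patch, and from |K|^(1/r).
    have hexp : H ^ (-(d : ℝ)) * H ^ ℓ * H ^ (d * (1 - 1 / q)) * H ^ (d * (1 / r))
        = H ^ (ℓ + d * (1 / r - 1 / q)) := by
      rw [← ENNReal.rpow_natCast, ← ENNReal.rpow_add _ _ hH0 hHt, ← ENNReal.rpow_add _ _ hH0 hHt,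
        ← ENNReal.rpow_add _ _ hH0 hHt]
      congr 1
      ring
    calc H ^ j * lpN (interior (simplex s)) r (classGrad j (polyField (R s)))
        ≤ H ^ j * (C₄ * H ^ (-(d : ℝ)) *
          (∫⁻ y in interior (simplex s), ‖classGrad j (polyField (R s)) y‖ₑ)
            * volume (simplex s) ^ (1 / r)) := by gcongr
      _ = C₄ * H ^ (-(d : ℝ)) * (H ^ j *
          ∫⁻ y in interior (simplex s), ‖classGrad j (polyField (R s)) y‖ₑ)
            * volume (simplex s) ^ (1 / r) := by ring
      _ ≤ C₄ * H ^ (-(d : ℝ)) * ((ENNReal.ofReal (2 * a) ^ j)⁻¹ * ENNReal.ofReal |A| *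
          (S * (H ^ ℓ * (N₁ ^ (1 - 1 / q) * H ^ (d * (1 - 1 / q)) * L))))
            * (C₃ * H ^ (d * (1 / r))) := by
          refine mul_le_mul' (mul_le_mul_right (hstab'.trans ?_) _) (H₃ Ω T ha hh s hs)
          gcongr
      _ = C₄ * (ENNReal.ofReal (2 * a) ^ j)⁻¹ * ENNReal.ofReal |A| * S * N₁ ^ (1 - 1 / q) * C₃ *
          ((H ^ (-(d : ℝ)) * H ^ ℓ * H ^ (d * (1 - 1 / q)) * H ^ (d * (1 / r))) * L) := by ring
      _ = _ := by rw [hexp]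
  refine (mul_le_mul_right hsplit _).trans ?_
  rw [mul_add, add_mul]
  exact add_le_add hfirst hsecond

end Triangulation

theorem lpN_rpow {d : ℕ} {F : Type*} [NormedAddCommGroup F] (D : Set (E d)) {p : ℝ} (hp : 0 < p)
    (u : E d → F) : lpN D p u ^ p = ∫⁻ x in D, ‖u x‖ₑ ^ p := by
  rw [lpN, ← ENNReal.rpow_mul, one_div_mul_cancel hp.ne', ENNReal.rpow_one]

/-! ### Summation over the cells -/

section SumInequalities

variable {ι : Type*}

/-- Each term is at most the ℓ^q norm; this bounds the surplus power r − q of every term. -/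
theorem sum_rpow_rpow_le_of_le (S : Finset ι) (x : ι → ℝ≥0∞) {q r : ℝ} (hq : 0 < q)
    (hqr : q ≤ r) : (∑ i ∈ S, x i ^ r) ^ (1 / r) ≤ (∑ i ∈ S, x i ^ q) ^ (1 / q) := by
  have hr : 0 < r := hq.trans_le hqr
  set X := ∑ i ∈ S, x i ^ q with hX
  have hx : ∀ i ∈ S, x i ≤ X ^ (1 / q) := fun i hi => by
    rw [one_div, ENNReal.le_rpow_inv_iff hq]
    exact Finset.single_le_sum (f := fun i => x i ^ q) (fun _ _ => zero_le) hi
  rw [one_div r, ENNReal.rpow_inv_le_iff hr, ← ENNReal.rpow_mul]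
  calc ∑ i ∈ S, x i ^ r ≤ ∑ i ∈ S, x i ^ q * (X ^ (1 / q)) ^ (r - q) := by
        refine Finset.sum_le_sum fun i hi => ?_
        have h : x i ^ r = x i ^ q * x i ^ (r - q) := by
          rw [← ENNReal.rpow_add_of_nonneg _ _ hq.le (sub_nonneg.2 hqr), add_sub_cancel]
        rw [h]
        exact mul_le_mul_right (ENNReal.rpow_le_rpow (hx i hi) (sub_nonneg.2 hqr)) _
    _ = X ^ (1 : ℝ) * X ^ (1 / q * (r - q)) := by
        rw [← Finset.sum_mul, ENNReal.rpow_one, ← ENNReal.rpow_mul]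
    _ = X ^ (1 / q * r) := by
        rw [← ENNReal.rpow_add_of_nonneg _ _ zero_le_one
          (mul_nonneg (by positivity) (sub_nonneg.2 hqr))]
        congr 1
        field_simp
        ring

theorem sum_rpow_rpow_le_card_mul (S : Finset ι) (x : ι → ℝ≥0∞) {q r : ℝ} (hr : 0 < r)
    (hrq : r ≤ q) : (∑ i ∈ S, x i ^ r) ^ (1 / r)
      ≤ (S.card : ℝ≥0∞) ^ (1 / r - 1 / q) * (∑ i ∈ S, x i ^ q) ^ (1 / q) := by
  have hq : 0 < q := hr.trans_le hrq
  have h := ENNReal.rpow_sum_le_const_mul_sum_rpow S (fun i => x i ^ r) (p := q / r)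
    ((one_le_div hr).2 hrq)
  have h1 := ENNReal.rpow_le_rpow h (z := 1 / q) (by positivity)
  rw [ENNReal.mul_rpow_of_nonneg _ _ (by positivity), ← ENNReal.rpow_mul,
    ← ENNReal.rpow_mul] at h1
  simp only [← ENNReal.rpow_mul, mul_div_cancel₀ q hr.ne'] at h1
  rwa [show q / r * (1 / q) = 1 / r by field_simp,
    show (q / r - 1) * (1 / q) = 1 / r - 1 / q by field_simp] at h1

end SumInequalities

namespace Triangulation

variable {d : ℕ} {Ω : Set (E d)} (T : Triangulation Ω)

theorem lintegral_eq_sum_cells (hΩ : IsOpen Ω) (hL : HasLipschitzBoundary Ω) (f : E d → ℝ≥0∞) :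
    ∫⁻ x in Ω, f x = ∑ s ∈ T.finite_cells.toFinset, ∫⁻ x in interior (simplex s), f x := by
  rw [← setLIntegral_congr (T.interiors_ae_eq hΩ hL), ← lintegral_biUnion_finset]
  · simp [interiors]
  · intro s hs t ht hst
    exact T.disjoint_interior (by simpa using hs) (by simpa using ht) hst
  · exact fun s _ => isOpen_interior.measurableSet

/-- Touching is symmetric, so after exchanging the sums each cell is counted as often as there are
cells touching it, which is boundedly often. -/
theorem sum_lintegral_patch_le (hΩ : IsOpen Ω) (hL : HasLipschitzBoundary Ω) {a : ℝ} (ha0 : 0 < a)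
    (ha : T.IsRegular a) (hh : 0 < T.meshSize) (f : E d → ℝ≥0∞) :
    ∑ s ∈ T.finite_cells.toFinset, ∫⁻ x in T.patch s, f x
      ≤ ENNReal.ofReal ((2 / a) ^ d) * ∫⁻ x in Ω, f x := by
  calc ∑ s ∈ T.finite_cells.toFinset, ∫⁻ x in T.patch s, f x
      ≤ ∑ s ∈ T.finite_cells.toFinset, ∑ t ∈ T.touching s, ∫⁻ x in simplex t, f x := by
        refine Finset.sum_le_sum fun s _ => ?_
        rw [patch_eq_biUnion_touching]
        exact lintegral_biUnion_finset_le _ _ _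
    _ = ∑ t ∈ T.finite_cells.toFinset, ∑ _s ∈ T.touching t, ∫⁻ x in simplex t, f x := by
        refine Finset.sum_comm' fun s t => ?_
        simp only [mem_touching, Finite.mem_toFinset]
        rw [inter_comm (simplex t)]
        tauto
    _ ≤ ∑ t ∈ T.finite_cells.toFinset,
          ENNReal.ofReal ((2 / a) ^ d) * ∫⁻ x in interior (simplex t), f x := by
        refine Finset.sum_le_sum fun t ht => ?_
        rw [Finset.sum_const, nsmul_eq_mul, lintegral_interior]
        gcongr
        rw [← ENNReal.ofReal_natCast]
        exact ENNReal.ofReal_le_ofReal (T.card_touching_le ha0 ha hh (by simpa using ht))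
    _ = _ := by rw [← Finset.mul_sum, ← T.lintegral_eq_sum_cells hΩ hL]

/-- Summation of local estimates over the cells. -/
theorem lpN_le_of_cell_le (hΩ : IsOpen Ω) (hL : HasLipschitzBoundary Ω) {F G : Type*}
    [NormedAddCommGroup F] [NormedAddCommGroup G] {f : E d → F} {g : E d → G} {q r : ℝ}
    (hq : 0 < q) (hr : 0 < r) {a : ℝ} (ha0 : 0 < a) (ha : T.IsRegular a) (hh : 0 < T.meshSize)
    {B K N : ℝ≥0∞}
    (h : ∀ s ∈ T.cells, B * lpN (interior (simplex s)) r f ≤ K * lpN (T.patch s) q g)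
    (hN : ∀ x : Finset (E d) → ℝ≥0∞, (∑ s ∈ T.finite_cells.toFinset, x s ^ r) ^ (1 / r)
      ≤ N * (∑ s ∈ T.finite_cells.toFinset, x s ^ q) ^ (1 / q)) :
    B * lpN Ω r f ≤ K * N * ENNReal.ofReal ((2 / a) ^ d) ^ (1 / q) * lpN Ω q g := by
  have h1 : B * lpN Ω r f = (∑ s ∈ T.finite_cells.toFinset,
      (B * lpN (interior (simplex s)) r f) ^ r) ^ (1 / r) := by
    have hB : B = (B ^ r) ^ (1 / r) := by
      rw [← ENNReal.rpow_mul, mul_one_div_cancel hr.ne', ENNReal.rpow_one]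
    simp only [ENNReal.mul_rpow_of_nonneg _ _ hr.le, lpN_rpow _ hr]
    rw [← Finset.mul_sum, ← T.lintegral_eq_sum_cells hΩ hL,
      ENNReal.mul_rpow_of_nonneg _ _ (by positivity), ← hB, lpN]
  have hK : K = (K ^ r) ^ (1 / r) := by
    rw [← ENNReal.rpow_mul, mul_one_div_cancel hr.ne', ENNReal.rpow_one]
  calc B * lpN Ω r f
      ≤ (∑ s ∈ T.finite_cells.toFinset, (K * lpN (T.patch s) q g) ^ r) ^ (1 / r) := by
        rw [h1]
        refine ENNReal.rpow_le_rpow (Finset.sum_le_sum fun s hs => ?_) (by positivity)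
        exact ENNReal.rpow_le_rpow (h s (by simpa using hs)) hr.le
    _ = K * (∑ s ∈ T.finite_cells.toFinset, lpN (T.patch s) q g ^ r) ^ (1 / r) := by
        simp only [ENNReal.mul_rpow_of_nonneg _ _ hr.le]
        rw [← Finset.mul_sum, ENNReal.mul_rpow_of_nonneg _ _ (by positivity), ← hK]
    _ ≤ K * (N * (ENNReal.ofReal ((2 / a) ^ d) * ∫⁻ x in Ω, ‖g x‖ₑ ^ q) ^ (1 / q)) := by
        gcongr
        refine (hN _).trans ?_
        gcongr
        refine le_trans (le_of_eq ?_) (T.sum_lintegral_patch_le hΩ hL ha0 ha hh _)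
        exact Finset.sum_congr rfl fun s _ => lpN_rpow _ hq _
    _ = _ := by
        rw [ENNReal.mul_rpow_of_nonneg _ _ (by positivity), lpN]
        ring

/-- The number of cells is bounded in terms of the volume of the domain. -/
theorem card_cells_rpow_le (hΩ : IsOpen Ω) (hL : HasLipschitzBoundary Ω) {a : ℝ} (ha0 : 0 < a)
    (ha : T.IsRegular a) (hh : 0 < T.meshSize) {V : ℝ≥0∞} (hV : volume Ω ≤ V) {e : ℝ}
    (he : 0 ≤ e) : (T.finite_cells.toFinset.card : ℝ≥0∞) ^ e
      ≤ (V * (ENNReal.ofReal a ^ (d : ℝ) * volume (Metric.ball (0 : E d) 1))⁻¹) ^ e *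
        ENNReal.ofReal T.meshSize ^ (-(d * e)) := by
  set b := ENNReal.ofReal a ^ (d : ℝ) * volume (Metric.ball (0 : E d) 1) with hb
  have ha' : ENNReal.ofReal a ≠ 0 := by simpa using ha0
  have hb0 : b ≠ 0 := mul_ne_zero (by simp [ha']) (Metric.measure_ball_pos volume _ one_pos).ne'
  have hb1 : b ≠ ⊤ := ENNReal.mul_ne_top (by finiteness) measure_ball_lt_top.ne
  have hH0 : ENNReal.ofReal T.meshSize ≠ 0 := by simpa using hh
  have h := (T.card_cells_mul_le hΩ hL ha0 ha hh).trans hV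
  have h1 : ENNReal.ofReal T.meshSize ^ (d : ℝ) * ENNReal.ofReal T.meshSize ^ (-(d : ℝ)) = 1 := by
    rw [← ENNReal.rpow_add _ _ hH0 ENNReal.ofReal_ne_top, add_neg_cancel, ENNReal.rpow_zero]
  have h2 : (T.finite_cells.toFinset.card : ℝ≥0∞)
      ≤ V * b⁻¹ * ENNReal.ofReal T.meshSize ^ (-(d : ℝ)) := by
    calc (T.finite_cells.toFinset.card : ℝ≥0∞)
        = T.finite_cells.toFinset.card * (ENNReal.ofReal T.meshSize ^ (d : ℝ) *
          ENNReal.ofReal T.meshSize ^ (-(d : ℝ))) * (b * b⁻¹) := by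
          rw [h1, ENNReal.mul_inv_cancel hb0 hb1, mul_one, mul_one]
      _ = (T.finite_cells.toFinset.card * (ENNReal.ofReal T.meshSize ^ (d : ℝ) * b)) *
          (b⁻¹ * ENNReal.ofReal T.meshSize ^ (-(d : ℝ))) := by ring
      _ ≤ V * (b⁻¹ * ENNReal.ofReal T.meshSize ^ (-(d : ℝ))) := mul_le_mul_left h _
      _ = _ := by rw [mul_assoc]
  refine (ENNReal.rpow_le_rpow h2 he).trans (le_of_eq ?_)
  rw [ENNReal.mul_rpow_of_nonneg _ _ he, ← ENNReal.rpow_mul, neg_mul]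

/-- The error estimate for one derivative. -/
theorem exists_lpN_le (hd : 1 ≤ d) {ℓ m j r₀ r₁ : ℕ} (hℓ : ℓ ≤ r₀ + 1) (hjm : j ≤ m)
    (hml : m ≤ ℓ) {q r : ℝ} (hq : 1 ≤ q) (hr : 1 ≤ r)
    (hθ : r ≤ q ∨ d * (1 / q - 1 / r) < (ℓ - m : ℕ)) {a : ℝ} (ha0 : 0 < a) (ha1 : a ≤ 1)
    (A V : ℝ) :
    ∃ C : ℝ≥0∞, C ≠ ⊤ ∧ ∀ (Ω : Set (E d)), IsOpen Ω → HasLipschitzBoundary Ω →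
      (r < q → volume Ω ≤ ENNReal.ofReal V) →
      ∀ T : Triangulation Ω, T.IsRegular a → 0 < T.meshSize →
      ∀ (ℓ₀ : ℕ) (P : sobolev Ω ℓ₀ 1 →ₗ[ℝ] VField Ω), (∀ v, IsPiecewisePoly T r₁ (P v)) →
      LocallyStable T P ℓ m A → ReproducesPoly P r₀ →
      ∀ v : sobolev Ω ℓ₀ 1, (v : VField Ω) ∈ sobolev Ω ℓ (ENNReal.ofReal q) →
      ENNReal.ofReal T.meshSize ^ j * lpN Ω r (T.brokenGrad j ((v : VField Ω) - P v))
        ≤ C * (ENNReal.ofReal T.meshSize ^ (ℓ + d * min 0 (1 / r - 1 / q)) *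
          lpN Ω q (weakGrad Ω ℓ (v : VField Ω))) := by
  obtain ⟨C, hC, h⟩ := exists_lpN_cell_le (r₁ := r₁) hd hℓ hjm hml hq hr hθ ha0 ha1 A
  have hr0 : 0 < r := by linarith
  have hq0 : 0 < q := by linarith
  -- For q ≤ r no number of cells enters. For r < q the factor card^(1/r − 1/q) contributes a
  -- multiple of h^(−d(1/r − 1/q)), which cancels the extra positive power of h in the cell
  -- estimate; only this case needs the bound on the volume.
  rcases le_or_gt q r with hqr | hrq
  · refine ⟨C * ENNReal.ofReal ((2 / a) ^ d) ^ (1 / q), by finiteness, ?_⟩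
    intro Ω hΩ hL _ T ha hh ℓ₀ P hpp hstab hrep v hv
    rw [min_eq_right (sub_nonpos.2 (one_div_le_one_div_of_le hq0 hqr))]
    refine (T.lpN_le_of_cell_le hΩ hL
      (f := T.brokenGrad j ((v : VField Ω) - P v)) (g := weakGrad Ω ℓ (v : VField Ω))
      hq0 hr0 ha0 ha hh (N := 1)
      (K := C * ENNReal.ofReal T.meshSize ^ (ℓ + d * (1 / r - 1 / q))) (fun s hs => ?_)
      fun x => ?_).trans (le_of_eq (by ring))
    · exact (h Ω hΩ hL T ha hh ℓ₀ P hpp hstab hrep v hv s hs).trans (le_of_eq (by ring))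
    · rw [one_mul]
      exact sum_rpow_rpow_le_of_le _ _ hq0 hqr
  · have he : 0 ≤ 1 / r - 1 / q := sub_nonneg.2 (one_div_le_one_div_of_le hr0 hrq.le)
    set b := ENNReal.ofReal a ^ (d : ℝ) * volume (Metric.ball (0 : E d) 1) with hb
    have ha' : ENNReal.ofReal a ≠ 0 := by simpa using ha0
    have hb0 : b ≠ 0 := mul_ne_zero (by simp [ha']) (Metric.measure_ball_pos volume _ one_pos).ne'
    refine ⟨C * (ENNReal.ofReal V * b⁻¹) ^ (1 / r - 1 / q) *
      ENNReal.ofReal ((2 / a) ^ d) ^ (1 / q), by finiteness, ?_⟩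
    intro Ω hΩ hL hV T ha hh ℓ₀ P hpp hstab hrep v hv
    have hH0 : ENNReal.ofReal T.meshSize ≠ 0 := by simpa using hh
    rw [min_eq_left he, mul_zero, add_zero]
    refine (T.lpN_le_of_cell_le hΩ hL
      (f := T.brokenGrad j ((v : VField Ω) - P v)) (g := weakGrad Ω ℓ (v : VField Ω))
      hq0 hr0 ha0 ha hh
      (N := (ENNReal.ofReal V * b⁻¹) ^ (1 / r - 1 / q) *
        ENNReal.ofReal T.meshSize ^ (-(d * (1 / r - 1 / q))))
      (K := C * ENNReal.ofReal T.meshSize ^ (ℓ + d * (1 / r - 1 / q))) (fun s hs => ?_)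
      fun x => ?_).trans (le_of_eq ?_)
    · exact (h Ω hΩ hL T ha hh ℓ₀ P hpp hstab hrep v hv s hs).trans (le_of_eq (by ring))
    · refine (sum_rpow_rpow_le_card_mul _ _ hr0 hrq.le).trans ?_
      gcongr
      exact T.card_cells_rpow_le hΩ hL ha0 ha hh (hV hrq) he
    · have h1 : ENNReal.ofReal T.meshSize ^ (ℓ + d * (1 / r - 1 / q)) *
          ENNReal.ofReal T.meshSize ^ (-(d * (1 / r - 1 / q)))
          = ENNReal.ofReal T.meshSize ^ (ℓ : ℝ) := by
        rw [← ENNReal.rpow_add _ _ hH0 ENNReal.ofReal_ne_top, add_neg_cancel_right]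
      rw [← h1]
      ring

end Triangulation

/-! ### The global estimate -/

theorem mainTheorem4 (d : ℕ) (hd : 1 ≤ d) (ℓ m r₀ r₁ : ℕ) (hℓ : ℓ ≤ r₀ + 1) (hr₀ : r₀ ≤ r₁)
    (r q : ℝ) (hr : 1 ≤ r) (hq : 1 ≤ q) (γ₀ κ A V : ℝ) :
    ∃ c : ℝ, 0 < c ∧
      ∀ Ω : Set (E d), IsOpen Ω → IsConnected Ω → HasLipschitzBoundary Ω →
        (r < q → volume Ω ≤ ENNReal.ofReal V) →
        CompactEmbedding Ω ℓ (ENNReal.ofReal q) m (ENNReal.ofReal r) →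
      ∀ T : Triangulation Ω, T.NonDegenerate γ₀ → T.QuasiUniform κ →
      ∀ ℓ₀ ≤ ℓ, ∀ P : sobolev Ω ℓ₀ 1 →ₗ[ℝ] VField Ω,
        (∀ v, IsPiecewisePoly T r₁ (P v)) → LocallyStable T P ℓ m A → ReproducesPoly P r₀ →
      ∀ v : sobolev Ω ℓ₀ 1, (v : VField Ω) ∈ sobolev Ω ℓ (ENNReal.ofReal q) →
        ∑ j ∈ Finset.range (m + 1), ENNReal.ofReal (T.meshSize ^ j) *
            eLpNorm (T.brokenGrad j ((v : VField Ω) - P v)) (ENNReal.ofReal r) (volume.restrict Ω)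
          ≤ ENNReal.ofReal c * ∑ k ∈ Finset.range (ℓ + 1),
            ENNReal.ofReal (T.meshSize ^ ((ℓ : ℝ) + d * min 0 (1 / r - 1 / q))) *
              gradNorm Ω k (ENNReal.ofReal q) v := by
  -- The condition involves the exponents only, so the constant can be fixed before the domain is
  -- given.
  by_cases hcond : m ≤ ℓ ∧ (r ≤ q ∨ d * (1 / q - 1 / r) < (ℓ - m : ℕ))
  · obtain ⟨hml, hθ⟩ := hcond
    set a : ℝ := 1 / (4 * (|κ| * |γ₀| + 1)) with ha
    have hκ : 0 ≤ |κ| * |γ₀| := by positivity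
    have ha0 : 0 < a := by positivity
    have ha1 : a ≤ 1 := (div_le_one (by positivity)).2 (by linarith)
    have hex : ∀ j ∈ Finset.range (m + 1), _ := fun j hj =>
      Triangulation.exists_lpN_le (r₁ := r₁) hd hℓ (Nat.lt_succ_iff.1 (Finset.mem_range.1 hj)) hml
        hq hr hθ ha0 ha1 A V
    choose! C hC hCle using hex
    have hsum : ∑ j ∈ Finset.range (m + 1), C j ≠ ⊤ := ENNReal.sum_ne_top.2 hC
    refine ⟨(∑ j ∈ Finset.range (m + 1), C j).toReal + 1, by positivity, ?_⟩
    intro Ω hΩ hconn hL hV _ T hT1 hT2 ℓ₀ _ P hpp hstab hrep v hv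
    have hh := T.meshSize_pos hd hconn.nonempty
    have hreg := T.isRegular_of_nonDegenerate hd hconn.nonempty hT1 hT2
    rw [← ha] at hreg
    calc _ ≤ ∑ j ∈ Finset.range (m + 1), C j * (ENNReal.ofReal
          (T.meshSize ^ ((ℓ : ℝ) + d * min 0 (1 / r - 1 / q))) *
            gradNorm Ω ℓ (ENNReal.ofReal q) v) := by
          refine Finset.sum_le_sum fun j hj => ?_
          rw [gradNorm, ← lpN_eq_eLpNorm _ (by linarith), ← lpN_eq_eLpNorm _ (by linarith),
            ENNReal.ofReal_pow hh.le, ← ENNReal.ofReal_rpow_of_pos hh]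
          exact hCle j hj Ω hΩ hL hV T hreg hh ℓ₀ P hpp hstab hrep v hv
      -- Only the summand k = ℓ on the right is used.
      _ ≤ _ := by
          rw [← Finset.sum_mul]
          refine mul_le_mul' ?_ ?_
          · rw [ENNReal.ofReal_add ENNReal.toReal_nonneg zero_le_one, ENNReal.ofReal_toReal hsum]
            exact le_self_add
          · exact Finset.single_le_sum (f := fun k => ENNReal.ofReal
              (T.meshSize ^ ((ℓ : ℝ) + d * min 0 (1 / r - 1 / q))) *
              gradNorm Ω k (ENNReal.ofReal q) v) (fun _ _ => zero_le)
              (Finset.mem_range.2 (Nat.lt_succ_self ℓ))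
  -- The value 1 is arbitrary: when the condition fails, no domain admits the compact embedding.
  · refine ⟨1, one_pos, fun Ω hΩ hconn _ _ hemb T _ _ => absurd ?_ hcond⟩
    have hml := hemb.le_of_isOpen hr hd hΩ T.isBounded hconn.nonempty
    refine ⟨hml, (le_or_gt r q).imp_right fun hqr => ?_⟩
    exact hemb.lt_of_lt hq hqr hml hd hΩ T.isBounded hconn.nonempty
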